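/- Let $n\ge 1$, let $\alpha=(\alpha_1,\dots,\alpha_n)\in\mathbb R^n$ with $\alpha_j>-1$ for all $j$, let $1<p<\infty$ and let $q$ be the conjugate exponent, $p=q(p-1)$. Let $\mathcal H^n=\{z\in\mathbb C^n:\operatorname{Im} z_j>0,\ j=1,\dots,n\}$, $dV_\alpha(z)=\prod_{j=1}^n y_j^{\alpha_j}\,dx_j\,dy_j$ for $z=x+iy$, and for $1<r<\infty$ put $\|f\|_{r,\alpha}^r=\int_{\mathcal H^n}|f|^r\,dV_\alpha$; the Bergman space $A^r_\alpha(\mathcal H^n)$ consists of the analytic functions $f$ on $\mathcal H^n$ with $\|f\|_{r,\alpha}<\infty$. Let $$K^\alpha(z,w)=\prod_{j=1}^n\frac{2^{\alpha_j}(\alpha_j+1)}{\pi}\Big(\frac{z_j-\overline{w_j}}{i}\Big)^{-(2+\alpha_j)}$$ (principal branch) be the reproducing kernel of $A^2_\alpha(\mathcal H^n)$, let $k_w^\alpha=K^\alpha(\cdot,w)/\|K^\alpha(\cdot,w)\|_{2,\alpha}$, and let $T_\varphi h(z)=\int_{\mathcal H^n}K^\alpha(z,w)\varphi(w)h(w)\,dV_\alpha(w)$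 be the Toeplitz operator with symbol $\varphi$. We say that $T_fT_{\bar g}$ is bounded on $A^r_\alpha(\mathcal H^n)$ if, for every $h\in A^r_\alpha(\mathcal H^n)$, the integrals defining $T_{\bar g}h$ and $T_f(T_{\bar g}h)$ converge absolutely at every point of $\mathcal H^n$, $T_fT_{\bar g}h\in A^r_\alpha(\mathcal H^n)$, and $\|T_fT_{\bar g}h\|_{r,\alpha}\le M\|h\|_{r,\alpha}$ with a finite $M$ independent of $h$; the least such $M$ is the norm $\|T_fT_{\bar g}\|_{A^r_\alpha\to A^r_\alpha}$ (which is $\infty$ if the product is not bounded). Then there is a constant $C$, depending only on $n$, $p$ and $\alpha$, with the following property. Let $f,g$ be analytic in $\mathcal H^n$, let $f$ have no zeros, and suppose that $$[f]_{p,\alpha}:=\sup_{w\in\mathcal H^n}\|fk_w^\alpha\|_{p,\alpha}\,\|f^{-1}k_w^\alpha\|_{q,\alpha}<\infty .$$ Then $T_fT_{\bar g}$ is bounded on $A^p_\alpha(\mathcal H^n)$ if and only if $$[f,g]_{p,\alpha}:=\sup_{w\in\mathcal H^n}\|fk_w^\alpha\|_{p,\alpha}\,\|gk_w^\alpha\|_{q,\alpha}<\infty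 ,$$ and in this case $T_gT_{\bar f}$ is bounded on $A^q_\alpha(\mathcal H^n)$. Moreover, $$\|T_fT_{\bar g}\|_{A^p_\alpha\to A^p_\alpha}\le C\,[f,g]_{p,\alpha}\,[f]_{p,\alpha}^{\,n\max\{p,q\}}\qquad\text{and}\qquad [f,g]_{p,\alpha}\le C\,\|T_gT_{\bar f}\|_{A^q_\alpha\to A^q_\alpha}\,[f]_{p,\alpha}.$$ -/

import Mathlib

open MeasureTheory
open scoped ENNReal NNReal ComplexConjugate

noncomputable section

namespace ToeplitzTube

/-- The tube domain over the first octant, `{z ∈ ℂⁿ : Im z_j > 0 for all j}`. -/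
def tube (n : ℕ) : Set (Fin n → ℂ) := {z | ∀ j, 0 < (z j).im}

/-- The measure `y^a dx dy` on the upper half-plane, as a measure on `ℂ`. -/
def halfPlaneMeasure (a : ℝ) : Measure ℂ :=
  (volume.restrict {z : ℂ | 0 < z.im}).withDensity fun z => ENNReal.ofReal (z.im ^ a)

/-- The product measure `dV_α(z) = dV_{α₁}(z₁) ⋯ dV_{αₙ}(zₙ)`, carried by the tube. -/
def tubeMeasure {n : ℕ} (α : Fin n → ℝ) : Measure (Fin n → ℂ) :=
  Measure.pi fun j => halfPlaneMeasure (α j)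

/-- The norm `‖f‖_{p,α}`, with value `∞` when the integral diverges. -/
def tubeNorm {n : ℕ} (p : ℝ) (α : Fin n → ℝ) (f : (Fin n → ℂ) → ℂ) : ℝ≥0∞ :=
  eLpNorm f (ENNReal.ofReal p) (tubeMeasure α)

/-- Membership in the weighted Bergman space `A^p_α` of the tube. -/
def MemBergman {n : ℕ} (p : ℝ) (α : Fin n → ℝ) (f : (Fin n → ℂ) → ℂ) : Prop :=
  DifferentiableOn ℂ f (tube n) ∧ MemLp f (ENNReal.ofReal p) (tubeMeasure α)

/-- The reproducing kernel `K^a(z, w)` of `A²_a` of the upper half-plane: the function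
`(z - w̄)^{-(2+a)}` with the constant factor that makes it reproducing for `y^a dx dy`.
For `z, w` in the half-plane, `(z - w̄) / i` has positive real part, so the power is the
holomorphic principal branch. -/
def halfPlaneKernel (a : ℝ) (z w : ℂ) : ℂ :=
  ((2 ^ a * (a + 1) / Real.pi : ℝ) : ℂ) *
    ((z - conj w) / Complex.I) ^ ((-(2 + a) : ℝ) : ℂ)

/-- The reproducing kernel `K^α(z, w)` of `A²_α` of the tube. -/
def tubeKernel {n : ℕ} (α : Fin n → ℝ) (z w : Fin n → ℂ) : ℂ :=
  ∏ j, halfPlaneKernel (α j) (z j) (w j)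

/-- The normalized reproducing kernel `k_w^α(z) = ∏_j K^{α_j}_{w_j}(z_j) / ‖K^{α_j}_{w_j}‖_2`. -/
def normalizedKernel {n : ℕ} (α : Fin n → ℝ) (w z : Fin n → ℂ) : ℂ :=
  ∏ j, halfPlaneKernel (α j) (z j) (w j) /
    ((eLpNorm (fun ζ : ℂ => halfPlaneKernel (α j) ζ (w j)) 2 (halfPlaneMeasure (α j))).toReal : ℂ)

/-- `[f, g]_{p,α} = sup_w ‖f k_w^α‖_{p,α} ‖g k_w^α‖_{q,α}`, where `q` is the exponent conjugate
to `p`. -/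
def sarasonConst {n : ℕ} (p q : ℝ) (α : Fin n → ℝ) (f g : (Fin n → ℂ) → ℂ) : ℝ≥0∞ :=
  ⨆ w ∈ tube n,
    tubeNorm p α (fun z => f z * normalizedKernel α w z) *
      tubeNorm q α (fun z => g z * normalizedKernel α w z)

/-- `[f]_{p,α} = sup_w ‖f k_w^α‖_{p,α} ‖f⁻¹ k_w^α‖_{q,α}`. -/
def invariantConst {n : ℕ} (p q : ℝ) (α : Fin n → ℝ) (f : (Fin n → ℂ) → ℂ) : ℝ≥0∞ :=
  sarasonConst p q α f fun z => (f z)⁻¹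

/-- The Toeplitz operator `T_φ h = P_α(φ h)`, `P_α u(z) = ∫ K^α(z, w) u(w) dV_α(w)`. -/
def toeplitz {n : ℕ} (α : Fin n → ℝ) (φ h : (Fin n → ℂ) → ℂ) (z : Fin n → ℂ) : ℂ :=
  ∫ w, tubeKernel α z w * (φ w * h w) ∂tubeMeasure α

/-- The integral defining `T_φ h` converges absolutely at every point of the tube. -/
def ToeplitzDefined {n : ℕ} (α : Fin n → ℝ) (φ h : (Fin n → ℂ) → ℂ) : Prop :=
  ∀ z ∈ tube n, Integrable (fun w => tubeKernel α z w * (φ w * h w)) (tubeMeasure α)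

/-- `T_f T_{ḡ}` is defined on `A^p_α`, maps it into itself, and
`‖T_f T_{ḡ} h‖_{p,α} ≤ M ‖h‖_{p,α}` for all `h` in `A^p_α`. -/
def ToeplitzProductBoundedBy {n : ℕ} (p : ℝ) (α : Fin n → ℝ) (f g : (Fin n → ℂ) → ℂ)
    (M : ℝ≥0) : Prop :=
  ∀ h : (Fin n → ℂ) → ℂ, MemBergman p α h →
    ToeplitzDefined α (fun w => conj (g w)) h ∧
    ToeplitzDefined α f (toeplitz α (fun w => conj (g w)) h) ∧
    MemBergman p α (toeplitz α f (toeplitz α (fun w => conj (g w)) h)) ∧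
    tubeNorm p α (toeplitz α f (toeplitz α (fun w => conj (g w)) h)) ≤ M * tubeNorm p α h

/-- `T_f T_{ḡ}` is a bounded operator on `A^p_α`. -/
def ToeplitzProductBounded {n : ℕ} (p : ℝ) (α : Fin n → ℝ) (f g : (Fin n → ℂ) → ℂ) : Prop :=
  ∃ M : ℝ≥0, ToeplitzProductBoundedBy p α f g M

/-- The operator norm of `T_f T_{ḡ}` on `A^p_α`; it is `∞` if the product is not bounded. -/
def toeplitzProductNorm {n : ℕ} (p : ℝ) (α : Fin n → ℝ) (f g : (Fin n → ℂ) → ℂ) : ℝ≥0∞ :=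
  ⨅ (M : ℝ≥0) (_ : ToeplitzProductBoundedBy p α f g M), (M : ℝ≥0∞)

end ToeplitzTube

end

noncomputable section

namespace ToeplitzTube

open Set Filter

/-! ### Layer cake and the dyadic Carleson embedding -/

/-! Write `P` for the Bergman projection and `P⁺` for the positive operator whose kernel is the
modulus of the Bergman kernel. By the reproducing formula `T_F u = F u` for holomorphic `u` whenever
the integral converges absolutely, so `T_f T_ḡ h = f · P(ḡ h)`.

Sufficiency. Reproducing `f k_w` at `w` and applying Hölder bounds `|f(w)|` by `‖f k_w‖_p` up to a
power of the height of `w` (`enorm_le_kernelNorm`). The same bound for `g` gives `|f g| ≤ c [f,g]`,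
that is `|g| ≤ c [f,g] |f|⁻¹`. Hence `|T_f T_ḡ h| ≤ c [f,g] |f| P⁺(|f|⁻¹ |h|)`, and only a
one-weight estimate for `P⁺` with weight `|f|` is needed. The dual product on `A^q` is treated in
the same way with the weight `|f|⁻¹`.

The weighted estimate on the half-plane. The kernel is dominated by sums over the Carleson boxes of
two dyadic grids (`modKernel_le_sum_boxes`). In each grid the boxes are laminar, and the upper
halves are disjoint and carry a fixed proportion of the measure. Finiteness of `[f]` gives a Békollé
condition on boxes (`rpow_lintegral_box_le`). Duality, Hölder's inequality and the Carleson
embedding for the two dual weights then give the norm bound `A ^ max p q` (`sparse_bilinear_le`).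

The weighted estimate on the tube. The kernel is a product, so `P⁺` is applied one variable at a
time. The pointwise estimate in the frozen variables shows that every slice of `f` satisfies the
same condition with a comparable constant, because `f` and `f⁻¹` are both holomorphic. Each variable
contributes one factor `A ^ max p q`, whence the exponent `n max{p, q}`.

Necessity. If `T_g T_f̄` is bounded on `A^q`, then testing on kernels, where `T_f̄ K_w` is the
multiple of `K_w` by the conjugate of `f(w)`, gives `|f(w)| ‖g k_w‖_q ≤ c M ‖k_w‖_q`. If instead
`T_f T_ḡ` is bounded on `A^p`, the same inequality follows by duality
(`exists_enorm_mul_kernelNorm_le`). The pointwise bound for `f⁻¹` at `w` then yields `[f,g] ≤ c M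
[f]`. -/

lemma setLIntegral_Ioo_rpow {s : ℝ} (hs : 0 < s) {t : ℝ} (ht : 0 ≤ t) :
    ∫⁻ l in Ioo 0 t, ENNReal.ofReal (s * l ^ (s - 1)) = ENNReal.ofReal (t ^ s) := by
  have hI : IntervalIntegrable (fun l : ℝ => s * l ^ (s - 1)) volume 0 t :=
    (intervalIntegral.intervalIntegrable_rpow' (by linarith)).const_mul s
  rw [← ofReal_integral_eq_lintegral_ofReal]
  · congr 1
    rw [← integral_Ioc_eq_integral_Ioo, ← intervalIntegral.integral_of_le ht,
      intervalIntegral.integral_const_mul, integral_rpow (Or.inl (by linarith))]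
    have : s - 1 + 1 = s := by ring
    rw [this, Real.zero_rpow hs.ne']
    field_simp
    ring
  · exact ((intervalIntegrable_iff_integrableOn_Ioc_of_le ht).1 hI).mono_set Ioo_subset_Ioc_self
  · filter_upwards [ae_restrict_mem measurableSet_Ioo] with l hl
    have := Real.rpow_nonneg hl.1.le (s - 1)
    simp only [Pi.zero_apply]
    positivity

/-- The layer-cake identity for a single number. With values in `ℝ≥0∞` it can be inserted under sums
over boxes and integrals over the space, and the level `l` moved outside by Tonelli. -/
lemma lintegral_layer {s : ℝ} (hs : 0 < s) (t : ℝ≥0∞) :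
    ∫⁻ l in Ioi (0 : ℝ), (if ENNReal.ofReal l < t then ENNReal.ofReal (s * l ^ (s - 1)) else 0)
      = t ^ s := by
  have key : ∀ T : ℝ, 0 ≤ T →
      ∫⁻ l in Ioi (0 : ℝ), (if ENNReal.ofReal l < ENNReal.ofReal T then
        ENNReal.ofReal (s * l ^ (s - 1)) else 0) = ENNReal.ofReal T ^ s := by
    intro T hT
    have h1 : ∫⁻ l in Ioi (0 : ℝ), (if ENNReal.ofReal l < ENNReal.ofReal T then
        ENNReal.ofReal (s * l ^ (s - 1)) else 0) =
        ∫⁻ l in Ioi (0 : ℝ), (Iio T).indicator (fun l => ENNReal.ofReal (s * l ^ (s - 1))) l := by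
      refine setLIntegral_congr_fun measurableSet_Ioi fun l hl => ?_
      have : (ENNReal.ofReal l < ENNReal.ofReal T) ↔ l < T := by
        rw [ENNReal.ofReal_lt_ofReal_iff']
        exact ⟨fun h => h.1, fun h => ⟨h, lt_trans hl h⟩⟩
      simp only [this, indicator, mem_Iio]
    rw [h1, lintegral_indicator measurableSet_Iio, Measure.restrict_restrict measurableSet_Iio,
      inter_comm, Ioi_inter_Iio, setLIntegral_Ioo_rpow hs hT, ENNReal.ofReal_rpow_of_nonneg hT hs.le]
  rcases eq_or_ne t ∞ with rfl | ht
  · rw [ENNReal.top_rpow_of_pos hs, eq_top_iff]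
    refine ENNReal.le_of_forall_nnreal_lt fun r _ => ?_
    -- The integral for `t = ∞` dominates the one for the finite value `r ^ s⁻¹`, which equals `r`.
    have h2 := key ((r : ℝ) ^ s⁻¹) (by positivity)
    rw [ENNReal.ofReal_rpow_of_nonneg (by positivity) hs.le, ← Real.rpow_mul r.coe_nonneg,
      inv_mul_cancel₀ hs.ne', Real.rpow_one, ENNReal.ofReal_coe_nnreal] at h2
    rw [← h2]
    refine lintegral_mono fun l => ?_
    split_ifs with h h' h'
    · exact le_rfl
    · exact absurd ENNReal.ofReal_lt_top h'
    · exact zero_le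
    · exact le_rfl
  · have := key t.toReal ENNReal.toReal_nonneg
    rwa [ENNReal.ofReal_toReal ht] at this

section Carleson

variable {X : Type*} [MeasurableSpace X] {ι : Type*}

/-- The maximal members of a finite laminar family are pairwise disjoint and cover its union. The
hypothesis can therefore be added up over them without any covering loss, and no doubling of `σ` is
needed. -/
lemma laminar_weak_type (σ : Measure X) (B : ι → Set X) (hB : ∀ i, MeasurableSet (B i))
    (F : Finset ι)
    (hlam : ∀ i ∈ F, ∀ j ∈ F, B i ⊆ B j ∨ B j ⊆ B i ∨ Disjoint (B i) (B j))
    (τ : ℝ≥0∞) (w : X → ℝ≥0∞) (h : ∀ i ∈ F, τ * σ (B i) ≤ ∫⁻ x in B i, w x ∂σ) :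
    τ * σ (⋃ i ∈ F, B i) ≤ ∫⁻ x, w x ∂σ := by
  classical
  -- Maximality is taken among the sets themselves: different indices may carry the same set, which
  -- must be counted once.
  set S : Finset (Set X) := (F.image B).filter fun s => Maximal (· ∈ F.image B) s with hS
  have hSF : ∀ s ∈ S, ∃ i ∈ F, B i = s := fun s hs => by
    simpa using (Finset.mem_filter.1 hs).1
  have hdis : (S : Set (Set X)).PairwiseDisjoint id := by
    intro s hs t ht hst
    obtain ⟨i, hi, rfl⟩ := hSF s hs
    obtain ⟨j, hj, rfl⟩ := hSF t ht
    rcases hlam i hi j hj with h1 | h1 | h1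
    · exact absurd (((Finset.mem_filter.1 hs).2.eq_of_le (Finset.mem_image_of_mem B hj) h1)) hst
    · exact absurd (((Finset.mem_filter.1 ht).2.eq_of_le (Finset.mem_image_of_mem B hi) h1)).symm hst
    · exact h1
  have hsub : (⋃ i ∈ F, B i) ⊆ ⋃ s ∈ S, s := by
    refine iUnion₂_subset fun i hi => ?_
    obtain ⟨m, hm, hmax⟩ := (F.image B).exists_le_maximal (Finset.mem_image_of_mem B hi)
    exact hm.trans (subset_biUnion_of_mem (u := fun s : Set X => s)
      (Finset.mem_coe.2 (Finset.mem_filter.2 ⟨hmax.prop, hmax⟩)))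
  calc τ * σ (⋃ i ∈ F, B i) ≤ τ * ∑ s ∈ S, σ s := by
        gcongr
        exact (measure_mono hsub).trans (measure_biUnion_finset_le _ _)
    _ = ∑ s ∈ S, τ * σ s := Finset.mul_sum ..
    _ ≤ ∑ s ∈ S, ∫⁻ x in s, w x ∂σ := by
        refine Finset.sum_le_sum fun s hs => ?_
        obtain ⟨i, hi, rfl⟩ := hSF s hs
        exact h i hi
    _ = ∫⁻ x in ⋃ s ∈ S, s, w x ∂σ := by
        refine (lintegral_biUnion_finset hdis (fun s hs => ?_) w).symm
        obtain ⟨i, hi, rfl⟩ := hSF s hs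
        exact hB i
    _ ≤ ∫⁻ x, w x ∂σ := setLIntegral_le_lintegral _ _

/-- The Carleson embedding theorem for a finite laminar family of sets `B i` with pairwise disjoint
parts `E i ⊆ B i`, for an arbitrary measure. -/
theorem carleson_embedding (σ : Measure X) [SFinite σ] (B E : ι → Set X)
    (hB : ∀ i, MeasurableSet (B i)) (hE : ∀ i, MeasurableSet (E i)) (hEB : ∀ i, E i ⊆ B i)
    (hdis : Pairwise fun i j => Disjoint (E i) (E j)) (F : Finset ι)
    (hlam : ∀ i ∈ F, ∀ j ∈ F, B i ⊆ B j ∨ B j ⊆ B i ∨ Disjoint (B i) (B j))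
    {p : ℝ} (hp : 1 < p) (u : X → ℝ≥0∞) (hu : Measurable u) :
    ∑ i ∈ F, σ (E i) * ((∫⁻ x in B i, u x ∂σ) / σ (B i)) ^ p ≤
      ENNReal.ofReal (2 ^ p * p / (p - 1)) * ∫⁻ x, u x ^ p ∂σ := by
  classical
  have hp0 : 0 < p := by linarith
  have hp1 : 0 < p - 1 := by linarith
  set a : ι → ℝ≥0∞ := fun i => (∫⁻ x in B i, u x ∂σ) / σ (B i) with ha
  -- the measure of the level set
  have hlevel : ∀ l : ℝ, 0 < l →
      ENNReal.ofReal l * ∑ i ∈ F, (if ENNReal.ofReal l < a i then σ (E i) else 0) ≤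
        2 * ∫⁻ x, (if ENNReal.ofReal l < 2 * u x then u x else 0) ∂σ := by
    intro l hl
    set τ : ℝ≥0∞ := ENNReal.ofReal (l / 2) with hτ
    have h2τ : ENNReal.ofReal l = 2 * τ := by
      rw [hτ, ← ENNReal.ofReal_ofNat, ← ENNReal.ofReal_mul (by norm_num)]
      congr 1; ring
    -- Only the part of `u` above `l / 2` matters: the part below contributes at most half of `l * σ
    -- (B i)` to the integral over a box whose average exceeds `l`.
    set w : X → ℝ≥0∞ := fun x => if ENNReal.ofReal l < 2 * u x then u x else 0 with hw
    set G := F.filter fun i => ENNReal.ofReal l < a i with hG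
    have hweak : τ * σ (⋃ i ∈ G, B i) ≤ ∫⁻ x, w x ∂σ := by
      refine laminar_weak_type σ B hB G (fun i hi j hj => hlam i (Finset.mem_filter.1 hi).1 j
        (Finset.mem_filter.1 hj).1) τ w fun i hi => ?_
      have hai : ENNReal.ofReal l < a i := (Finset.mem_filter.1 hi).2
      -- A box of infinite measure has average `0`, since division by `∞` gives `0`; finiteness
      -- permits the subtraction of `τ * σ (B i)` below.
      have hfin : σ (B i) ≠ ∞ := by
        intro h
        simp [ha, h] at hai
      have h1 : ENNReal.ofReal l * σ (B i) ≤ ∫⁻ x in B i, u x ∂σ := ENNReal.mul_le_of_le_div hai.le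
      have h2 : ∫⁻ x in B i, u x ∂σ ≤ τ * σ (B i) + ∫⁻ x in B i, w x ∂σ := by
        rw [← setLIntegral_const, ← lintegral_add_left measurable_const]
        refine lintegral_mono fun x => ?_
        simp only [hw]
        split_ifs with h
        · exact le_add_self
        · rw [h2τ] at h
          have : u x ≤ τ := (ENNReal.mul_le_mul_iff_right (by norm_num) (by norm_num)).1 (not_lt.1 h)
          simpa using this
      have h3 := h1.trans h2
      rw [h2τ, two_mul, add_mul] at h3
      exact (ENNReal.add_le_add_iff_left (ENNReal.mul_ne_top ENNReal.ofReal_ne_top hfin)).1 h3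
    have hsum : ∑ i ∈ F, (if ENNReal.ofReal l < a i then σ (E i) else 0) ≤ σ (⋃ i ∈ G, B i) := by
      rw [← Finset.sum_filter, ← measure_biUnion_finset (fun i _ j _ hij => hdis hij) fun i _ => hE i]
      exact measure_mono (iUnion₂_mono fun i _ => hEB i)
    calc ENNReal.ofReal l * ∑ i ∈ F, (if ENNReal.ofReal l < a i then σ (E i) else 0)
        ≤ ENNReal.ofReal l * σ (⋃ i ∈ G, B i) := mul_le_mul' le_rfl hsum
      _ = 2 * (τ * σ (⋃ i ∈ G, B i)) := by rw [h2τ, mul_assoc]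
      _ ≤ _ := by gcongr
  have hmeas : ∀ i, Measurable fun l : ℝ => σ (E i) *
      (if ENNReal.ofReal l < a i then ENNReal.ofReal (p * l ^ (p - 1)) else 0) := fun i => by
    refine Measurable.const_mul (Measurable.ite ?_ (by fun_prop) measurable_const) _
    exact measurableSet_lt (by fun_prop) measurable_const
  calc ∑ i ∈ F, σ (E i) * a i ^ p
      = ∫⁻ l in Ioi (0 : ℝ), ∑ i ∈ F, σ (E i) *
          (if ENNReal.ofReal l < a i then ENNReal.ofReal (p * l ^ (p - 1)) else 0) := by
        rw [lintegral_finsetSum _ fun i _ => hmeas i]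
        refine Finset.sum_congr rfl fun i _ => ?_
        rw [lintegral_const_mul, lintegral_layer hp0]
        refine Measurable.ite ?_ (by fun_prop) measurable_const
        exact measurableSet_lt (by fun_prop) measurable_const
    -- The level-set bound uses up one factor `l` of `l ^ (p - 1)`. What remains is, up to `p / (p -
    -- 1)`, the layer-cake density for the exponent `p - 1`, so the integral in `l` returns `(2 * u
    -- x) ^ (p - 1)`.
    _ ≤ ∫⁻ l in Ioi (0 : ℝ), ENNReal.ofReal (2 * p / (p - 1)) *
          ∫⁻ x, u x * (if ENNReal.ofReal l < 2 * u x then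
            ENNReal.ofReal ((p - 1) * l ^ (p - 1 - 1)) else 0) ∂σ := by
        refine setLIntegral_mono' measurableSet_Ioi fun l hl => ?_
        have hl : 0 < l := hl
        have e1 : ENNReal.ofReal (p * l ^ (p - 1)) =
            ENNReal.ofReal (p * l ^ (p - 1 - 1)) * ENNReal.ofReal l := by
          rw [← ENNReal.ofReal_mul (by positivity), mul_assoc, ← Real.rpow_add_one hl.ne']
          congr 3; ring
        calc ∑ i ∈ F, σ (E i) * (if ENNReal.ofReal l < a i then ENNReal.ofReal (p * l ^ (p - 1)) else 0)
            = ENNReal.ofReal (p * l ^ (p - 1 - 1)) * (ENNReal.ofReal l *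
                ∑ i ∈ F, (if ENNReal.ofReal l < a i then σ (E i) else 0)) := by
              rw [← mul_assoc, ← e1, Finset.mul_sum]
              refine Finset.sum_congr rfl fun i _ => ?_
              split_ifs
              · rw [mul_comm]
              · simp
          _ ≤ ENNReal.ofReal (p * l ^ (p - 1 - 1)) *
                (2 * ∫⁻ x, (if ENNReal.ofReal l < 2 * u x then u x else 0) ∂σ) := by
              exact mul_le_mul' le_rfl (hlevel l hl)
          _ = ENNReal.ofReal (2 * p / (p - 1)) * (ENNReal.ofReal ((p - 1) * l ^ (p - 1 - 1)) *
                ∫⁻ x, (if ENNReal.ofReal l < 2 * u x then u x else 0) ∂σ) := by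
              rw [← mul_assoc, ← mul_assoc, ← ENNReal.ofReal_mul (by positivity),
                ← ENNReal.ofReal_ofNat, ← ENNReal.ofReal_mul (by positivity)]
              congr 2
              field_simp
          _ = _ := by
              rw [← lintegral_const_mul]
              · congr 2 with x
                split_ifs
                · rw [mul_comm]
                · simp
              · refine Measurable.ite ?_ hu measurable_const
                exact measurableSet_lt measurable_const (hu.const_mul 2)
    _ = ENNReal.ofReal (2 * p / (p - 1)) * ∫⁻ x, (∫⁻ l in Ioi (0 : ℝ),
          u x * (if ENNReal.ofReal l < 2 * u x then
            ENNReal.ofReal ((p - 1) * l ^ (p - 1 - 1)) else 0)) ∂σ := by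
        rw [lintegral_const_mul' _ _ ENNReal.ofReal_ne_top, lintegral_lintegral_swap]
        refine Measurable.aemeasurable ?_
        refine (hu.comp measurable_snd).mul (Measurable.ite ?_ (by fun_prop) measurable_const)
        exact measurableSet_lt (by fun_prop) ((hu.comp measurable_snd).const_mul 2)
    _ = ENNReal.ofReal (2 * p / (p - 1)) * ∫⁻ x, 2 ^ (p - 1) * u x ^ p ∂σ := by
        congr 2 with x
        rw [lintegral_const_mul, lintegral_layer hp1, ENNReal.mul_rpow_of_nonneg _ _ hp1.le]
        · have : u x ^ p = u x * u x ^ (p - 1) := by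
            conv_lhs => rw [show p = 1 + (p - 1) by ring]
            rw [ENNReal.rpow_add_of_nonneg _ _ zero_le_one hp1.le, ENNReal.rpow_one]
          rw [this]
          ring
        · refine Measurable.ite ?_ (by fun_prop) measurable_const
          exact measurableSet_lt (by fun_prop) measurable_const
    _ = _ := by
        rw [lintegral_const_mul _ (hu.pow_const p), ← mul_assoc]
        congr 1
        rw [← ENNReal.ofReal_ofNat, ENNReal.ofReal_rpow_of_pos (by norm_num),
          ← ENNReal.ofReal_mul (by positivity)]
        congr 1
        rw [Real.rpow_sub_one (by norm_num)]
        field_simp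

end Carleson

/-! ### Duality and the weighted sparse estimate -/

section Sparse

variable {X : Type*} [MeasurableSpace X] {ι : Type*}

/-- The cancellation that ends a duality argument: division by `W ^ (1 / q)`, legitimate because `W`
is finite. -/
lemma ennreal_rpow_le_of_le_mul_rpow {p q : ℝ} (hpq : p.HolderConjugate q) {W N : ℝ≥0∞}
    (hW : W ≠ ∞) (h : W ≤ N * W ^ (1 / q)) : W ≤ N ^ p := by
  rcases eq_or_ne W 0 with rfl | hW0
  · exact zero_le
  have hq : 0 < q := hpq.symm.pos
  have h1 : W ^ (1 / p) * W ^ (1 / q) = W := by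
    rw [← ENNReal.rpow_add _ _ hW0 hW]
    have : 1 / p + 1 / q = 1 := by simpa using hpq.inv_add_inv_eq_one
    rw [this, ENNReal.rpow_one]
  have h2 : W ^ (1 / p) ≤ N := by
    have h3 : W ^ (1 / p) * W ^ (1 / q) ≤ N * W ^ (1 / q) := by rw [h1]; exact h
    refine (ENNReal.mul_le_mul_iff_left ?_ ?_).1 h3
    · simp [hW0, hW]
    · exact ENNReal.rpow_ne_top_of_nonneg (by positivity) hW
  calc W = (W ^ (1 / p)) ^ p := by
        rw [← ENNReal.rpow_mul, one_div_mul_cancel hpq.ne_zero, ENNReal.rpow_one]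
    _ ≤ N ^ p := ENNReal.rpow_le_rpow h2 hpq.nonneg

/-- Converse of Hölder's inequality for nonnegative functions. It suffices to test against powers of
truncations of the function itself. -/
theorem lintegral_rpow_le_of_forall_mul_le {μ : Measure X} [SigmaFinite μ] {p q : ℝ}
    (hpq : p.HolderConjugate q) {F : X → ℝ≥0∞} (hF : Measurable F) {N : ℝ≥0∞}
    (h : ∀ k : ℕ, ∫⁻ x, F x * (spanningSets μ k).indicator (fun x => min (F x) k ^ (p - 1)) x ∂μ ≤
      N * (∫⁻ x, (spanningSets μ k).indicator (fun x => min (F x) k ^ (p - 1)) x ^ q ∂μ) ^ (1 / q)) :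
    ∫⁻ x, F x ^ p ∂μ ≤ N ^ p := by
  have hp1 : 0 < p - 1 := by linarith [hpq.lt]
  have hq : 0 < q := hpq.symm.pos
  -- Since `(p - 1) * q = p`, the `q`-th power of the test function is `W k`, and its product with
  -- `F` dominates `W k`. Truncation in height and in space makes the integral of `W k` finite, so
  -- it can be cancelled; Fatou removes the truncation.
  set W : ℕ → X → ℝ≥0∞ := fun k => (spanningSets μ k).indicator fun x => min (F x) k ^ p with hW
  have hWm : ∀ k, Measurable (W k) := fun k =>
    ((hF.min measurable_const).pow_const p).indicator (measurableSet_spanningSets μ k)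
  have hVW : ∀ k x, (spanningSets μ k).indicator (fun x => min (F x) k ^ (p - 1)) x ^ q = W k x := by
    intro k x
    by_cases hx : x ∈ spanningSets μ k
    · simp only [hW, indicator_of_mem hx]
      rw [← ENNReal.rpow_mul, hpq.sub_one_mul_conj]
    · simp only [hW, indicator_of_notMem hx, ENNReal.zero_rpow_of_pos hq]
  have hWV : ∀ k x, W k x ≤
      F x * (spanningSets μ k).indicator (fun x => min (F x) k ^ (p - 1)) x := by
    intro k x
    by_cases hx : x ∈ spanningSets μ k
    · simp only [hW, indicator_of_mem hx]
      conv_lhs => rw [show p = 1 + (p - 1) by ring]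
      rw [ENNReal.rpow_add_of_nonneg _ _ zero_le_one hp1.le, ENNReal.rpow_one]
      gcongr
      exact min_le_left _ _
    · simp only [hW, indicator_of_notMem hx, zero_le]
  have hWfin : ∀ k, ∫⁻ x, W k x ∂μ ≠ ∞ := by
    intro k
    have h1 : ∫⁻ x, W k x ∂μ ≤ (k : ℝ≥0∞) ^ p * μ (spanningSets μ k) := by
      rw [← setLIntegral_const, ← lintegral_indicator (measurableSet_spanningSets μ k)]
      refine lintegral_mono fun x => indicator_le_indicator ?_
      exact ENNReal.rpow_le_rpow (min_le_right _ _) hpq.nonneg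
    refine (h1.trans_lt (ENNReal.mul_lt_top ?_ (measure_spanningSets_lt_top μ k))).ne
    exact ENNReal.rpow_lt_top_of_nonneg hpq.nonneg (ENNReal.natCast_ne_top k)
  have hWN : ∀ k, ∫⁻ x, W k x ∂μ ≤ N ^ p := by
    intro k
    refine ennreal_rpow_le_of_le_mul_rpow hpq (hWfin k) ?_
    calc ∫⁻ x, W k x ∂μ ≤ _ := lintegral_mono (hWV k)
      _ ≤ _ := h k
      _ = _ := by simp only [hVW]
  have hlim : ∀ x, Tendsto (fun k => W k x) atTop (nhds (F x ^ p)) := by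
    intro x
    have h1 : Tendsto (fun k : ℕ => min (F x) (k : ℝ≥0∞) ^ p) atTop (nhds (F x ^ p)) := by
      refine (ENNReal.continuous_rpow_const.tendsto _).comp ?_
      have := (tendsto_const_nhds (x := F x)).min ENNReal.tendsto_nat_nhds_top
      simpa using this
    refine h1.congr' ?_
    filter_upwards [eventually_ge_atTop (spanningSetsIndex μ x)] with k hk
    simp only [hW, indicator_of_mem (mem_spanningSets_of_index_le μ x hk)]
  calc ∫⁻ x, F x ^ p ∂μ = ∫⁻ x, liminf (fun k => W k x) atTop ∂μ := by
        simp only [(hlim _).liminf_eq]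
    _ ≤ liminf (fun k => ∫⁻ x, W k x ∂μ) atTop := lintegral_liminf_le hWm
    _ ≤ N ^ p := liminf_le_of_le (by isBoundedDefault) fun b hb => by
        obtain ⟨k, hk⟩ := hb.exists
        exact hk.trans (hWN k)

/-- Here `s` and `o` are the masses of the two dual weights on a box, and `sE`, `oE` those on its
distinguished part. In `s = s ^ (p - 1) * s ^ (2 - p)` the first power is absorbed with `o` by the
weight condition. The second has a nonpositive exponent when `p ≥ 2`, so it increases when `s` is
replaced by `sE`. The remaining `m ^ (p - 1)` passes to the part `E` through `m ≤ c * mE` and Hölder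
there. -/
lemma real_sparse_weight_bound {p q : ℝ} (hpq : p.HolderConjugate q) (hp2 : 2 ≤ p)
    {m mE s sE o oE A c : ℝ} (hm : 0 < m) (hsE : 0 < sE) (hoE : 0 < oE)
    (hA : 0 ≤ A) (hc : 0 < c) (hs : sE ≤ s) (ho : oE ≤ o) (hA1 : o ^ (1 / p) * s ^ (1 / q) ≤ A * m)
    (hmc : m ≤ c * mE) (hH : mE ≤ oE ^ (1 / p) * sE ^ (1 / q)) :
    m⁻¹ * s * o ≤ c ^ (p - 1) * A ^ p * (sE ^ (1 / p) * oE ^ (1 / q)) := by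
  have hp0 : 0 < p := hpq.pos
  have hq0 : 0 < q := hpq.symm.pos
  have hp1 : 0 < p - 1 := by linarith
  have hs0 : 0 < s := hsE.trans_le hs
  have ho0 : 0 < o := hoE.trans_le ho
  have hpq1 : 1 / q * p = p - 1 := by
    have := hpq.div_conj_eq_sub_one
    rw [← this]; ring
  have hpq2 : 1 / p * (p - 1) = 1 / q := by
    have : 1 / p + 1 / q = 1 := by simpa using hpq.inv_add_inv_eq_one
    field_simp at this ⊢
    linarith
  have hpq3 : 1 / q * (p - 1) + (2 - p) = 1 / p := by
    have : 1 / q = 1 - 1 / p := by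
      have : 1 / p + 1 / q = 1 := by simpa using hpq.inv_add_inv_eq_one
      linarith
    rw [this]; field_simp; ring
  have h1 : o * s ^ (p - 1) ≤ A ^ p * m ^ p := by
    have := Real.rpow_le_rpow (by positivity) hA1 hp0.le
    rwa [Real.mul_rpow (by positivity) (by positivity), ← Real.rpow_mul ho0.le,
      ← Real.rpow_mul hs0.le, one_div_mul_cancel hp0.ne', Real.rpow_one, hpq1,
      Real.mul_rpow hA hm.le] at this
  have h2 : m⁻¹ * s * o = m⁻¹ * (o * s ^ (p - 1)) * s ^ (2 - p) := by
    have : s ^ (p - 1) * s ^ (2 - p) = s := by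
      rw [← Real.rpow_add hs0, show p - 1 + (2 - p) = 1 by ring, Real.rpow_one]
    calc m⁻¹ * s * o = m⁻¹ * (s ^ (p - 1) * s ^ (2 - p)) * o := by rw [this]
      _ = _ := by ring
  calc m⁻¹ * s * o = m⁻¹ * (o * s ^ (p - 1)) * s ^ (2 - p) := h2
    _ ≤ m⁻¹ * (A ^ p * m ^ p) * sE ^ (2 - p) := by
        have : s ^ (2 - p) ≤ sE ^ (2 - p) := Real.rpow_le_rpow_of_nonpos hsE hs (by linarith)
        gcongr
    _ = A ^ p * m ^ (p - 1) * sE ^ (2 - p) := by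
        rw [Real.rpow_sub_one hm.ne']; ring
    _ ≤ A ^ p * (c * (oE ^ (1 / p) * sE ^ (1 / q))) ^ (p - 1) * sE ^ (2 - p) := by
        gcongr
        exact hmc.trans (by gcongr)
    _ = c ^ (p - 1) * A ^ p * (sE ^ (1 / p) * oE ^ (1 / q)) := by
        rw [Real.mul_rpow hc.le (by positivity), Real.mul_rpow (by positivity) (by positivity),
          ← Real.rpow_mul hoE.le, ← Real.rpow_mul hsE.le, hpq2]
        have : sE ^ (1 / q * (p - 1)) * sE ^ (2 - p) = sE ^ (1 / p) := by
          rw [← Real.rpow_add hsE, hpq3]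
        rw [← this]; ring

lemma sparse_weight_bound_of_two_le {p q : ℝ} (hpq : p.HolderConjugate q) (hp2 : 2 ≤ p)
    {m mE s sE o oE A c : ℝ≥0∞} (hm : m ≠ 0) (hm' : m ≠ ∞) (hA : A ≠ ∞) (hc : c ≠ ∞)
    (hs : sE ≤ s) (ho : oE ≤ o) (hmEm : mE ≤ m) (hA1 : o ^ (1 / p) * s ^ (1 / q) ≤ A * m)
    (hmc : m ≤ c * mE) (hH : mE ≤ oE ^ (1 / p) * sE ^ (1 / q)) :
    m⁻¹ * s * o ≤ c ^ (p - 1) * A ^ p * (sE ^ (1 / p) * oE ^ (1 / q)) := by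
  have hp0 : 0 < p := hpq.pos
  have hq0 : 0 < q := hpq.symm.pos
  have hip : 0 < 1 / p := by positivity
  have hiq : 0 < 1 / q := by positivity
  have hmE0 : mE ≠ 0 := by rintro rfl; simp at hmc; exact hm hmc
  have hc0 : c ≠ 0 := by rintro rfl; simp at hmc; exact hm hmc
  -- Degenerate values are ruled out: `mE ≠ 0` makes both masses on the small part positive, and the
  -- finite bound `A * m` then makes both masses on the box finite.
  have hoE0 : oE ≠ 0 := by
    rintro rfl
    rw [ENNReal.zero_rpow_of_pos hip, zero_mul] at hH
    exact hmE0 (le_antisymm hH zero_le)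
  have hsE0 : sE ≠ 0 := by
    rintro rfl
    rw [ENNReal.zero_rpow_of_pos hiq, mul_zero] at hH
    exact hmE0 (le_antisymm hH zero_le)
  have ho0 : o ≠ 0 := fun h => hoE0 (le_antisymm (h ▸ ho) zero_le)
  have hs0 : s ≠ 0 := fun h => hsE0 (le_antisymm (h ▸ hs) zero_le)
  have hfin : o ^ (1 / p) * s ^ (1 / q) ≠ ∞ := (hA1.trans_lt (ENNReal.mul_lt_top hA.lt_top hm'.lt_top)).ne
  have hoT : o ≠ ∞ := by
    rintro rfl
    rw [ENNReal.top_rpow_of_pos hip, ENNReal.top_mul] at hfin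
    · exact hfin rfl
    · exact (ENNReal.rpow_pos_of_nonneg (pos_iff_ne_zero.2 hs0) hiq.le).ne'
  have hsT : s ≠ ∞ := by
    rintro rfl
    rw [ENNReal.top_rpow_of_pos hiq, ENNReal.mul_top] at hfin
    · exact hfin rfl
    · exact (ENNReal.rpow_pos_of_nonneg (pos_iff_ne_zero.2 ho0) hip.le).ne'
  have hmET : mE ≠ ∞ := (hmEm.trans_lt hm'.lt_top).ne
  have hoET : oE ≠ ∞ := (ho.trans_lt hoT.lt_top).ne
  have hsET : sE ≠ ∞ := (hs.trans_lt hsT.lt_top).ne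
  lift m to ℝ≥0 using hm'
  lift mE to ℝ≥0 using hmET
  lift s to ℝ≥0 using hsT
  lift sE to ℝ≥0 using hsET
  lift o to ℝ≥0 using hoT
  lift oE to ℝ≥0 using hoET
  lift A to ℝ≥0 using hA
  lift c to ℝ≥0 using hc
  simp only [ne_eq, ENNReal.coe_eq_zero] at hm hmE0 hc0 hoE0 hsE0 ho0 hs0
  have hp1 : 0 ≤ p - 1 := by linarith
  simp only [← ENNReal.coe_rpow_of_nonneg _ hip.le, ← ENNReal.coe_rpow_of_nonneg _ hiq.le,
    ← ENNReal.coe_rpow_of_nonneg _ hp1, ← ENNReal.coe_rpow_of_nonneg _ hp0.le,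
    ← ENNReal.coe_inv hm, ← ENNReal.coe_mul, ENNReal.coe_le_coe] at *
  have := real_sparse_weight_bound hpq hp2 (m := m) (mE := mE) (s := s) (sE := sE) (o := o)
    (oE := oE) (A := A) (c := c) (by positivity) (by positivity) (by positivity)
    (by positivity) (by positivity) (by exact_mod_cast hs) (by exact_mod_cast ho)
    (by exact_mod_cast hA1) (by exact_mod_cast hmc) (by exact_mod_cast hH)
  exact_mod_cast this

/-- The data are symmetric under exchange of `(p, o)` with `(q, s)`, and one of the two exponents is
at least `2`; this is the origin of `max p q`. -/
lemma sparse_weight_bound {p q : ℝ} (hpq : p.HolderConjugate q)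
    {m mE s sE o oE A c : ℝ≥0∞} (hm : m ≠ 0) (hm' : m ≠ ∞) (hA : A ≠ ∞) (hc : c ≠ ∞)
    (hs : sE ≤ s) (ho : oE ≤ o) (hmEm : mE ≤ m) (hA1 : o ^ (1 / p) * s ^ (1 / q) ≤ A * m)
    (hmc : m ≤ c * mE) (hH : mE ≤ oE ^ (1 / p) * sE ^ (1 / q)) :
    m⁻¹ * s * o ≤ c ^ (max p q - 1) * A ^ (max p q) * (sE ^ (1 / p) * oE ^ (1 / q)) := by
  rcases le_total 2 p with h2 | h2
  · have hqp : q ≤ p := by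
      have h1 : 1 / p + 1 / q = 1 := by simpa using hpq.inv_add_inv_eq_one
      have h3 : 1 / p ≤ 1 / 2 := one_div_le_one_div_of_le (by norm_num) h2
      exact (one_div_le_one_div hpq.pos hpq.symm.pos).1 (by linarith)
    rw [max_eq_left hqp]
    exact sparse_weight_bound_of_two_le hpq h2 hm hm' hA hc hs ho hmEm hA1 hmc hH
  · have h1 : 1 / p + 1 / q = 1 := by simpa using hpq.inv_add_inv_eq_one
    have h3 : 1 / 2 ≤ 1 / p := one_div_le_one_div_of_le hpq.pos h2
    have hqp : p ≤ q := (one_div_le_one_div hpq.symm.pos hpq.pos).1 (by linarith)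
    have hq2 : 2 ≤ q := (one_div_le_one_div hpq.symm.pos (by norm_num)).1 (by linarith)
    rw [max_eq_right hqp, mul_comm (sE ^ _), mul_right_comm]
    exact sparse_weight_bound_of_two_le hpq.symm hq2 hm hm' hA hc ho hs hmEm
      (by rw [mul_comm]; exact hA1) hmc (by rw [mul_comm]; exact hH)

/-- The constant in `sparse_bilinear_le`. -/
def sparseConst (p q : ℝ) (c : ℝ≥0∞) : ℝ≥0∞ :=
  c ^ (max p q - 1) * ENNReal.ofReal (2 ^ p * p / (p - 1)) ^ (1 / p) *
    ENNReal.ofReal (2 ^ q * q / (q - 1)) ^ (1 / q)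

lemma sparseConst_ne_top {p q : ℝ} (hpq : p.HolderConjugate q) {c : ℝ≥0∞} (hc : c ≠ ∞) :
    sparseConst p q c ≠ ∞ := by
  have := hpq.lt
  have := hpq.pos
  have := hpq.symm.pos
  refine ENNReal.mul_ne_top (ENNReal.mul_ne_top ?_ ?_) ?_
  · exact ENNReal.rpow_ne_top_of_nonneg (by linarith [le_max_left p q]) hc
  · exact ENNReal.rpow_ne_top_of_nonneg (by positivity) ENNReal.ofReal_ne_top
  · exact ENNReal.rpow_ne_top_of_nonneg (by positivity) ENNReal.ofReal_ne_top

/-- Since `φ ψ = 1`, the measure `ψ U dμ` equals `u dσ` with `dσ = ψ ^ q dμ` and `u = U φ ^ (q -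
1)`. Unweighted integrals over boxes thus become `σ`-averages of `u`, to which the Carleson
embedding applies, while the `L^p(σ)` norm of `u` is the `L^p(μ)` norm of `U` by the companion lemma
below. -/
lemma setLIntegral_withDensity_rpow {μ : Measure X} [SigmaFinite μ] {p q : ℝ}
    (hpq : p.HolderConjugate q) {φ ψ U : X → ℝ≥0∞} (hφ : Measurable φ) (hψ : Measurable ψ)
    (hU : Measurable U) (hφψ : ∀ᵐ x ∂μ, φ x * ψ x = 1) (s : Set X) (hs : MeasurableSet s) :
    ∫⁻ x in s, U x * φ x ^ (q - 1) ∂(μ.withDensity fun x => ψ x ^ q) = ∫⁻ x in s, ψ x * U x ∂μ := by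
  have hq1 : 0 < q - 1 := by linarith [hpq.symm.lt]
  have hm : Measurable fun x => U x * φ x ^ (q - 1) := hU.mul (hφ.pow_const _)
  rw [setLIntegral_withDensity_eq_setLIntegral_mul _ (hψ.pow_const q) hm hs]
  refine lintegral_congr_ae (ae_restrict_of_ae ?_)
  filter_upwards [hφψ] with x hx
  have h1 : ψ x ^ q = ψ x * ψ x ^ (q - 1) := by
    conv_lhs => rw [show q = 1 + (q - 1) by ring]
    rw [ENNReal.rpow_add_of_nonneg _ _ zero_le_one hq1.le, ENNReal.rpow_one]
  have h2 : φ x ^ (q - 1) * ψ x ^ (q - 1) = 1 := by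
    rw [← ENNReal.mul_rpow_of_nonneg _ _ hq1.le, hx, ENNReal.one_rpow]
  simp only [Pi.mul_apply]
  calc ψ x ^ q * (U x * φ x ^ (q - 1)) = ψ x * U x * (φ x ^ (q - 1) * ψ x ^ (q - 1)) := by
        rw [h1]; ring
    _ = ψ x * U x := by rw [h2, mul_one]

lemma lintegral_withDensity_rpow {μ : Measure X} [SigmaFinite μ] {p q : ℝ}
    (hpq : p.HolderConjugate q) {φ ψ U : X → ℝ≥0∞} (hφ : Measurable φ) (hψ : Measurable ψ)
    (hU : Measurable U) (hφψ : ∀ᵐ x ∂μ, φ x * ψ x = 1) :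
    ∫⁻ x, (U x * φ x ^ (q - 1)) ^ p ∂(μ.withDensity fun x => ψ x ^ q) = ∫⁻ x, U x ^ p ∂μ := by
  have hq1 : 0 < q - 1 := by linarith [hpq.symm.lt]
  have hm : Measurable fun x => (U x * φ x ^ (q - 1)) ^ p := (hU.mul (hφ.pow_const _)).pow_const p
  rw [lintegral_withDensity_eq_lintegral_mul _ (hψ.pow_const q) hm]
  refine lintegral_congr_ae ?_
  filter_upwards [hφψ] with x hx
  have h2 : φ x ^ q * ψ x ^ q = 1 := by
    rw [← ENNReal.mul_rpow_of_nonneg _ _ hpq.symm.nonneg, hx, ENNReal.one_rpow]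
  simp only [Pi.mul_apply]
  rw [ENNReal.mul_rpow_of_nonneg _ _ hpq.nonneg, ← ENNReal.rpow_mul, hpq.symm.sub_one_mul_conj]
  calc ψ x ^ q * (U x ^ p * φ x ^ q) = U x ^ p * (φ x ^ q * ψ x ^ q) := by ring
    _ = U x ^ p := by rw [h2, mul_one]

/-- The sharp weighted estimate for positive operators associated with a laminar family of sets,
as a bound for the bilinear form. -/
theorem sparse_bilinear_le {μ : Measure X} [SigmaFinite μ] {p q : ℝ} (hpq : p.HolderConjugate q)
    (B E : ι → Set X) (hB : ∀ i, MeasurableSet (B i)) (hE : ∀ i, MeasurableSet (E i))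
    (hEB : ∀ i, E i ⊆ B i) (hdis : Pairwise fun i j => Disjoint (E i) (E j))
    (hlam : ∀ i j, B i ⊆ B j ∨ B j ⊆ B i ∨ Disjoint (B i) (B j))
    (hB0 : ∀ i, μ (B i) ≠ 0) (hBT : ∀ i, μ (B i) ≠ ∞) {c : ℝ≥0∞} (hc : c ≠ ∞)
    (hBE : ∀ i, μ (B i) ≤ c * μ (E i)) {φ ψ : X → ℝ≥0∞} (hφ : Measurable φ) (hψ : Measurable ψ)
    (hφψ : ∀ᵐ x ∂μ, φ x * ψ x = 1) {A : ℝ≥0∞} (hA : A ≠ ∞)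
    (hAB : ∀ i, (∫⁻ x in B i, φ x ^ p ∂μ) ^ (1 / p) * (∫⁻ x in B i, ψ x ^ q ∂μ) ^ (1 / q) ≤
      A * μ (B i)) {U V : X → ℝ≥0∞} (hU : Measurable U) (hV : Measurable V) :
    ∑' i, (μ (B i))⁻¹ * (∫⁻ x in B i, ψ x * U x ∂μ) * (∫⁻ x in B i, φ x * V x ∂μ) ≤
      sparseConst p q c * A ^ (max p q) * (∫⁻ x, U x ^ p ∂μ) ^ (1 / p) *
        (∫⁻ x, V x ^ q ∂μ) ^ (1 / q) := by
  have hp0 : 0 < p := hpq.pos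
  have hq0 : 0 < q := hpq.symm.pos
  rw [ENNReal.tsum_eq_iSup_sum]
  refine iSup_le fun F => ?_
  set σ : Measure X := μ.withDensity fun x => ψ x ^ q with hσ
  set ω : Measure X := μ.withDensity fun x => φ x ^ p with hω
  have hψφ : ∀ᵐ x ∂μ, ψ x * φ x = 1 := by simpa only [mul_comm] using hφψ
  set u : X → ℝ≥0∞ := fun x => U x * φ x ^ (q - 1) with hu
  set v : X → ℝ≥0∞ := fun x => V x * ψ x ^ (p - 1) with hv
  have hum : Measurable u := hU.mul (hφ.pow_const _)
  have hvm : Measurable v := hV.mul (hψ.pow_const _)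
  have hσB : ∀ s, MeasurableSet s → σ s = ∫⁻ x in s, ψ x ^ q ∂μ := fun s hs => withDensity_apply _ hs
  have hωB : ∀ s, MeasurableSet s → ω s = ∫⁻ x in s, φ x ^ p ∂μ := fun s hs => withDensity_apply _ hs
  set a : ι → ℝ≥0∞ := fun i => (∫⁻ x in B i, u x ∂σ) / σ (B i) with ha
  set b : ι → ℝ≥0∞ := fun i => (∫⁻ x in B i, v x ∂ω) / ω (B i) with hb
  -- Hölder applied to `1 = φ ψ`. On the parts `E i` this bounds the weight masses from below, which
  -- replaces any doubling or `A_∞` property of the weights.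
  have hholder : ∀ s, MeasurableSet s → μ s ≤ ω s ^ (1 / p) * σ s ^ (1 / q) := by
    intro s hs
    rw [hσB s hs, hωB s hs]
    calc μ s = ∫⁻ x in s, (φ * ψ) x ∂μ := by
          rw [← setLIntegral_one]
          refine lintegral_congr_ae (ae_restrict_of_ae ?_)
          filter_upwards [hφψ] with x hx using hx.symm
      _ ≤ _ := ENNReal.lintegral_mul_le_Lp_mul_Lq _ hpq hφ.aemeasurable hψ.aemeasurable
  -- Each term is rewritten with the averages `a i`, `b i` and with weight masses on the disjoint
  -- parts only, so that Hölder over `i` leaves two Carleson sums.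
  have hterm : ∀ i, (μ (B i))⁻¹ * (∫⁻ x in B i, ψ x * U x ∂μ) * (∫⁻ x in B i, φ x * V x ∂μ) ≤
      c ^ (max p q - 1) * A ^ (max p q) *
        ((σ (E i) ^ (1 / p) * a i) * (ω (E i) ^ (1 / q) * b i)) := by
    intro i
    have hw := sparse_weight_bound hpq (hB0 i) (hBT i) hA hc (measure_mono (μ := σ) (hEB i))
      (measure_mono (μ := ω) (hEB i)) (measure_mono (μ := μ) (hEB i))
      (by rw [hσB _ (hB i), hωB _ (hB i)]; exact hAB i) (hBE i) (hholder _ (hE i))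
    have h1 : ∫⁻ x in B i, ψ x * U x ∂μ = ∫⁻ x in B i, u x ∂σ :=
      (setLIntegral_withDensity_rpow hpq hφ hψ hU hφψ _ (hB i)).symm
    have h2 : ∫⁻ x in B i, φ x * V x ∂μ = ∫⁻ x in B i, v x ∂ω :=
      (setLIntegral_withDensity_rpow hpq.symm hψ hφ hV hψφ _ (hB i)).symm
    have h0 := hholder _ (hB i)
    have hprod : ω (B i) ^ (1 / p) * σ (B i) ^ (1 / q) ≠ 0 := fun h =>
      hB0 i (le_antisymm (h ▸ h0) zero_le)
    have hprodT : ω (B i) ^ (1 / p) * σ (B i) ^ (1 / q) ≠ ∞ := by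
      rw [hσB _ (hB i), hωB _ (hB i)]
      exact ((hAB i).trans_lt (ENNReal.mul_lt_top hA.lt_top (hBT i).lt_top)).ne
    have hσ0 : σ (B i) ≠ 0 := fun h => hprod (by
      rw [h, ENNReal.zero_rpow_of_pos (by positivity), mul_zero])
    have hω0 : ω (B i) ≠ 0 := fun h => hprod (by
      rw [h, ENNReal.zero_rpow_of_pos (by positivity), zero_mul])
    have hσT : σ (B i) ≠ ∞ := fun h => hprodT (by
      rw [h, ENNReal.top_rpow_of_pos (by positivity), ENNReal.mul_top]
      exact (ENNReal.rpow_pos_of_nonneg (pos_iff_ne_zero.2 hω0) (by positivity)).ne')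
    have hωT : ω (B i) ≠ ∞ := fun h => hprodT (by
      rw [h, ENNReal.top_rpow_of_pos (by positivity), ENNReal.top_mul]
      exact (ENNReal.rpow_pos_of_nonneg (pos_iff_ne_zero.2 hσ0) (by positivity)).ne')
    have h3 : ∫⁻ x in B i, u x ∂σ = σ (B i) * a i := (ENNReal.mul_div_cancel hσ0 hσT).symm
    have h4 : ∫⁻ x in B i, v x ∂ω = ω (B i) * b i := (ENNReal.mul_div_cancel hω0 hωT).symm
    rw [h1, h2, h3, h4]
    calc (μ (B i))⁻¹ * (σ (B i) * a i) * (ω (B i) * b i)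
        = (μ (B i))⁻¹ * σ (B i) * ω (B i) * (a i * b i) := by ring
      _ ≤ c ^ (max p q - 1) * A ^ (max p q) * (σ (E i) ^ (1 / p) * ω (E i) ^ (1 / q)) *
          (a i * b i) := by gcongr
      _ = _ := by ring
  have hpow : ∀ (r : ℝ), 0 < r → ∀ x y : ℝ≥0∞, (x ^ (1 / r) * y) ^ r = x * y ^ r := by
    intro r hr x y
    rw [ENNReal.mul_rpow_of_nonneg _ _ hr.le, ← ENNReal.rpow_mul, one_div_mul_cancel hr.ne',
      ENNReal.rpow_one]
  have hcu := carleson_embedding σ B E hB hE hEB hdis F (fun i _ j _ => hlam i j) hpq.lt u hum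
  have hcv := carleson_embedding ω B E hB hE hEB hdis F (fun i _ j _ => hlam i j) hpq.symm.lt v hvm
  rw [lintegral_withDensity_rpow hpq hφ hψ hU hφψ] at hcu
  rw [lintegral_withDensity_rpow hpq.symm hψ hφ hV hψφ] at hcv
  calc ∑ i ∈ F, (μ (B i))⁻¹ * (∫⁻ x in B i, ψ x * U x ∂μ) * (∫⁻ x in B i, φ x * V x ∂μ)
      ≤ ∑ i ∈ F, c ^ (max p q - 1) * A ^ (max p q) *
        ((σ (E i) ^ (1 / p) * a i) * (ω (E i) ^ (1 / q) * b i)) :=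
        Finset.sum_le_sum fun i _ => hterm i
    _ = c ^ (max p q - 1) * A ^ (max p q) *
        ∑ i ∈ F, (σ (E i) ^ (1 / p) * a i) * (ω (E i) ^ (1 / q) * b i) := (Finset.mul_sum ..).symm
    _ ≤ c ^ (max p q - 1) * A ^ (max p q) *
        ((∑ i ∈ F, (σ (E i) ^ (1 / p) * a i) ^ p) ^ (1 / p) *
          (∑ i ∈ F, (ω (E i) ^ (1 / q) * b i) ^ q) ^ (1 / q)) := by
        gcongr
        exact ENNReal.inner_le_Lp_mul_Lq F _ _ hpq
    _ ≤ c ^ (max p q - 1) * A ^ (max p q) *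
        ((ENNReal.ofReal (2 ^ p * p / (p - 1)) * ∫⁻ x, U x ^ p ∂μ) ^ (1 / p) *
          (ENNReal.ofReal (2 ^ q * q / (q - 1)) * ∫⁻ x, V x ^ q ∂μ) ^ (1 / q)) := by
        simp only [hpow p hp0, hpow q hq0]
        gcongr
    _ = _ := by
        rw [ENNReal.mul_rpow_of_nonneg _ _ (by positivity),
          ENNReal.mul_rpow_of_nonneg _ _ (by positivity), sparseConst]
        ring

end Sparse

/-! ### The measure on the half-plane -/

/-- The upper half-plane. -/
abbrev halfPlane : Set ℂ := {z | 0 < z.im}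

lemma isOpen_halfPlane : IsOpen halfPlane := isOpen_lt continuous_const Complex.continuous_im

lemma measurableSet_halfPlane : MeasurableSet halfPlane := isOpen_halfPlane.measurableSet

instance sigmaFinite_halfPlaneMeasure (a : ℝ) : SigmaFinite (halfPlaneMeasure a) :=
  SigmaFinite.withDensity fun z : ℂ => (z.im ^ a).toNNReal

lemma ae_mem_halfPlane (a : ℝ) : ∀ᵐ z ∂halfPlaneMeasure a, z ∈ halfPlane :=
  (withDensity_absolutelyContinuous _ _).ae_le (ae_restrict_mem measurableSet_halfPlane)

lemma lintegral_halfPlaneMeasure (a : ℝ) {F : ℂ → ℝ≥0∞} (hF : Measurable F) :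
    ∫⁻ z, F z ∂halfPlaneMeasure a = ∫⁻ z in halfPlane, ENNReal.ofReal (z.im ^ a) * F z := by
  rw [halfPlaneMeasure, lintegral_withDensity_eq_lintegral_mul _ (by fun_prop) hF]
  rfl

lemma lintegral_halfPlaneMeasure_eq_iterated (a : ℝ) {F : ℂ → ℝ≥0∞} (hF : Measurable F) :
    ∫⁻ z, F z ∂halfPlaneMeasure a =
      ∫⁻ y in Ioi (0 : ℝ), ENNReal.ofReal (y ^ a) * ∫⁻ x : ℝ, F (x + y * Complex.I) := by
  rw [lintegral_halfPlaneMeasure a hF, ← lintegral_indicator measurableSet_halfPlane,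
    ← Complex.volume_preserving_equiv_real_prod.symm.lintegral_comp_emb
      Complex.measurableEquivRealProd.symm.measurableEmbedding, Measure.volume_eq_prod,
    lintegral_prod_symm, ← lintegral_indicator measurableSet_Ioi]
  · refine lintegral_congr fun y => ?_
    by_cases hy : 0 < y
    · rw [indicator_of_mem (mem_Ioi.2 hy), ← lintegral_const_mul' _ _ ENNReal.ofReal_ne_top]
      refine lintegral_congr fun x => ?_
      have : Complex.measurableEquivRealProd.symm (x, y) = x + y * Complex.I := by
        rw [Complex.measurableEquivRealProd_symm_apply]; exact Complex.mk_eq_add_mul_I x y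
      rw [this, indicator_of_mem (by simpa using hy)]
      simp
    · rw [indicator_of_notMem (by simpa using hy)]
      have : ∀ x : ℝ, halfPlane.indicator (fun z => ENNReal.ofReal (z.im ^ a) * F z)
          (Complex.measurableEquivRealProd.symm (x, y)) = 0 := fun x =>
        indicator_of_notMem (by
          rw [Complex.measurableEquivRealProd_symm_apply]; simpa using hy) _
      simp only [this, lintegral_zero]
  · have hm : Measurable (halfPlane.indicator fun z => ENNReal.ofReal (z.im ^ a) * F z) :=
      (Measurable.mul (by fun_prop) hF).indicator measurableSet_halfPlane
    exact (hm.comp Complex.measurableEquivRealProd.symm.measurable).aemeasurable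

lemma halfPlaneMeasure_reProdIm (a : ℝ) {I J : Set ℝ} (hI : MeasurableSet I) (hJ : MeasurableSet J)
    (hJ0 : J ⊆ Ioi 0) :
    halfPlaneMeasure a (I ×ℂ J) = volume I * ∫⁻ y in J, ENNReal.ofReal (y ^ a) := by
  have hm : MeasurableSet (I ×ℂ J) :=
    (Complex.measurable_re hI).inter (Complex.measurable_im hJ)
  rw [← lintegral_indicator_one hm, lintegral_halfPlaneMeasure_eq_iterated a
    (measurable_one.indicator hm), ← lintegral_const_mul _ (by fun_prop),
    ← lintegral_indicator measurableSet_Ioi, ← lintegral_indicator hJ]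
  refine lintegral_congr fun y => ?_
  by_cases hy : y ∈ J
  · rw [indicator_of_mem hy, indicator_of_mem (hJ0 hy), mul_comm]
    congr 1
    rw [← lintegral_indicator_one hI]
    refine lintegral_congr fun x => ?_
    by_cases hx : x ∈ I
    · rw [indicator_of_mem hx, indicator_of_mem]; · rfl
      simp [Complex.mem_reProdIm, hx, hy]
    · rw [indicator_of_notMem hx, indicator_of_notMem]
      simp [Complex.mem_reProdIm, hx]
  · rw [indicator_of_notMem hy]
    by_cases hy0 : y ∈ Ioi (0 : ℝ)
    · rw [indicator_of_mem hy0]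
      have : ∀ x : ℝ, (I ×ℂ J).indicator (1 : ℂ → ℝ≥0∞) (x + y * Complex.I) = 0 := fun x =>
        indicator_of_notMem (by simp [Complex.mem_reProdIm, hy]) _
      simp [this]
    · rw [indicator_of_notMem hy0]

lemma setLIntegral_Ioo_rpow_im {a : ℝ} (ha : -1 < a) {s t : ℝ} (hs : 0 ≤ s) (hst : s ≤ t) :
    ∫⁻ y in Ioo s t, ENNReal.ofReal (y ^ a) =
      ENNReal.ofReal ((t ^ (a + 1) - s ^ (a + 1)) / (a + 1)) := by
  have hI : IntervalIntegrable (fun y : ℝ => y ^ a) volume s t :=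
    intervalIntegral.intervalIntegrable_rpow' ha
  rw [← ofReal_integral_eq_lintegral_ofReal]
  · rw [← integral_Ioc_eq_integral_Ioo, ← intervalIntegral.integral_of_le hst,
      integral_rpow (Or.inl ha)]
  · exact ((intervalIntegrable_iff_integrableOn_Ioc_of_le hst).1 hI).mono_set Ioo_subset_Ioc_self
  · filter_upwards [ae_restrict_mem measurableSet_Ioo] with l hl
    exact Real.rpow_nonneg (hs.trans hl.1.le) _

/-! ### Holomorphic changes of variables in the plane -/

lemma abs_det_restrictScalars_toSpanSingleton (c : ℂ) :
    |((ContinuousLinearMap.toSpanSingleton ℂ c).restrictScalars ℝ : ℂ →L[ℝ] ℂ).det| = ‖c‖ ^ 2 := by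
  have h : (((ContinuousLinearMap.toSpanSingleton ℂ c).restrictScalars ℝ : ℂ →L[ℝ] ℂ) : ℂ →ₗ[ℝ] ℂ)
      = Algebra.lmul ℝ ℂ c := by
    ext; simp [mul_comm]
  rw [ContinuousLinearMap.det, h, ← Algebra.norm_apply, Algebra.norm_complex_apply,
    Complex.normSq_eq_norm_sq, abs_of_nonneg (by positivity)]

lemma lintegral_image_eq_lintegral_norm_deriv_sq {s : Set ℂ} (hs : MeasurableSet s) {Φ Φ' : ℂ → ℂ}
    (hΦ : ∀ z ∈ s, HasDerivAt Φ (Φ' z) z) (hinj : InjOn Φ s) (F : ℂ → ℝ≥0∞) :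
    ∫⁻ z in Φ '' s, F z = ∫⁻ z in s, ENNReal.ofReal (‖Φ' z‖ ^ 2) * F (Φ z) := by
  rw [lintegral_image_eq_lintegral_abs_det_fderiv_mul volume hs
    (fun z hz => ((hΦ z hz).hasFDerivAt.restrictScalars ℝ).hasFDerivWithinAt) hinj]
  simp only [abs_det_restrictScalars_toSpanSingleton]

lemma integral_image_eq_integral_norm_deriv_sq {s : Set ℂ} (hs : MeasurableSet s) {Φ Φ' : ℂ → ℂ}
    (hΦ : ∀ z ∈ s, HasDerivAt Φ (Φ' z) z) (hinj : InjOn Φ s) (F : ℂ → ℂ) :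
    ∫ z in Φ '' s, F z = ∫ z in s, (‖Φ' z‖ ^ 2) • F (Φ z) := by
  rw [integral_image_eq_integral_abs_det_fderiv_smul volume hs
    (fun z hz => ((hΦ z hz).hasFDerivAt.restrictScalars ℝ).hasFDerivWithinAt) hinj]
  simp only [abs_det_restrictScalars_toSpanSingleton]

lemma integrableOn_image_iff_norm_deriv_sq {s : Set ℂ} (hs : MeasurableSet s) {Φ Φ' : ℂ → ℂ}
    (hΦ : ∀ z ∈ s, HasDerivAt Φ (Φ' z) z) (hinj : InjOn Φ s) (F : ℂ → ℂ) :
    IntegrableOn F (Φ '' s) ↔ IntegrableOn (fun z => (‖Φ' z‖ ^ 2) • F (Φ z)) s := by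
  rw [integrableOn_image_iff_integrableOn_abs_det_fderiv_smul volume hs
    (fun z hz => ((hΦ z hz).hasFDerivAt.restrictScalars ℝ).hasFDerivWithinAt) hinj]
  simp only [abs_det_restrictScalars_toSpanSingleton]

/-! ### The modulus of the kernel -/

/-- The modulus of the kernel without its constant factor. -/
def modKernel (a : ℝ) (z w : ℂ) : ℝ≥0∞ := ENNReal.ofReal (‖z - conj w‖ ^ (-(2 + a)))

lemma measurable_modKernel (a : ℝ) : Measurable fun x : ℂ × ℂ => modKernel a x.1 x.2 := by
  unfold modKernel
  fun_prop

lemma norm_sub_conj_comm (z w : ℂ) : ‖z - conj w‖ = ‖w - conj z‖ := by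
  rw [← RCLike.norm_conj (z - conj w), map_sub, RCLike.conj_conj, norm_sub_rev]

lemma modKernel_comm (a : ℝ) (z w : ℂ) : modKernel a z w = modKernel a w z := by
  rw [modKernel, modKernel, norm_sub_conj_comm]

lemma im_sub_conj (z w : ℂ) : (z - conj w).im = z.im + w.im := by simp

lemma im_add_im_le_norm (z w : ℂ) : z.im + w.im ≤ ‖z - conj w‖ := by
  rw [← im_sub_conj]; exact (le_abs_self _).trans (Complex.abs_im_le_norm _)

lemma norm_sub_conj_pos {z w : ℂ} (hz : z ∈ halfPlane) (hw : w ∈ halfPlane) :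
    0 < ‖z - conj w‖ := by
  have := im_add_im_le_norm z w
  have h1 : 0 < z.im := hz
  have h2 : 0 < w.im := hw
  linarith

lemma modKernel_pos {a : ℝ} {z w : ℂ} (hz : z ∈ halfPlane) (hw : w ∈ halfPlane) :
    0 < modKernel a z w := ENNReal.ofReal_pos.2 (Real.rpow_pos_of_pos (norm_sub_conj_pos hz hw) _)

lemma modKernel_ne_top (a : ℝ) (z w : ℂ) : modKernel a z w ≠ ∞ := ENNReal.ofReal_ne_top

/-- The integral of the power `s` of the kernel with pole at `i`. -/
def modKernelMass (a s : ℝ) : ℝ≥0∞ := ∫⁻ z, modKernel a z Complex.I ^ s ∂halfPlaneMeasure a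

/-- The affine map `ξ ↦ Re w + Im w * ξ` preserves the half-plane and sends `i` to `w`. Jacobian,
weight and kernel contribute the powers `2`, `a` and `-(2 + a) * s` of `Im w`. The identity holds
also when both sides are infinite. -/
lemma lintegral_modKernel_rpow {a s : ℝ} (hs : 0 < s) {w : ℂ} (hw : w ∈ halfPlane) :
    ∫⁻ z, modKernel a z w ^ s ∂halfPlaneMeasure a =
      ENNReal.ofReal (w.im ^ ((2 + a) * (1 - s))) * modKernelMass a s := by
  have hw0 : 0 < w.im := hw
  have hm : ∀ w, Measurable fun z => modKernel a z w ^ s := fun w =>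
    ((measurable_modKernel a).comp (measurable_id.prodMk measurable_const)).pow_const s
  set Φ : ℂ → ℂ := fun ξ => w.re + w.im * ξ with hΦ
  have himg : Φ '' halfPlane = halfPlane := by
    ext z
    constructor
    · rintro ⟨ξ, hξ, rfl⟩
      have : 0 < ξ.im := hξ
      simp only [hΦ, mem_ofPred_eq, Complex.add_im, Complex.ofReal_im, Complex.mul_im,
        Complex.ofReal_re, zero_mul, add_zero, zero_add]
      positivity
    · intro hz
      have hz : 0 < z.im := hz
      have hwc : (w.im : ℂ) ≠ 0 := by exact_mod_cast hw0.ne'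
      refine ⟨((w.im⁻¹ : ℝ) : ℂ) * (z - w.re), ?_, ?_⟩
      · simp only [mem_ofPred_eq, Complex.im_ofReal_mul, Complex.sub_im,
          Complex.ofReal_im, sub_zero]
        positivity
      · simp only [hΦ]
        push_cast
        field_simp
        ring
  have hder : ∀ ξ ∈ halfPlane, HasDerivAt Φ (w.im : ℂ) ξ := fun ξ _ => by
    have := ((hasDerivAt_id' ξ).const_mul (w.im : ℂ)).const_add (w.re : ℂ)
    rwa [mul_one] at this
  have hinj : InjOn Φ halfPlane := by
    intro x _ y _ hxy
    have hwc : (w.im : ℂ) ≠ 0 := by exact_mod_cast hw0.ne'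
    simpa [hΦ, hwc, hw0.ne'] using hxy
  rw [modKernelMass, lintegral_halfPlaneMeasure a (hm w), lintegral_halfPlaneMeasure a (hm _),
    ← lintegral_const_mul' _ _ ENNReal.ofReal_ne_top]
  conv_lhs => rw [← himg]
  rw [lintegral_image_eq_lintegral_norm_deriv_sq measurableSet_halfPlane hder hinj]
  refine setLIntegral_congr_fun measurableSet_halfPlane fun ξ hξ => ?_
  have hξ : 0 < ξ.im := hξ
  have him : (Φ ξ).im = w.im * ξ.im := by simp [hΦ]
  have hsub : Φ ξ - conj w = w.im * (ξ - conj Complex.I) := by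
    simp only [hΦ, Complex.conj_I, sub_neg_eq_add]
    apply Complex.ext <;> simp
    ring
  have hnn : ‖Φ ξ - conj w‖ = w.im * ‖ξ - conj Complex.I‖ := by
    rw [hsub, norm_mul, Complex.norm_real, Real.norm_of_nonneg hw0.le]
  simp only [modKernel]
  rw [hnn, him, Complex.norm_real, Real.norm_of_nonneg hw0.le,
    ENNReal.ofReal_rpow_of_nonneg (by positivity) hs.le,
    ENNReal.ofReal_rpow_of_nonneg (by positivity) hs.le, ← ENNReal.ofReal_mul (by positivity),
    ← ENNReal.ofReal_mul (by positivity), ← ENNReal.ofReal_mul (by positivity),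
    ← ENNReal.ofReal_mul (by positivity)]
  congr 1
  rw [Real.mul_rpow hw0.le hξ.le, Real.mul_rpow hw0.le (norm_nonneg _),
    Real.mul_rpow (by positivity) (by positivity), ← Real.rpow_mul hw0.le]
  have : w.im ^ 2 * (w.im ^ a * w.im ^ (-(2 + a) * s)) = w.im ^ ((2 + a) * (1 - s)) := by
    rw [← Real.rpow_natCast, ← Real.rpow_add hw0, ← Real.rpow_add hw0]
    congr 1; push_cast; ring
  rw [← this]; ring

lemma modKernelMass_ne_zero (a s : ℝ) : modKernelMass a s ≠ 0 := by
  intro h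
  have hm : Measurable fun z => modKernel a z Complex.I ^ s :=
    ((measurable_modKernel a).comp (measurable_id.prodMk measurable_const)).pow_const s
  rw [modKernelMass, lintegral_halfPlaneMeasure a hm, lintegral_eq_zero_iff (by fun_prop)] at h
  have h1 := (ae_restrict_iff' measurableSet_halfPlane).1 h
  have h2 : volume halfPlane = 0 := by
    refine measure_mono_null ?_ h1
    intro z hz
    have hz0 : 0 < z.im := hz
    simp only [mem_compl_iff, mem_ofPred_eq, Classical.not_imp]
    refine ⟨hz, ?_⟩
    simp only [Pi.zero_apply, mul_eq_zero, not_or, ENNReal.ofReal_eq_zero, not_le]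
    refine ⟨by positivity, ?_⟩
    exact (ENNReal.rpow_pos (modKernel_pos hz (by simp)) (modKernel_ne_top _ _ _)).ne'
  exact (isOpen_halfPlane.measure_pos volume ⟨Complex.I, by simp⟩).ne' h2

lemma lintegral_Ioi_rpow_mul_one_add_rpow_lt_top {a b : ℝ} (ha : -1 < a) (hb : a + 1 < b) :
    ∫⁻ y in Ioi (0 : ℝ), ENNReal.ofReal (y ^ a) * ENNReal.ofReal ((1 + y) ^ (-b)) < ∞ := by
  have hb0 : 0 < b := by linarith
  rw [← Ioc_union_Ioi_eq_Ioi (zero_le_one (α := ℝ))]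
  refine (lintegral_union_le _ _ _).trans_lt (ENNReal.add_lt_top.2 ⟨?_, ?_⟩)
  · have hI : IntegrableOn (fun y : ℝ => y ^ a) (Ioc 0 1) :=
      (intervalIntegrable_iff_integrableOn_Ioc_of_le zero_le_one).1
        (intervalIntegral.intervalIntegrable_rpow' ha)
    refine lt_of_le_of_lt ?_ hI.lintegral_lt_top
    refine setLIntegral_mono' measurableSet_Ioc fun y hy => ?_
    have h1 : (1 + y) ^ (-b) ≤ 1 := Real.rpow_le_one_of_one_le_of_nonpos (by linarith [hy.1])
      (by linarith)
    calc _ ≤ ENNReal.ofReal (y ^ a) * ENNReal.ofReal 1 := by gcongr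
      _ = _ := by simp
  · have hI : IntegrableOn (fun y : ℝ => y ^ (a - b)) (Ioi 1) :=
      integrableOn_Ioi_rpow_of_lt (by linarith) zero_lt_one
    refine lt_of_le_of_lt ?_ hI.lintegral_lt_top
    refine setLIntegral_mono' measurableSet_Ioi fun y hy => ?_
    have hy : 1 < y := hy
    have hy0 : 0 < y := by linarith
    have h1 : (1 + y) ^ (-b) ≤ y ^ (-b) := Real.rpow_le_rpow_of_nonpos hy0 (by linarith)
      (by linarith)
    rw [← ENNReal.ofReal_mul (by positivity), sub_eq_add_neg, Real.rpow_add hy0]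
    gcongr

lemma modKernelMass_ne_top {a s : ℝ} (ha : -1 < a) (hs : 1 < s) : modKernelMass a s ≠ ∞ := by
  have hm : Measurable fun z => modKernel a z Complex.I ^ s :=
    ((measurable_modKernel a).comp (measurable_id.prodMk measurable_const)).pow_const s
  -- With this `δ` the total decay `(2 + a) * s` splits as `(1 + δ) + (a + 1 + δ)`, just enough for
  -- convergence in `x` and in `y` separately.
  set δ : ℝ := (2 + a) * (s - 1) / 2 with hδ
  have hδ0 : 0 < δ := by
    have : 0 < 2 + a := by linarith
    have : 0 < s - 1 := by linarith
    positivity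
  have hX : ∫⁻ x : ℝ, ENNReal.ofReal ((1 + ‖x‖) ^ (-(1 + δ))) < ∞ := by
    refine Integrable.lintegral_lt_top (integrable_one_add_norm ?_)
    simp only [Module.finrank_self, Nat.cast_one]; linarith
  have hY := lintegral_Ioi_rpow_mul_one_add_rpow_lt_top ha (b := a + 1 + δ) (by linarith)
  refine ne_of_lt ?_
  rw [modKernelMass, lintegral_halfPlaneMeasure_eq_iterated a hm]
  calc ∫⁻ y in Ioi (0 : ℝ), ENNReal.ofReal (y ^ a) *
        ∫⁻ x : ℝ, modKernel a (x + y * Complex.I) Complex.I ^ s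
      ≤ ∫⁻ y in Ioi (0 : ℝ), ENNReal.ofReal (2 ^ (1 + δ)) *
          (∫⁻ x : ℝ, ENNReal.ofReal ((1 + ‖x‖) ^ (-(1 + δ)))) *
          (ENNReal.ofReal (y ^ a) * ENNReal.ofReal ((1 + y) ^ (-(a + 1 + δ)))) := by
        refine setLIntegral_mono' measurableSet_Ioi fun y hy => ?_
        have hy : 0 < y := hy
        rw [mul_left_comm]
        refine mul_le_mul' le_rfl ?_
        rw [mul_right_comm, ← ENNReal.ofReal_mul (by positivity),
          ← lintegral_const_mul' _ _ ENNReal.ofReal_ne_top]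
        refine lintegral_mono fun x => ?_
        simp only [modKernel]
        rw [ENNReal.ofReal_rpow_of_nonneg (by positivity) (by linarith),
          ← ENNReal.ofReal_mul (by positivity)]
        refine ENNReal.ofReal_le_ofReal ?_
        have hy1 : 1 + y ≤ ‖(x + y * Complex.I : ℂ) - conj Complex.I‖ := by
          have := im_add_im_le_norm (x + y * Complex.I) Complex.I
          simp at this ⊢; linarith
        have hx1 : |x| ≤ ‖(x + y * Complex.I : ℂ) - conj Complex.I‖ := by
          have := Complex.abs_re_le_norm ((x + y * Complex.I : ℂ) - conj Complex.I)
          simpa using this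
        set R := ‖(x + y * Complex.I : ℂ) - conj Complex.I‖ with hR
        have hR0 : 0 < R := by linarith
        have hxR : (1 + ‖x‖) / 2 ≤ R := by rw [Real.norm_eq_abs]; linarith
        have e1 : (R ^ (-(2 + a))) ^ s = R ^ (-(1 + δ)) * R ^ (-(a + 1 + δ)) := by
          rw [← Real.rpow_mul hR0.le, ← Real.rpow_add hR0]
          congr 1; rw [hδ]; ring
        rw [e1]
        have e2 : R ^ (-(1 + δ)) ≤ ((1 + ‖x‖) / 2) ^ (-(1 + δ)) :=
          Real.rpow_le_rpow_of_nonpos (by positivity) hxR (by linarith)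
        have e3 : R ^ (-(a + 1 + δ)) ≤ (1 + y) ^ (-(a + 1 + δ)) :=
          Real.rpow_le_rpow_of_nonpos (by positivity) hy1 (by linarith)
        have e4 : ((1 + ‖x‖) / 2) ^ (-(1 + δ)) = 2 ^ (1 + δ) * (1 + ‖x‖) ^ (-(1 + δ)) := by
          rw [Real.div_rpow (by positivity) (by norm_num), Real.rpow_neg (by norm_num : (0:ℝ) ≤ 2)]
          field_simp
        calc _ ≤ ((1 + ‖x‖) / 2) ^ (-(1 + δ)) * (1 + y) ^ (-(a + 1 + δ)) := by gcongr
          _ = _ := by rw [e4]; ring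
    _ < ∞ := by
        rw [lintegral_const_mul _ (by fun_prop)]
        exact ENNReal.mul_lt_top (ENNReal.mul_lt_top ENNReal.ofReal_lt_top hX) hY

/-! ### Two dyadic grids of Carleson boxes -/

/-- The alternating sign `(-1)^k`. -/
def altSign (k : ℤ) : ℤ := if Even k then 1 else -1

lemma altSign_succ (k : ℤ) : altSign (k + 1) = -altSign k := by
  unfold altSign
  by_cases h : Even k <;> simp [h]

/-- The position of the point `x` in the grid of mesh `2 ^ k`, shifted by a third if `b = 1`. -/
def gridPos (b k : ℤ) (x : ℝ) : ℝ := x / 2 ^ k - b * altSign k / 3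

lemma floor_add_int_div_two (t : ℝ) (e : ℤ) : ⌊(t + e) / 2⌋ = (⌊t⌋ + e) / 2 := by
  have := Int.floor_div_natCast (t + e) 2
  rw [Int.floor_add_intCast] at this
  exact_mod_cast this

/-- The reason for the alternating sign: with it, the position at mesh `2 ^ (k + 1)` is half of an
integer translate of the position at mesh `2 ^ k`. The cell of a point therefore determines all its
coarser cells, also in the shifted grid. -/
lemma floor_gridPos_succ (b k : ℤ) (x : ℝ) :
    ⌊gridPos b (k + 1) x⌋ = (⌊gridPos b k x⌋ + b * altSign k) / 2 := by
  rw [← floor_add_int_div_two]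
  congr 1
  unfold gridPos
  rw [altSign_succ, zpow_add_one₀ (by norm_num)]
  push_cast
  field_simp
  ring

lemma floor_gridPos_eq_of_le {b k l : ℤ} (hkl : k ≤ l) {x y : ℝ}
    (h : ⌊gridPos b k x⌋ = ⌊gridPos b k y⌋) : ⌊gridPos b l x⌋ = ⌊gridPos b l y⌋ := by
  induction l, hkl using Int.leInduction with
  | base => exact h
  | succ l _ ih => rw [floor_gridPos_succ, floor_gridPos_succ, ih]

lemma exists_int_between_of_floor_ne {x y : ℝ} (h : ⌊x⌋ ≠ ⌊y⌋) :
    ∃ N : ℤ, min x y < N ∧ N ≤ max x y := by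
  rcases lt_or_gt_of_ne h with h | h
  · refine ⟨⌊y⌋, (min_le_left _ _).trans_lt ?_, (Int.floor_le y).trans (le_max_right _ _)⟩
    exact (Int.lt_floor_add_one x).trans_le (by exact_mod_cast h)
  · refine ⟨⌊x⌋, (min_le_right _ _).trans_lt ?_, (Int.floor_le x).trans (le_max_left _ _)⟩
    exact (Int.lt_floor_add_one y).trans_le (by exact_mod_cast h)

/-- The one-third trick. If both grids separated `x` and `y`, each would have an endpoint between
them; in units of `2 ^ k` two such endpoints differ by an integer plus or minus `1 / 3`, hence by at
least `1 / 3`, which exceeds the distance of `x` and `y`. -/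
lemma floor_gridPos_eq_or {k : ℤ} {x y : ℝ} (h : 3 * |x - y| < 2 ^ k) :
    ⌊gridPos 0 k x⌋ = ⌊gridPos 0 k y⌋ ∨ ⌊gridPos 1 k x⌋ = ⌊gridPos 1 k y⌋ := by
  by_contra! hne
  obtain ⟨N, hN1, hN2⟩ := exists_int_between_of_floor_ne hne.1
  obtain ⟨N', hN1', hN2'⟩ := exists_int_between_of_floor_ne hne.2
  have h2 : (0 : ℝ) < 2 ^ k := by positivity
  set X := x / 2 ^ k with hX
  set Y := y / 2 ^ k with hY
  have hXY : |X - Y| < 1 / 3 := by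
    rw [hX, hY, ← sub_div, abs_div, abs_of_pos h2, div_lt_div_iff₀ h2 (by norm_num)]
    linarith
  have e0 : ∀ x : ℝ, gridPos 0 k x = x / 2 ^ k := fun x => by simp [gridPos]
  have e1 : ∀ x : ℝ, gridPos 1 k x = x / 2 ^ k - altSign k / 3 := fun x => by simp [gridPos]
  rw [e0, e0] at hN1 hN2
  rw [e1, e1, min_sub_sub_right] at hN1'
  rw [e1, e1, max_sub_sub_right] at hN2'
  have hmm : max X Y - min X Y < 1 / 3 := by rw [max_sub_min_eq_abs', ]; exact hXY
  have a1 : ((N : ℝ) - N') - altSign k / 3 < 1 / 3 := by linarith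
  have a2 : -(1 / 3) < ((N : ℝ) - N') - altSign k / 3 := by linarith
  unfold altSign at a1 a2
  split_ifs at a1 a2
  · have b1 : (0 : ℝ) < ((N - N' : ℤ) : ℝ) := by push_cast at *; linarith
    have b2 : ((N - N' : ℤ) : ℝ) < 1 := by push_cast at *; linarith
    have b1' : 0 < N - N' := by exact_mod_cast b1
    have b2' : N - N' < 1 := by exact_mod_cast b2
    omega
  · have b1 : (-1 : ℝ) < ((N - N' : ℤ) : ℝ) := by push_cast at *; linarith
    have b2 : ((N - N' : ℤ) : ℝ) < 0 := by push_cast at *; linarith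
    have b1' : -1 < N - N' := by exact_mod_cast b1
    have b2' : N - N' < 0 := by exact_mod_cast b2
    omega

/-- The left endpoint of a grid interval, in units of its length. -/
def gridStart (b : ℤ) (i : ℤ × ℤ) : ℝ := i.2 + b * altSign i.1 / 3

/-- The base of a dyadic Carleson box. -/
def gridInterval (b : ℤ) (i : ℤ × ℤ) : Set ℝ :=
  Ico (2 ^ i.1 * gridStart b i) (2 ^ i.1 * (gridStart b i + 1))

lemma mem_gridInterval {b : ℤ} {i : ℤ × ℤ} {x : ℝ} :
    x ∈ gridInterval b i ↔ ⌊gridPos b i.1 x⌋ = i.2 := by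
  have h2 : (0 : ℝ) < 2 ^ i.1 := by positivity
  rw [Int.floor_eq_iff, gridInterval, mem_Ico, gridPos, gridStart, le_sub_iff_add_le,
    sub_lt_iff_lt_add, le_div_iff₀ h2, div_lt_iff₀ h2]
  constructor <;> rintro ⟨h3, h4⟩ <;> constructor <;> linarith

/-- The dyadic Carleson box. -/
def dyadicBox (b : ℤ) (i : ℤ × ℤ) : Set ℂ := gridInterval b i ×ℂ Ioo 0 (2 ^ i.1)

/-- The upper half of a dyadic Carleson box. -/
def dyadicTop (b : ℤ) (i : ℤ × ℤ) : Set ℂ := gridInterval b i ×ℂ Ioo (2 ^ (i.1 - 1)) (2 ^ i.1)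

lemma mem_dyadicBox {b : ℤ} {i : ℤ × ℤ} {z : ℂ} :
    z ∈ dyadicBox b i ↔ ⌊gridPos b i.1 z.re⌋ = i.2 ∧ 0 < z.im ∧ z.im < 2 ^ i.1 := by
  rw [dyadicBox, Complex.mem_reProdIm, mem_gridInterval, mem_Ioo]

lemma measurableSet_gridInterval (b : ℤ) (i : ℤ × ℤ) : MeasurableSet (gridInterval b i) :=
  measurableSet_Ico

lemma measurableSet_dyadicBox (b : ℤ) (i : ℤ × ℤ) : MeasurableSet (dyadicBox b i) :=
  (Complex.measurable_re measurableSet_Ico).inter (Complex.measurable_im measurableSet_Ioo)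

lemma measurableSet_dyadicTop (b : ℤ) (i : ℤ × ℤ) : MeasurableSet (dyadicTop b i) :=
  (Complex.measurable_re measurableSet_Ico).inter (Complex.measurable_im measurableSet_Ioo)

lemma dyadicTop_subset (b : ℤ) (i : ℤ × ℤ) : dyadicTop b i ⊆ dyadicBox b i := by
  intro z hz
  rw [dyadicTop, Complex.mem_reProdIm] at hz
  rw [dyadicBox, Complex.mem_reProdIm]
  exact ⟨hz.1, (by positivity : (0 : ℝ) < 2 ^ (i.1 - 1)).trans hz.2.1, hz.2.2⟩

/-- A common point puts both bases in the same coarser cell, and the height of a box equals the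
length of its base, so the finer box is also the lower one. -/
lemma dyadicBox_subset_or_disjoint {b : ℤ} {i j : ℤ × ℤ} (hij : i.1 ≤ j.1) :
    dyadicBox b i ⊆ dyadicBox b j ∨ Disjoint (dyadicBox b i) (dyadicBox b j) := by
  by_cases h : Disjoint (dyadicBox b i) (dyadicBox b j)
  · exact Or.inr h
  · left
    obtain ⟨z, hz⟩ := not_disjoint_iff.1 h
    intro w hw
    rw [mem_dyadicBox] at hw ⊢
    obtain ⟨hzi, hzj⟩ := hz
    rw [mem_dyadicBox] at hzi hzj
    refine ⟨?_, hw.2.1, hw.2.2.trans_le (zpow_le_zpow_right₀ (by norm_num) hij)⟩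
    rw [← hzj.1]
    exact floor_gridPos_eq_of_le hij (hw.1.trans hzi.1.symm)

lemma dyadicBox_laminar (b : ℤ) (i j : ℤ × ℤ) :
    dyadicBox b i ⊆ dyadicBox b j ∨ dyadicBox b j ⊆ dyadicBox b i ∨
      Disjoint (dyadicBox b i) (dyadicBox b j) := by
  rcases le_total i.1 j.1 with h | h
  · rcases dyadicBox_subset_or_disjoint (b := b) h with h | h
    · exact Or.inl h
    · exact Or.inr (Or.inr h)
  · rcases dyadicBox_subset_or_disjoint (b := b) h with h | h
    · exact Or.inr (Or.inl h)
    · exact Or.inr (Or.inr h.symm)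

/-- Tops of different generations are separated by height, tops of the same generation by their
bases. -/
lemma dyadicTop_pairwise_disjoint (b : ℤ) :
    Pairwise fun i j => Disjoint (dyadicTop b i) (dyadicTop b j) := by
  have key : ∀ (i j : ℤ × ℤ) (z : ℂ), z ∈ dyadicTop b i → z ∈ dyadicTop b j → ¬ i.1 < j.1 := by
    intro i j z hi hj hlt
    rw [dyadicTop, Complex.mem_reProdIm] at hi hj
    have : (2 : ℝ) ^ i.1 ≤ 2 ^ (j.1 - 1) := zpow_le_zpow_right₀ (by norm_num) (by omega)
    linarith [hi.2.2, hj.2.1]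
  intro i j hij
  refine disjoint_left.2 fun z hi hj => hij ?_
  have h1 : i.1 = j.1 := le_antisymm (not_lt.1 (key j i z hj hi)) (not_lt.1 (key i j z hi hj))
  refine Prod.ext h1 ?_
  have h2 := (mem_dyadicBox.1 (dyadicTop_subset b i hi)).1
  have h3 := (mem_dyadicBox.1 (dyadicTop_subset b j hj)).1
  rw [← h2, ← h3, h1]

lemma volume_gridInterval (b : ℤ) (i : ℤ × ℤ) :
    volume (gridInterval b i) = ENNReal.ofReal (2 ^ i.1) := by
  rw [gridInterval, Real.volume_Ico]; congr 1; ring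

lemma two_pow_rpow_two_add (k : ℤ) (a : ℝ) :
    ((2 : ℝ) ^ k) ^ (2 + a) = 2 ^ k * ((2 : ℝ) ^ k) ^ (a + 1) := by
  rw [show 2 + a = 1 + (a + 1) by ring, Real.rpow_add (by positivity), Real.rpow_one]

lemma halfPlaneMeasure_dyadicBox {a : ℝ} (ha : -1 < a) (b : ℤ) (i : ℤ × ℤ) :
    halfPlaneMeasure a (dyadicBox b i) = ENNReal.ofReal (((2 : ℝ) ^ i.1) ^ (2 + a) / (a + 1)) := by
  have h2 : (0 : ℝ) < 2 ^ i.1 := by positivity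
  rw [dyadicBox, halfPlaneMeasure_reProdIm a (measurableSet_gridInterval b i) measurableSet_Ioo
    (fun y hy => hy.1), volume_gridInterval, setLIntegral_Ioo_rpow_im ha le_rfl h2.le,
    ← ENNReal.ofReal_mul h2.le]
  congr 1
  rw [Real.zero_rpow (by linarith), two_pow_rpow_two_add]
  ring

lemma halfPlaneMeasure_dyadicTop {a : ℝ} (ha : -1 < a) (b : ℤ) (i : ℤ × ℤ) :
    halfPlaneMeasure a (dyadicTop b i) = ENNReal.ofReal
      (((2 : ℝ) ^ i.1) ^ (2 + a) / (a + 1) * (1 - 2 ^ (-(a + 1)))) := by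
  have h2 : (0 : ℝ) < 2 ^ i.1 := by positivity
  have h3 : (2 : ℝ) ^ (i.1 - 1) ≤ 2 ^ i.1 := zpow_le_zpow_right₀ (by norm_num) (by omega)
  rw [dyadicTop, halfPlaneMeasure_reProdIm a (measurableSet_gridInterval b i) measurableSet_Ioo
    (fun y hy => lt_trans (by positivity : (0 : ℝ) < 2 ^ (i.1 - 1)) hy.1), volume_gridInterval,
    setLIntegral_Ioo_rpow_im ha (by positivity) h3, ← ENNReal.ofReal_mul h2.le]
  congr 1
  rw [zpow_sub_one₀ (by norm_num), Real.mul_rpow h2.le (by norm_num),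
    two_pow_rpow_two_add, Real.inv_rpow (by norm_num), Real.rpow_neg (by norm_num)]
  ring

/-- The ratio of the measure of a box to that of its upper half. -/
def boxRatio (a : ℝ) : ℝ≥0∞ := ENNReal.ofReal (1 - 2 ^ (-(a + 1)))⁻¹

lemma halfPlaneMeasure_dyadicBox_le {a : ℝ} (ha : -1 < a) (b : ℤ) (i : ℤ × ℤ) :
    halfPlaneMeasure a (dyadicBox b i) ≤ boxRatio a * halfPlaneMeasure a (dyadicTop b i) := by
  have h1 : (2 : ℝ) ^ (-(a + 1)) < 1 :=
    Real.rpow_lt_one_of_one_lt_of_neg (by norm_num) (by linarith)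
  have h2 : 0 < 1 - (2 : ℝ) ^ (-(a + 1)) := by linarith
  rw [halfPlaneMeasure_dyadicBox ha, halfPlaneMeasure_dyadicTop ha, boxRatio,
    ← ENNReal.ofReal_mul (by positivity)]
  refine ENNReal.ofReal_le_ofReal (le_of_eq ?_)
  field_simp

/-- The distance `R = ‖z - conj w‖` controls both heights and the horizontal distance of `z` and
`w`. Hence a box of side comparable to `R` in one of the two grids contains both points; its measure
is comparable to `R ^ (2 + a)`, and its single term already dominates the kernel. -/
lemma modKernel_le_sum_boxes {a : ℝ} (ha : -1 < a) {z w : ℂ} (hz : z ∈ halfPlane)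
    (hw : w ∈ halfPlane) :
    modKernel a z w ≤ ∑ b ∈ ({0, 1} : Finset ℤ), ∑' i : ℤ × ℤ,
      ENNReal.ofReal (6 ^ (2 + a) / (a + 1)) * ((halfPlaneMeasure a (dyadicBox b i))⁻¹ *
        ((dyadicBox b i).indicator 1 z * (dyadicBox b i).indicator 1 w)) := by
  have hz0 : 0 < z.im := hz
  have hw0 : 0 < w.im := hw
  set R := ‖z - conj w‖ with hR
  have hR0 : 0 < R := norm_sub_conj_pos hz hw
  have hzR : z.im + w.im ≤ R := im_add_im_le_norm z w
  have hre : |z.re - w.re| ≤ R := by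
    have := Complex.abs_re_le_norm (z - conj w)
    simpa using this
  -- The choice `2 ^ k ≤ 3 * R < 2 ^ (k + 1)`: the upper inequality is the hypothesis of the
  -- one-third trick at level `k + 1`, and the lower one gives `2 ^ (k + 1) ≤ 6 * R`, the source of
  -- `6 ^ (2 + a)`.
  obtain ⟨k, hk1, hk2⟩ := exists_mem_Ico_zpow (x := 3 * R) (y := 2) (by positivity) (by norm_num)
  have hk3 : (2 : ℝ) ^ (k + 1) ≤ 6 * R := by rw [zpow_add_one₀ (by norm_num)]; linarith
  have h2 : (0 : ℝ) < 2 ^ (k + 1) := by positivity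
  obtain ⟨b, hb, hfl⟩ : ∃ b ∈ ({0, 1} : Finset ℤ),
      ⌊gridPos b (k + 1) z.re⌋ = ⌊gridPos b (k + 1) w.re⌋ := by
    rcases floor_gridPos_eq_or (k := k + 1) (x := z.re) (y := w.re) (by linarith) with h | h
    · exact ⟨0, by simp, h⟩
    · exact ⟨1, by simp, h⟩
  set i : ℤ × ℤ := (k + 1, ⌊gridPos b (k + 1) w.re⌋) with hi
  have hzi : z ∈ dyadicBox b i := mem_dyadicBox.2 ⟨hfl, hz0, by simp only [hi]; linarith⟩
  have hwi : w ∈ dyadicBox b i := mem_dyadicBox.2 ⟨rfl, hw0, by simp only [hi]; linarith⟩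
  refine le_trans ?_ (Finset.single_le_sum (f := fun b => ∑' i : ℤ × ℤ,
      ENNReal.ofReal (6 ^ (2 + a) / (a + 1)) * ((halfPlaneMeasure a (dyadicBox b i))⁻¹ *
        ((dyadicBox b i).indicator 1 z * (dyadicBox b i).indicator 1 w)))
      (fun _ _ => zero_le) hb)
  refine le_trans ?_ (ENNReal.le_tsum i)
  have ha1 : 0 < a + 1 := by linarith
  rw [indicator_of_mem hzi, indicator_of_mem hwi, halfPlaneMeasure_dyadicBox ha,
    ← ENNReal.ofReal_inv_of_pos (by positivity)]
  simp only [Pi.one_apply, mul_one]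
  rw [← ENNReal.ofReal_mul (by positivity), modKernel]
  refine ENNReal.ofReal_le_ofReal ?_
  calc R ^ (-(2 + a)) ≤ ((2 : ℝ) ^ (k + 1) / 6) ^ (-(2 + a)) :=
        Real.rpow_le_rpow_of_nonpos (by positivity) (by linarith) (by linarith)
    _ = _ := by
        rw [Real.rpow_neg (by positivity), Real.div_rpow (by positivity) (by norm_num)]
        field_simp
        rfl

/-- The point `w` lies at the height of the box above the left end of its base. On the box `z - conj
w` has real part at most `2 ^ k` and imaginary part at most `2 * 2 ^ k` in modulus, so the kernel is
bounded below. This turns a condition tested on kernels into one on boxes. -/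
lemma rpow_lintegral_box_le {a r : ℝ} (ha : -1 < a) (hr : 0 < r) (b : ℤ) (i : ℤ × ℤ) {w : ℂ}
    (hw : w = (2 ^ i.1 * gridStart b i : ℝ) + (2 ^ i.1 : ℝ) * Complex.I) (φ : ℂ → ℝ≥0∞) :
    (∫⁻ z in dyadicBox b i, φ z ^ r ∂halfPlaneMeasure a) ^ (1 / r) ≤
      ENNReal.ofReal ((3 * 2 ^ i.1) ^ (2 + a)) *
        (∫⁻ z, (φ z * modKernel a z w) ^ r ∂halfPlaneMeasure a) ^ (1 / r) := by
  have h2 : (0 : ℝ) < 2 ^ i.1 := by positivity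
  have hpos : (0 : ℝ) < (3 * 2 ^ i.1) ^ (2 + a) := by positivity
  have h1 : ∀ z ∈ dyadicBox b i, φ z ≤ ENNReal.ofReal ((3 * 2 ^ i.1) ^ (2 + a)) *
      (φ z * modKernel a z w) := by
    intro z hz
    have hz' := hz
    rw [mem_dyadicBox] at hz'
    rw [dyadicBox, Complex.mem_reProdIm, gridInterval, mem_Ico] at hz
    have hwim : w.im = 2 ^ i.1 := by
      rw [hw]; simp only [Complex.add_im, Complex.ofReal_im, Complex.im_ofReal_mul, Complex.I_im]; ring
    have hwre : w.re = 2 ^ i.1 * gridStart b i := by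
      rw [hw]; simp only [Complex.add_re, Complex.ofReal_re, Complex.re_ofReal_mul, Complex.I_re]; ring
    have hn : ‖z - conj w‖ ≤ 3 * 2 ^ i.1 := by
      refine (Complex.norm_le_abs_re_add_abs_im _).trans ?_
      rw [im_sub_conj, abs_of_pos (a := z.im + w.im) (by rw [hwim]; linarith [hz'.2.1]), Complex.sub_re, Complex.conj_re,
        hwim, hwre]
      have : |z.re - 2 ^ i.1 * gridStart b i| ≤ 2 ^ i.1 := by
        rw [abs_le]; constructor <;> linarith [hz.1.1, hz.1.2]
      linarith [hz'.2.2]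
    have hn0 : 0 < ‖z - conj w‖ := norm_sub_conj_pos hz'.2.1 (show 0 < w.im by rw [hwim]; exact h2)
    have h3 : 1 ≤ ENNReal.ofReal ((3 * 2 ^ i.1) ^ (2 + a)) * modKernel a z w := by
      rw [modKernel, ← ENNReal.ofReal_mul hpos.le, ← ENNReal.ofReal_one]
      refine ENNReal.ofReal_le_ofReal ?_
      rw [Real.rpow_neg (norm_nonneg _), ← div_eq_mul_inv, le_div_iff₀ (by positivity), one_mul]
      exact Real.rpow_le_rpow (norm_nonneg _) hn (by linarith)
    calc φ z = φ z * 1 := (mul_one _).symm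
      _ ≤ φ z * (ENNReal.ofReal ((3 * 2 ^ i.1) ^ (2 + a)) * modKernel a z w) := by gcongr
      _ = _ := by ring
  have hT : ENNReal.ofReal ((3 * 2 ^ i.1) ^ (2 + a)) ^ r ≠ ∞ :=
    ENNReal.rpow_ne_top_of_nonneg hr.le ENNReal.ofReal_ne_top
  calc (∫⁻ z in dyadicBox b i, φ z ^ r ∂halfPlaneMeasure a) ^ (1 / r)
      ≤ (∫⁻ z in dyadicBox b i, (ENNReal.ofReal ((3 * 2 ^ i.1) ^ (2 + a)) *
        (φ z * modKernel a z w)) ^ r ∂halfPlaneMeasure a) ^ (1 / r) := by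
        refine ENNReal.rpow_le_rpow ?_ (by positivity)
        refine setLIntegral_mono' (measurableSet_dyadicBox b i) fun z hz => ?_
        exact ENNReal.rpow_le_rpow (h1 z hz) hr.le
    _ ≤ (∫⁻ z, (ENNReal.ofReal ((3 * 2 ^ i.1) ^ (2 + a)) *
        (φ z * modKernel a z w)) ^ r ∂halfPlaneMeasure a) ^ (1 / r) :=
        ENNReal.rpow_le_rpow (setLIntegral_le_lintegral _ _) (by positivity)
    _ = _ := by
        simp only [ENNReal.mul_rpow_of_nonneg _ _ hr.le]
        rw [lintegral_const_mul' _ _ hT, ENNReal.mul_rpow_of_nonneg _ _ (by positivity),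
          ← ENNReal.rpow_mul, mul_one_div_cancel hr.ne', ENNReal.rpow_one]

/-! ### The weighted estimate for the positive Bergman operator on the half-plane -/

/-- The constant in the weighted estimate on the half-plane. -/
def halfPlaneConst (a p q : ℝ) : ℝ≥0∞ :=
  2 * ENNReal.ofReal (6 ^ (2 + a) / (a + 1)) * sparseConst p q (boxRatio a) *
    ENNReal.ofReal (9 ^ (2 + a) * (a + 1)) ^ max p q

lemma halfPlaneConst_ne_top {a p q : ℝ} (hpq : p.HolderConjugate q) : halfPlaneConst a p q ≠ ∞ := by
  refine ENNReal.mul_ne_top (ENNReal.mul_ne_top (ENNReal.mul_ne_top (by norm_num)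
    ENNReal.ofReal_ne_top) (sparseConst_ne_top hpq ENNReal.ofReal_ne_top)) ?_
  exact ENNReal.rpow_ne_top_of_nonneg (hpq.nonneg.trans (le_max_left _ _)) ENNReal.ofReal_ne_top

/-- Domination of the kernel by boxes splits the form into two sparse forms, one for each grid. The
factor `w.im ^ (-(2 + a))` in the weight condition appears because the kernels are not normalized.
-/
lemma bilinear_modKernel_le {a p q : ℝ} (ha : -1 < a) (hpq : p.HolderConjugate q)
    {φ ψ : ℂ → ℝ≥0∞} (hφ : Measurable φ) (hψ : Measurable ψ)
    (hφψ : ∀ z ∈ halfPlane, φ z * ψ z = 1) {A : ℝ≥0∞} (hA : A ≠ ∞)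
    (hAw : ∀ w ∈ halfPlane, (∫⁻ z, (φ z * modKernel a z w) ^ p ∂halfPlaneMeasure a) ^ (1 / p) *
      (∫⁻ z, (ψ z * modKernel a z w) ^ q ∂halfPlaneMeasure a) ^ (1 / q) ≤
        A * ENNReal.ofReal (w.im ^ (-(2 + a))))
    {U V : ℂ → ℝ≥0∞} (hU : Measurable U) (hV : Measurable V) :
    ∫⁻ z, (φ z * V z) * ∫⁻ w, modKernel a z w * (ψ w * U w) ∂halfPlaneMeasure a
        ∂halfPlaneMeasure a ≤
      halfPlaneConst a p q * A ^ max p q * (∫⁻ x, U x ^ p ∂halfPlaneMeasure a) ^ (1 / p) *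
        (∫⁻ x, V x ^ q ∂halfPlaneMeasure a) ^ (1 / q) := by
  have ha1 : 0 < a + 1 := by linarith
  have hp0 : 0 < p := hpq.pos
  have hq0 : 0 < q := hpq.symm.pos
  set μ := halfPlaneMeasure a with hμ
  set c₀ := ENNReal.ofReal (6 ^ (2 + a) / (a + 1)) with hc₀
  set A' := ENNReal.ofReal (9 ^ (2 + a) * (a + 1)) * A with hA'
  have hA'T : A' ≠ ∞ := ENNReal.mul_ne_top ENNReal.ofReal_ne_top hA
  -- Two factors `(3 * 2 ^ k) ^ (2 + a)` from the lower bound of the kernel and one factor `(2 ^ k)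
  -- ^ (-(2 + a))` from the hypothesis leave `9 ^ (2 + a) * (2 ^ k) ^ (2 + a)`, which is `9 ^ (2 +
  -- a) * (a + 1)` times the measure of the box.
  have hbox : ∀ b i, (∫⁻ x in dyadicBox b i, φ x ^ p ∂μ) ^ (1 / p) *
      (∫⁻ x in dyadicBox b i, ψ x ^ q ∂μ) ^ (1 / q) ≤ A' * μ (dyadicBox b i) := by
    intro b i
    have h2 : (0 : ℝ) < 2 ^ i.1 := by positivity
    set w : ℂ := (2 ^ i.1 * gridStart b i : ℝ) + (2 ^ i.1 : ℝ) * Complex.I with hw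
    have hwim : w.im = 2 ^ i.1 := by
      rw [hw]; simp only [Complex.add_im, Complex.ofReal_im, Complex.im_ofReal_mul, Complex.I_im]; ring
    have hwH : w ∈ halfPlane := show 0 < w.im by rw [hwim]; exact h2
    calc _ ≤ (ENNReal.ofReal ((3 * 2 ^ i.1) ^ (2 + a)) *
          (∫⁻ z, (φ z * modKernel a z w) ^ p ∂μ) ^ (1 / p)) *
          (ENNReal.ofReal ((3 * 2 ^ i.1) ^ (2 + a)) *
          (∫⁻ z, (ψ z * modKernel a z w) ^ q ∂μ) ^ (1 / q)) :=
          mul_le_mul' (rpow_lintegral_box_le ha hp0 b i hw φ) (rpow_lintegral_box_le ha hq0 b i hw ψ)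
      _ = ENNReal.ofReal ((3 * 2 ^ i.1) ^ (2 + a)) * ENNReal.ofReal ((3 * 2 ^ i.1) ^ (2 + a)) *
          ((∫⁻ z, (φ z * modKernel a z w) ^ p ∂μ) ^ (1 / p) *
          (∫⁻ z, (ψ z * modKernel a z w) ^ q ∂μ) ^ (1 / q)) := by ring
      _ ≤ ENNReal.ofReal ((3 * 2 ^ i.1) ^ (2 + a)) * ENNReal.ofReal ((3 * 2 ^ i.1) ^ (2 + a)) *
          (A * ENNReal.ofReal (w.im ^ (-(2 + a)))) := by
          exact mul_le_mul' le_rfl (hAw w hwH)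
      _ = (ENNReal.ofReal ((3 * 2 ^ i.1) ^ (2 + a)) * ENNReal.ofReal ((3 * 2 ^ i.1) ^ (2 + a)) *
          ENNReal.ofReal (w.im ^ (-(2 + a)))) * A := by ring
      _ = (ENNReal.ofReal (9 ^ (2 + a) * (a + 1)) *
          ENNReal.ofReal (((2 : ℝ) ^ i.1) ^ (2 + a) / (a + 1))) * A := by
          congr 1
          rw [hwim, ← ENNReal.ofReal_mul (by positivity), ← ENNReal.ofReal_mul (by positivity),
            ← ENNReal.ofReal_mul (by positivity)]
          congr 1
          rw [Real.mul_rpow (by norm_num) h2.le, Real.rpow_neg h2.le, show (9 : ℝ) = 3 * 3 by norm_num,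
            Real.mul_rpow (by norm_num) (by norm_num)]
          field_simp
      _ = _ := by rw [hμ, halfPlaneMeasure_dyadicBox ha, hA']; ring
  have hsparse : ∀ b : ℤ, ∑' i, (μ (dyadicBox b i))⁻¹ * (∫⁻ x in dyadicBox b i, ψ x * U x ∂μ) *
      (∫⁻ x in dyadicBox b i, φ x * V x ∂μ) ≤ sparseConst p q (boxRatio a) * A' ^ max p q *
        (∫⁻ x, U x ^ p ∂μ) ^ (1 / p) * (∫⁻ x, V x ^ q ∂μ) ^ (1 / q) := by
    intro b
    refine sparse_bilinear_le hpq (dyadicBox b) (dyadicTop b) (measurableSet_dyadicBox b)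
      (measurableSet_dyadicTop b) (dyadicTop_subset b) (dyadicTop_pairwise_disjoint b)
      (dyadicBox_laminar b) (fun i => ?_) (fun i => ?_) ENNReal.ofReal_ne_top
      (halfPlaneMeasure_dyadicBox_le ha b) hφ hψ ?_ hA'T (hbox b) hU hV
    · rw [halfPlaneMeasure_dyadicBox ha]
      exact (ENNReal.ofReal_pos.2 (by positivity)).ne'
    · rw [halfPlaneMeasure_dyadicBox ha]
      exact ENNReal.ofReal_ne_top
    · filter_upwards [ae_mem_halfPlane a] with z hz using hφψ z hz
  have hψU : Measurable fun w => ψ w * U w := hψ.mul hU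
  have hφV : Measurable fun w => φ w * V w := hφ.mul hV
  have hind : ∀ b i, Measurable ((dyadicBox b i).indicator (1 : ℂ → ℝ≥0∞)) := fun b i =>
    measurable_one.indicator (measurableSet_dyadicBox b i)
  have hiψ : ∀ b i, Measurable fun w => (dyadicBox b i).indicator (1 : ℂ → ℝ≥0∞) w * (ψ w * U w) :=
    fun b i => (hind b i).mul hψU
  have hiφ : ∀ b i, Measurable fun w => (dyadicBox b i).indicator (1 : ℂ → ℝ≥0∞) w * (φ w * V w) :=
    fun b i => (hind b i).mul hφV
  have hindint : ∀ b i (G : ℂ → ℝ≥0∞), ∫⁻ w, (dyadicBox b i).indicator 1 w * G w ∂μ =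
      ∫⁻ w in dyadicBox b i, G w ∂μ := by
    intro b i G
    rw [← lintegral_indicator (measurableSet_dyadicBox b i)]
    refine lintegral_congr fun w => ?_
    by_cases hw : w ∈ dyadicBox b i <;> simp [hw]
  have hinner : ∀ᵐ z ∂μ, ∫⁻ w, modKernel a z w * (ψ w * U w) ∂μ ≤
      ∑ b ∈ ({0, 1} : Finset ℤ), ∑' i : ℤ × ℤ, c₀ * ((μ (dyadicBox b i))⁻¹ *
        (∫⁻ w in dyadicBox b i, ψ w * U w ∂μ) * (dyadicBox b i).indicator 1 z) := by
    filter_upwards [ae_mem_halfPlane a] with z hz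
    calc ∫⁻ w, modKernel a z w * (ψ w * U w) ∂μ
        ≤ ∫⁻ w, ∑ b ∈ ({0, 1} : Finset ℤ), ∑' i : ℤ × ℤ, (c₀ * (μ (dyadicBox b i))⁻¹ *
          (dyadicBox b i).indicator 1 z) * ((dyadicBox b i).indicator 1 w * (ψ w * U w)) ∂μ := by
          refine lintegral_mono_ae ?_
          filter_upwards [ae_mem_halfPlane a] with w hw
          refine (mul_le_mul' (modKernel_le_sum_boxes ha hz hw) le_rfl).trans_eq ?_
          rw [Finset.sum_mul]
          refine Finset.sum_congr rfl fun b _ => ?_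
          rw [← ENNReal.tsum_mul_right]
          refine tsum_congr fun i => ?_
          ring
      _ = _ := by
          rw [lintegral_finsetSum _ fun b _ => Measurable.tsum fun i =>
            ((hiψ b i).const_mul _)]
          refine Finset.sum_congr rfl fun b _ => ?_
          rw [lintegral_tsum fun i => ((hiψ b i).const_mul _).aemeasurable]
          refine tsum_congr fun i => ?_
          rw [lintegral_const_mul _ (hiψ b i), hindint]
          ring
  calc ∫⁻ z, (φ z * V z) * ∫⁻ w, modKernel a z w * (ψ w * U w) ∂μ ∂μ
      ≤ ∫⁻ z, ∑ b ∈ ({0, 1} : Finset ℤ), ∑' i : ℤ × ℤ, (c₀ * (μ (dyadicBox b i))⁻¹ *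
        (∫⁻ w in dyadicBox b i, ψ w * U w ∂μ)) *
          ((dyadicBox b i).indicator 1 z * (φ z * V z)) ∂μ := by
        refine lintegral_mono_ae ?_
        filter_upwards [hinner] with z hz
        refine (mul_le_mul' le_rfl hz).trans_eq ?_
        rw [Finset.mul_sum]
        refine Finset.sum_congr rfl fun b _ => ?_
        rw [← ENNReal.tsum_mul_left]
        refine tsum_congr fun i => ?_
        ring
    _ = ∑ b ∈ ({0, 1} : Finset ℤ), c₀ * ∑' i : ℤ × ℤ, (μ (dyadicBox b i))⁻¹ *
        (∫⁻ w in dyadicBox b i, ψ w * U w ∂μ) * (∫⁻ w in dyadicBox b i, φ w * V w ∂μ) := by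
        rw [lintegral_finsetSum _ fun b _ => Measurable.tsum fun i =>
          ((hiφ b i).const_mul _)]
        refine Finset.sum_congr rfl fun b _ => ?_
        rw [lintegral_tsum fun i => ((hiφ b i).const_mul _).aemeasurable,
          ← ENNReal.tsum_mul_left]
        refine tsum_congr fun i => ?_
        rw [lintegral_const_mul _ (hiφ b i), hindint]
        ring
    _ ≤ ∑ b ∈ ({0, 1} : Finset ℤ), c₀ * (sparseConst p q (boxRatio a) * A' ^ max p q *
        (∫⁻ x, U x ^ p ∂μ) ^ (1 / p) * (∫⁻ x, V x ^ q ∂μ) ^ (1 / q)) :=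
        Finset.sum_le_sum fun b _ => mul_le_mul' le_rfl (hsparse b)
    _ = _ := by
        rw [Finset.sum_const, Finset.card_pair (by norm_num), hA',
          ENNReal.mul_rpow_of_nonneg _ _ (hp0.le.trans (le_max_left _ _)), halfPlaneConst]
        simp only [nsmul_eq_mul, Nat.cast_ofNat]
        ring

/-- The weighted estimate for the positive Bergman operator on the half-plane. -/
theorem lintegral_modKernel_weighted_le {a p q : ℝ} (ha : -1 < a) (hpq : p.HolderConjugate q)
    {φ ψ : ℂ → ℝ≥0∞} (hφ : Measurable φ) (hψ : Measurable ψ)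
    (hφψ : ∀ z ∈ halfPlane, φ z * ψ z = 1) {A : ℝ≥0∞} (hA : A ≠ ∞)
    (hAw : ∀ w ∈ halfPlane, (∫⁻ z, (φ z * modKernel a z w) ^ p ∂halfPlaneMeasure a) ^ (1 / p) *
      (∫⁻ z, (ψ z * modKernel a z w) ^ q ∂halfPlaneMeasure a) ^ (1 / q) ≤
        A * ENNReal.ofReal (w.im ^ (-(2 + a))))
    {U : ℂ → ℝ≥0∞} (hU : Measurable U) :
    ∫⁻ z, (φ z * ∫⁻ w, modKernel a z w * (ψ w * U w) ∂halfPlaneMeasure a) ^ p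
        ∂halfPlaneMeasure a ≤
      (halfPlaneConst a p q * A ^ max p q) ^ p * ∫⁻ x, U x ^ p ∂halfPlaneMeasure a := by
  have hp0 : 0 < p := hpq.pos
  have hm : Measurable fun z => ∫⁻ w, modKernel a z w * (ψ w * U w) ∂halfPlaneMeasure a :=
    Measurable.lintegral_prod_right'
      (f := fun x : ℂ × ℂ => modKernel a x.1 x.2 * (ψ x.2 * U x.2))
      ((measurable_modKernel a).mul ((hψ.comp measurable_snd).mul (hU.comp measurable_snd)))
  have hF : Measurable fun z => φ z * ∫⁻ w, modKernel a z w * (ψ w * U w) ∂halfPlaneMeasure a :=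
    hφ.mul hm
  have key := lintegral_rpow_le_of_forall_mul_le (μ := halfPlaneMeasure a) hpq hF
    (N := halfPlaneConst a p q * A ^ max p q *
      (∫⁻ x, U x ^ p ∂halfPlaneMeasure a) ^ (1 / p)) fun k => ?_
  · refine key.trans_eq ?_
    rw [ENNReal.mul_rpow_of_nonneg _ _ hp0.le, ← ENNReal.rpow_mul, one_div_mul_cancel hp0.ne',
      ENNReal.rpow_one]
  · refine le_trans (le_of_eq ?_) (bilinear_modKernel_le ha hpq hφ hψ hφψ hA hAw hU
      (V := (spanningSets (halfPlaneMeasure a) k).indicator _) ?_)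
    · refine lintegral_congr fun z => ?_
      ring
    · exact ((hF.min measurable_const).pow_const _).indicator (measurableSet_spanningSets _ _)

/-! ### The weighted mean value property on the disc -/

lemma integral_angle_eq {G : ℂ → ℂ} (hG : DifferentiableOn ℂ G (Metric.ball 0 1)) {r : ℝ}
    (hr0 : 0 ≤ r) (hr : r < 1) :
    ∫ θ in Ioo (-Real.pi) Real.pi, G (Complex.polarCoord.symm (r, θ)) =
      (2 * Real.pi : ℝ) • G 0 := by
  have h1 : DiffContOnCl ℂ G (Metric.ball 0 |r|) := by
    rw [abs_of_nonneg hr0]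
    exact hG.diffContOnCl_ball (Metric.closedBall_subset_ball hr)
  have h2 := h1.circleAverage
  rw [Real.circleAverage_eq_integral_add (-Real.pi),
    intervalIntegral.integral_comp_add_right (fun θ => G (circleMap 0 r θ))] at h2
  rw [← integral_Ioc_eq_integral_Ioo,
    ← intervalIntegral.integral_of_le (by linarith [Real.pi_pos])]
  have e : ∀ θ : ℝ, Complex.polarCoord.symm (r, θ) = circleMap 0 r θ := by
    intro θ
    rw [Complex.polarCoord_symm_apply, circleMap_zero, Complex.exp_mul_I]
    simp
  simp only [e]
  rw [show (0 : ℝ) + -Real.pi = -Real.pi by ring,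
    show 2 * Real.pi + -Real.pi = Real.pi by ring] at h2
  rw [← h2, smul_smul, mul_inv_cancel₀ (by positivity), one_smul]

lemma integral_Ioi_mul_indicator_rpow {a : ℝ} (ha : -1 < a) :
    ∫ r in Ioi (0 : ℝ), r * (Iio 1).indicator (fun t : ℝ => (1 - t) ^ a) (r ^ 2) =
      1 / (2 * (a + 1)) := by
  set g : ℝ → ℝ := (Iio 1).indicator fun t : ℝ => (1 - t) ^ a with hg
  have h1 := integral_comp_rpow_Ioi g (p := 2) (by norm_num)
  have h2 : ∫ y in Ioi (0 : ℝ), g y = 1 / (a + 1) := by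
    rw [hg, setIntegral_indicator measurableSet_Iio, Ioi_inter_Iio, ← integral_Ioc_eq_integral_Ioo,
      ← intervalIntegral.integral_of_le zero_le_one,
      intervalIntegral.integral_comp_sub_left (fun t : ℝ => t ^ a), integral_rpow (Or.inl ha)]
    simp [Real.zero_rpow (show a + 1 ≠ 0 by linarith)]
  have h3 : ∫ x in Ioi (0 : ℝ), (|(2 : ℝ)| * x ^ ((2 : ℝ) - 1)) • g (x ^ (2 : ℝ)) =
      2 * ∫ r in Ioi (0 : ℝ), r * g (r ^ 2) := by
    rw [← integral_const_mul]
    refine setIntegral_congr_fun measurableSet_Ioi fun x hx => ?_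
    norm_num [mul_assoc]
  rw [h3, h2] at h1
  have ha1 : 0 < a + 1 := by linarith
  field_simp at h1 ⊢
  linarith

/-- In polar coordinates the weight is constant on circles, so the mean value property applies on
each circle and only a radial integral is left. Integrability of the product is the only assumption
on the boundary behaviour of `G`. -/
lemma integral_ball_weight_smul {a : ℝ} (ha : -1 < a) {G : ℂ → ℂ}
    (hG : DifferentiableOn ℂ G (Metric.ball 0 1))
    (hint : IntegrableOn (fun u => ((1 - ‖u‖ ^ 2) ^ a : ℝ) • G u) (Metric.ball 0 1)) :
    ∫ u in Metric.ball 0 1, ((1 - ‖u‖ ^ 2) ^ a : ℝ) • G u = (Real.pi / (a + 1) : ℝ) • G 0 := by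
  classical
  set f : ℂ → ℂ := (Metric.ball 0 1).indicator fun u => ((1 - ‖u‖ ^ 2) ^ a : ℝ) • G u with hf
  have hball : MeasurableSet (Metric.ball (0 : ℂ) 1) := measurableSet_ball
  have hfm : Measurable f := by
    have hGm : Measurable ((Metric.ball (0 : ℂ) 1).indicator G) := by
      rw [← piecewise_eq_indicator]
      exact hG.continuousOn.measurable_piecewise continuousOn_const hball
    have : f = fun u => ((1 - ‖u‖ ^ 2) ^ a : ℝ) • (Metric.ball (0 : ℂ) 1).indicator G u := by
      ext u
      by_cases hu : u ∈ Metric.ball (0 : ℂ) 1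
      · simp only [hf, indicator_of_mem hu]
      · simp only [hf, indicator_of_notMem hu, smul_zero]
    rw [this]
    have hρ : Measurable fun u : ℂ => (1 - ‖u‖ ^ 2) ^ a := by fun_prop
    exact hρ.smul hGm
  have hfint : Integrable f := (integrable_indicator_iff hball).2 hint
  have hsymm : Measurable fun x : ℝ × ℝ => Complex.polarCoord.symm x := by
    simp only [Complex.polarCoord_symm_apply]
    fun_prop
  have hpm : Measurable fun x : ℝ × ℝ => x.1 • f (Complex.polarCoord.symm x) :=
    measurable_fst.smul (hfm.comp hsymm)
  have hpint : IntegrableOn (fun x : ℝ × ℝ => x.1 • f (Complex.polarCoord.symm x))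
      polarCoord.target := by
    refine ⟨hpm.aestronglyMeasurable, ?_⟩
    have h1 := Complex.lintegral_comp_polarCoord_symm fun z => ‖f z‖ₑ
    refine lt_of_eq_of_lt (Eq.trans ?_ h1) hfint.2
    refine setLIntegral_congr_fun polarCoord.open_target.measurableSet fun x hx => ?_
    have hx1 : 0 < x.1 := hx.1
    simp only [enorm_smul, smul_eq_mul, Real.enorm_of_nonneg hx1.le]
  rw [← integral_indicator hball, ← Complex.integral_comp_polarCoord_symm f]
  rw [polarCoord_target, Measure.volume_eq_prod] at hpint ⊢
  rw [setIntegral_prod _ hpint]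
  have hinner : ∀ r ∈ Ioi (0 : ℝ), ∫ θ in Ioo (-Real.pi) Real.pi,
      (r, θ).1 • f (Complex.polarCoord.symm (r, θ)) =
      (r * (Iio 1).indicator (fun t : ℝ => (1 - t) ^ a) (r ^ 2)) • ((2 * Real.pi : ℝ) • G 0) := by
    intro r hr
    have hr : 0 < r := hr
    have hn : ∀ θ : ℝ, ‖Complex.polarCoord.symm (r, θ)‖ = r := fun θ => by
      rw [Complex.norm_polarCoord_symm, abs_of_pos hr]
    by_cases hr1 : r < 1
    · have hr2 : r ^ 2 < 1 := by nlinarith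
      have e : ∀ θ : ℝ, f (Complex.polarCoord.symm (r, θ)) =
          ((1 - r ^ 2) ^ a : ℝ) • G (Complex.polarCoord.symm (r, θ)) := fun θ => by
        simp only [hf]
        rw [indicator_of_mem (by rw [mem_ball_zero_iff, hn]; exact hr1), hn]
      simp only [e]
      rw [integral_smul, integral_smul, integral_angle_eq hG hr.le hr1,
        indicator_of_mem (mem_Iio.2 hr2), smul_smul r]
    · have hr2 : ¬ r ^ 2 < 1 := by push Not at hr1 ⊢; nlinarith
      have e : ∀ θ : ℝ, f (Complex.polarCoord.symm (r, θ)) = 0 := fun θ => by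
        simp only [hf]
        rw [indicator_of_notMem (by rw [mem_ball_zero_iff, hn]; exact hr1)]
      simp only [e]
      rw [indicator_of_notMem (by simpa using hr2)]
      simp
  rw [setIntegral_congr_fun measurableSet_Ioi hinner, integral_smul_const,
    integral_Ioi_mul_indicator_rpow ha, smul_smul]
  congr 1
  have : 0 < a + 1 := by linarith
  field_simp

/-! ### The reproducing formula on the half-plane -/

lemma enorm_halfPlaneKernel {a : ℝ} (ha : -1 < a) (z w : ℂ) :
    ‖halfPlaneKernel a z w‖ₑ = ENNReal.ofReal (2 ^ a * (a + 1) / Real.pi) * modKernel a z w := by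
  have ha1 : 0 < a + 1 := by linarith
  rw [halfPlaneKernel, enorm_mul, modKernel]
  congr 1
  · rw [← ofReal_norm, Complex.norm_real, Real.norm_of_nonneg (by positivity)]
  · rw [← ofReal_norm, Complex.norm_cpow_real, norm_div, Complex.norm_I, div_one]

/-- The Cayley transform of the disc onto the half-plane with `0 ↦ z`. -/
def cayley (z u : ℂ) : ℂ := (z - conj z * u) / (1 - u)

lemma one_sub_ne_zero_of_mem_ball {u : ℂ} (hu : u ∈ Metric.ball (0 : ℂ) 1) : 1 - u ≠ 0 := by
  intro h
  rw [mem_ball_zero_iff, ← sub_eq_zero.1 h] at hu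
  simp at hu

lemma hasDerivAt_cayley (z : ℂ) {u : ℂ} (hu : u ∈ Metric.ball (0 : ℂ) 1) :
    HasDerivAt (cayley z) ((z - conj z) / (1 - u) ^ 2) u := by
  have h1 : HasDerivAt (fun u => z - conj z * u) (-conj z) u := by
    simpa using ((hasDerivAt_id' u).const_mul (conj z)).const_sub z
  have h2 : HasDerivAt (fun u : ℂ => 1 - u) (-1) u := by
    simpa using (hasDerivAt_id' u).const_sub 1
  convert! h1.div h2 (one_sub_ne_zero_of_mem_ball hu) using 1
  congr 1
  ring

/-- The identity behind the reproducing formula. Although the kernel is antiholomorphic in its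
second variable, its base pulls back to a positive real multiple of `1 - u`. The principal power
therefore splits into a real factor and the holomorphic function `(1 - u) ^ (-(2 + a))`. -/
lemma sub_conj_cayley (z : ℂ) {u : ℂ} (hu : u ∈ Metric.ball (0 : ℂ) 1) :
    (z - conj (cayley z u)) / Complex.I = ((2 * z.im / ‖1 - u‖ ^ 2 : ℝ) : ℂ) * (1 - u) := by
  have h0 := one_sub_ne_zero_of_mem_ball hu
  have h1 : conj (1 - u) ≠ 0 := (map_ne_zero _).2 h0
  have h2 : z - conj z = (2 * z.im : ℝ) * Complex.I := Complex.sub_conj z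
  have h3 : ((‖1 - u‖ ^ 2 : ℝ) : ℂ) = (1 - u) * conj (1 - u) := by
    rw [Complex.mul_conj, Complex.normSq_eq_norm_sq]
  have h4 : z - conj (cayley z u) = (z - conj z) / conj (1 - u) := by
    rw [cayley, map_div₀, map_sub, map_mul, RCLike.conj_conj]
    field_simp
    simp only [map_sub, map_one]
    ring
  rw [h4, h2, Complex.ofReal_div, h3]
  field_simp

lemma im_cayley (z : ℂ) {u : ℂ} (hu : u ∈ Metric.ball (0 : ℂ) 1) :
    (cayley z u).im = z.im * (1 - ‖u‖ ^ 2) / ‖1 - u‖ ^ 2 := by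
  have h0 := one_sub_ne_zero_of_mem_ball hu
  have hn : ‖1 - u‖ ≠ 0 := norm_ne_zero_iff.2 h0
  have h1 := congrArg Complex.re (sub_conj_cayley z hu)
  rw [Complex.re_ofReal_mul] at h1
  have h2 : ((z - conj (cayley z u)) / Complex.I).re = z.im + (cayley z u).im := by
    simp [Complex.div_I]
  have h3 : ‖1 - u‖ ^ 2 = 1 - 2 * u.re + ‖u‖ ^ 2 := by
    rw [← Complex.normSq_eq_norm_sq, ← Complex.normSq_eq_norm_sq, Complex.normSq_apply,
      Complex.normSq_apply]
    simp
    ring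
  rw [h2] at h1
  have h4 : (1 - u).re = 1 - u.re := by simp
  rw [h4] at h1
  have h5 : (cayley z u).im = 2 * z.im / ‖1 - u‖ ^ 2 * (1 - u.re) - z.im := by linarith
  rw [h5]
  field_simp
  rw [h3]
  ring

lemma image_cayley {z : ℂ} (hz : z ∈ halfPlane) :
    cayley z '' Metric.ball (0 : ℂ) 1 = halfPlane := by
  have hz0 : 0 < z.im := hz
  ext w
  constructor
  · rintro ⟨u, hu, rfl⟩
    have hn : 0 < ‖1 - u‖ := norm_pos_iff.2 (one_sub_ne_zero_of_mem_ball hu)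
    have hu1 : ‖u‖ < 1 := by simpa using hu
    have hu2 : 0 < 1 - ‖u‖ ^ 2 := by nlinarith [norm_nonneg u]
    show 0 < (cayley z u).im
    rw [im_cayley z hu]
    positivity
  · intro hw
    have hw0 : 0 < w.im := hw
    have h1 : w - conj z ≠ 0 := norm_pos_iff.1 (norm_sub_conj_pos hw hz)
    have h2 : z - conj z ≠ 0 := norm_pos_iff.1 (norm_sub_conj_pos hz hz)
    refine ⟨(w - z) / (w - conj z), ?_, ?_⟩
    · rw [mem_ball_zero_iff, norm_div, div_lt_one (norm_pos_iff.2 h1)]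
      refine lt_of_pow_lt_pow_left₀ 2 (norm_nonneg _) ?_
      rw [← Complex.normSq_eq_norm_sq, ← Complex.normSq_eq_norm_sq, Complex.normSq_apply,
        Complex.normSq_apply]
      simp only [Complex.sub_re, Complex.sub_im, Complex.conj_re, Complex.conj_im]
      nlinarith
    · have h3 : 1 - (w - z) / (w - conj z) = (z - conj z) / (w - conj z) := by
        field_simp; ring
      rw [cayley, h3]
      field_simp
      ring

lemma injOn_cayley {z : ℂ} (hz : z ∈ halfPlane) : InjOn (cayley z) (Metric.ball (0 : ℂ) 1) := by
  intro u hu v hv h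
  have h2 : z - conj z ≠ 0 := norm_pos_iff.1 (norm_sub_conj_pos hz hz)
  have hu0 := one_sub_ne_zero_of_mem_ball hu
  have hv0 := one_sub_ne_zero_of_mem_ball hv
  rw [cayley, cayley, div_eq_div_iff hu0 hv0] at h
  have h3 : (z - conj z) * (u - v) = 0 := by linear_combination h
  rcases mul_eq_zero.1 h3 with h | h
  · exact absurd h h2
  · exact sub_eq_zero.1 h

/-- The quantity `2 * z.im / ‖1 - u‖ ^ 2` occurs with exponent `2` in the Jacobian, `a` in the
weight and `-(2 + a)` in the kernel, so it cancels. What remains is the radial weight times a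
function holomorphic on the disc. -/
lemma cayley_integrand {a : ℝ} {z : ℂ} (hz : z ∈ halfPlane) (F : ℂ → ℂ) {u : ℂ}
    (hu : u ∈ Metric.ball (0 : ℂ) 1) :
    (‖(z - conj z) / (1 - u) ^ 2‖ ^ 2) •
      ((cayley z u).im ^ a • (halfPlaneKernel a z (cayley z u) * F (cayley z u))) =
    ((a + 1) / Real.pi : ℝ) • (((1 - ‖u‖ ^ 2) ^ a : ℝ) •
      (F (cayley z u) * (1 - u) ^ ((-(2 + a) : ℝ) : ℂ))) := by
  have hz0 : 0 < z.im := hz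
  have h0 := one_sub_ne_zero_of_mem_ball hu
  have hn : 0 < ‖1 - u‖ := norm_pos_iff.2 h0
  have hu1 : ‖u‖ < 1 := by simpa using hu
  have hρ : 0 < 1 - ‖u‖ ^ 2 := by nlinarith [norm_nonneg u]
  have hr : 0 < 2 * z.im / ‖1 - u‖ ^ 2 := by positivity
  have h1 : ‖z - conj z‖ = 2 * z.im := by
    rw [Complex.sub_conj, norm_mul, Complex.norm_real, Complex.norm_I, mul_one,
      Real.norm_of_nonneg (by positivity)]
  have hpow : (((2 * z.im / ‖1 - u‖ ^ 2 : ℝ) : ℂ) * (1 - u)) ^ ((-(2 + a) : ℝ) : ℂ) =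
      (((2 * z.im / ‖1 - u‖ ^ 2) ^ (-(2 + a)) : ℝ) : ℂ) * (1 - u) ^ ((-(2 + a) : ℝ) : ℂ) := by
    have hrc : ((2 * z.im / ‖1 - u‖ ^ 2 : ℝ) : ℂ) ≠ 0 := by exact_mod_cast hr.ne'
    rw [Complex.ofReal_cpow hr.le, Complex.cpow_def_of_ne_zero (mul_ne_zero hrc h0),
      Complex.log_ofReal_mul hr h0, Complex.cpow_def_of_ne_zero hrc,
      Complex.cpow_def_of_ne_zero h0, ← Complex.exp_add, Complex.ofReal_log hr.le]
    congr 1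
    ring
  have hreal : (2 * z.im / ‖1 - u‖ ^ 2) ^ 2 * ((z.im * (1 - ‖u‖ ^ 2) / ‖1 - u‖ ^ 2) ^ a *
      ((2 ^ a * (a + 1) / Real.pi) * (2 * z.im / ‖1 - u‖ ^ 2) ^ (-(2 + a)))) =
      (a + 1) / Real.pi * (1 - ‖u‖ ^ 2) ^ a := by
    set t := ‖1 - u‖ ^ 2 with ht
    have ht0 : 0 < t := by positivity
    have e1 : z.im * (1 - ‖u‖ ^ 2) / t = (2 * z.im / t) * ((1 - ‖u‖ ^ 2) / 2) := by
      field_simp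
    have e2 : (2 * z.im / t) ^ 2 * ((2 * z.im / t) ^ a * (2 * z.im / t) ^ (-(2 + a))) = 1 := by
      rw [← Real.rpow_natCast, ← Real.rpow_add hr, ← Real.rpow_add hr]
      have : ((2 : ℕ) : ℝ) + (a + -(2 + a)) = 0 := by push_cast; ring
      rw [this, Real.rpow_zero]
    rw [e1, Real.mul_rpow hr.le (by positivity), Real.div_rpow hρ.le (by norm_num)]
    calc _ = ((2 * z.im / t) ^ 2 * ((2 * z.im / t) ^ a * (2 * z.im / t) ^ (-(2 + a)))) *
          ((1 - ‖u‖ ^ 2) ^ a / 2 ^ a * (2 ^ a * (a + 1) / Real.pi)) := by ring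
      _ = _ := by rw [e2]; field_simp
  rw [halfPlaneKernel, sub_conj_cayley z hu, hpow, im_cayley z hu, norm_div, norm_pow, h1]
  simp only [Complex.real_smul]
  have hc := congrArg (fun x : ℝ => (x : ℂ)) hreal
  push_cast at hc ⊢
  linear_combination (F (cayley z u) * (1 - u) ^ (-(2 + a) : ℂ)) * hc

lemma integral_halfPlaneMeasure (a : ℝ) (F : ℂ → ℂ) :
    ∫ w, F w ∂halfPlaneMeasure a = ∫ w in halfPlane, (w.im ^ a : ℝ) • F w := by
  rw [halfPlaneMeasure, integral_withDensity_eq_integral_toReal_smul (by fun_prop)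
    (Eventually.of_forall fun _ => ENNReal.ofReal_lt_top)]
  refine setIntegral_congr_fun measurableSet_halfPlane fun w hw => ?_
  have hw : 0 < w.im := hw
  simp only [ENNReal.toReal_ofReal (Real.rpow_nonneg hw.le a)]

lemma integrable_halfPlaneMeasure_iff (a : ℝ) (F : ℂ → ℂ) :
    Integrable F (halfPlaneMeasure a) ↔
      IntegrableOn (fun w => (w.im ^ a : ℝ) • F w) halfPlane := by
  rw [halfPlaneMeasure, integrable_withDensity_iff_integrable_smul' (by fun_prop)
    (Eventually.of_forall fun _ => ENNReal.ofReal_lt_top)]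
  refine integrableOn_congr_fun (fun w hw => ?_) measurableSet_halfPlane
  have hw : 0 < w.im := hw
  simp only [ENNReal.toReal_ofReal (Real.rpow_nonneg hw.le a)]

/-- The reproducing formula on the half-plane, for every holomorphic function for which the
integral converges absolutely. -/
theorem integral_halfPlaneKernel_mul {a : ℝ} (ha : -1 < a) {F : ℂ → ℂ}
    (hF : DifferentiableOn ℂ F halfPlane) {z : ℂ} (hz : z ∈ halfPlane)
    (hint : Integrable (fun w => halfPlaneKernel a z w * F w) (halfPlaneMeasure a)) :
    ∫ w, halfPlaneKernel a z w * F w ∂halfPlaneMeasure a = F z := by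
  have ha1 : 0 < a + 1 := by linarith
  have hball : MeasurableSet (Metric.ball (0 : ℂ) 1) := measurableSet_ball
  rw [integrable_halfPlaneMeasure_iff, ← image_cayley hz,
    integrableOn_image_iff_norm_deriv_sq hball (fun u hu => hasDerivAt_cayley z hu)
      (injOn_cayley hz)] at hint
  rw [integral_halfPlaneMeasure, ← image_cayley hz,
    integral_image_eq_integral_norm_deriv_sq hball (fun u hu => hasDerivAt_cayley z hu)
      (injOn_cayley hz), setIntegral_congr_fun hball fun u hu => cayley_integrand hz F hu,
    integral_smul]
  rw [integrableOn_congr_fun (fun u hu => cayley_integrand hz F hu) hball] at hint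
  have hc : ((a + 1) / Real.pi : ℝ) ≠ 0 := by positivity
  have hint' := (integrable_smul_iff hc _).1 hint
  have hG : DifferentiableOn ℂ
      (fun u => F (cayley z u) * (1 - u) ^ ((-(2 + a) : ℝ) : ℂ)) (Metric.ball 0 1) := by
    refine DifferentiableOn.mul ?_ ?_
    · refine hF.comp (fun u hu => (hasDerivAt_cayley z hu).differentiableAt.differentiableWithinAt) ?_
      rw [← image_cayley hz]
      exact mapsTo_image _ _
    · refine DifferentiableOn.cpow (by fun_prop) (by fun_prop) fun u hu => ?_
      left
      have : ‖u‖ < 1 := by simpa using hu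
      have h2 := (Complex.abs_re_le_norm u).trans_lt this
      simp only [Complex.sub_re, Complex.one_re]
      linarith [le_abs_self u.re]
  rw [integral_ball_weight_smul ha hG hint', smul_smul]
  have : (a + 1) / Real.pi * (Real.pi / (a + 1)) = 1 := by
    have := Real.pi_pos
    field_simp
  rw [this, one_smul]
  simp [cayley]

/-! ### The measure and the kernel on the tube -/

variable {n : ℕ}

instance sigmaFinite_tubeMeasure (α : Fin n → ℝ) : SigmaFinite (tubeMeasure α) := by
  unfold tubeMeasure; infer_instance

lemma tube_eq_pi (n : ℕ) : tube n = univ.pi fun _ => halfPlane := by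
  ext z; simp [tube, halfPlane]

lemma isOpen_tube (n : ℕ) : IsOpen (tube n) := by
  rw [tube_eq_pi]; exact isOpen_set_pi finite_univ fun _ _ => isOpen_halfPlane

lemma measurableSet_tube (n : ℕ) : MeasurableSet (tube n) := (isOpen_tube n).measurableSet

lemma ae_mem_tube (α : Fin n → ℝ) : ∀ᵐ z ∂tubeMeasure α, z ∈ tube n := by
  have h : ∀ j : Fin n, ∀ᵐ z ∂tubeMeasure α, z j ∈ halfPlane := fun j =>
    Measure.tendsto_eval_ae_ae (ae_mem_halfPlane (α j))
  filter_upwards [ae_all_iff.2 h] with z hz using hz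

lemma restrict_tube (α : Fin n → ℝ) : (tubeMeasure α).restrict (tube n) = tubeMeasure α :=
  Measure.restrict_eq_self_of_ae_mem (ae_mem_tube α)

lemma aestronglyMeasurable_of_differentiableOn (α : Fin n → ℝ) {f : (Fin n → ℂ) → ℂ}
    (hf : DifferentiableOn ℂ f (tube n)) : AEStronglyMeasurable f (tubeMeasure α) := by
  rw [← restrict_tube α]
  exact hf.continuousOn.aestronglyMeasurable (measurableSet_tube n)

lemma cons_mem_tube {x : ℂ} {y : Fin n → ℂ} :
    (Fin.cons x y : Fin (n + 1) → ℂ) ∈ tube (n + 1) ↔ x ∈ halfPlane ∧ y ∈ tube n := by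
  simp [tube, Fin.forall_fin_succ]

/-- The first coordinate of a point and the others. -/
abbrev consEquiv (n : ℕ) : ℂ × (Fin n → ℂ) ≃ᵐ (Fin (n + 1) → ℂ) :=
  (MeasurableEquiv.piFinSuccAbove (fun _ : Fin (n + 1) => ℂ) 0).symm

lemma consEquiv_apply (x : ℂ × (Fin n → ℂ)) : consEquiv n x = Fin.cons x.1 x.2 := by
  simp [consEquiv, MeasurableEquiv.piFinSuccAbove, Fin.insertNthEquiv]

lemma measurePreserving_cons (α : Fin (n + 1) → ℝ) :
    MeasurePreserving (consEquiv n) ((halfPlaneMeasure (α 0)).prod (tubeMeasure (Fin.tail α)))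
      (tubeMeasure α) :=
  (measurePreserving_piFinSuccAbove (fun j => halfPlaneMeasure (α j)) 0).symm

lemma measurable_cons : Measurable fun x : ℂ × (Fin n → ℂ) => (Fin.cons x.1 x.2 : Fin (n + 1) → ℂ) := by
  have h : (fun x : ℂ × (Fin n → ℂ) => (Fin.cons x.1 x.2 : Fin (n + 1) → ℂ)) = consEquiv n :=
    funext fun x => (consEquiv_apply x).symm
  rw [h]
  exact (consEquiv n).measurable

lemma lintegral_tubeMeasure_succ (α : Fin (n + 1) → ℝ) {F : (Fin (n + 1) → ℂ) → ℝ≥0∞}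
    (hF : Measurable F) :
    ∫⁻ z, F z ∂tubeMeasure α =
      ∫⁻ x, ∫⁻ y, F (Fin.cons x y) ∂tubeMeasure (Fin.tail α) ∂halfPlaneMeasure (α 0) := by
  rw [← (measurePreserving_cons α).lintegral_comp hF, lintegral_prod]
  · simp only [consEquiv_apply]
  · exact (hF.comp (consEquiv n).measurable).aemeasurable

lemma lintegral_tubeMeasure_succ' (α : Fin (n + 1) → ℝ) {F : (Fin (n + 1) → ℂ) → ℝ≥0∞}
    (hF : Measurable F) :
    ∫⁻ z, F z ∂tubeMeasure α =
      ∫⁻ y, ∫⁻ x, F (Fin.cons x y) ∂halfPlaneMeasure (α 0) ∂tubeMeasure (Fin.tail α) := by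
  rw [← (measurePreserving_cons α).lintegral_comp hF, lintegral_prod_symm]
  · simp only [consEquiv_apply]
  · exact (hF.comp (consEquiv n).measurable).aemeasurable

lemma tubeMeasure_zero (α : Fin 0 → ℝ) (x : Fin 0 → ℂ) : tubeMeasure α = Measure.dirac x :=
  Measure.pi_of_empty _ x

/-- The modulus of the kernel of the tube without its constant factor. -/
def modTube (α : Fin n → ℝ) (z w : Fin n → ℂ) : ℝ≥0∞ := ∏ j, modKernel (α j) (z j) (w j)

/-- The product of the powers `(Im w_j) ^ (2 + α_j)`. -/
def tubeHeight (α : Fin n → ℝ) (w : Fin n → ℂ) : ℝ≥0∞ :=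
  ∏ j, ENNReal.ofReal ((w j).im ^ (2 + α j))

/-- The constant factor of the kernel of the tube. -/
def tubeKernelConst (α : Fin n → ℝ) : ℝ≥0∞ :=
  ∏ j, ENNReal.ofReal (2 ^ α j * (α j + 1) / Real.pi)

lemma measurable_modTube (α : Fin n → ℝ) :
    Measurable fun x : (Fin n → ℂ) × (Fin n → ℂ) => modTube α x.1 x.2 := by
  unfold modTube
  refine Finset.measurable_fun_prod _ fun j _ => ?_
  unfold modKernel
  fun_prop

lemma measurable_modTube_left (α : Fin n → ℝ) (w : Fin n → ℂ) :
    Measurable fun z => modTube α z w := by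
  unfold modTube
  refine Finset.measurable_fun_prod _ fun j _ => ?_
  unfold modKernel
  fun_prop

lemma modTube_comm (α : Fin n → ℝ) (z w : Fin n → ℂ) : modTube α z w = modTube α w z :=
  Finset.prod_congr rfl fun _ _ => modKernel_comm _ _ _

lemma modTube_ne_top (α : Fin n → ℝ) (z w : Fin n → ℂ) : modTube α z w ≠ ∞ :=
  ENNReal.prod_ne_top fun _ _ => modKernel_ne_top _ _ _

lemma tubeHeight_ne_top (α : Fin n → ℝ) (w : Fin n → ℂ) : tubeHeight α w ≠ ∞ :=
  ENNReal.prod_ne_top fun _ _ => ENNReal.ofReal_ne_top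

lemma tubeHeight_ne_zero (α : Fin n → ℝ) {w : Fin n → ℂ} (hw : w ∈ tube n) : tubeHeight α w ≠ 0 :=
  Finset.prod_ne_zero_iff.2 fun j _ => (ENNReal.ofReal_pos.2 (Real.rpow_pos_of_pos (hw j) _)).ne'

lemma tubeKernelConst_ne_top (α : Fin n → ℝ) : tubeKernelConst α ≠ ∞ :=
  ENNReal.prod_ne_top fun _ _ => ENNReal.ofReal_ne_top

lemma tubeKernelConst_ne_zero {α : Fin n → ℝ} (hα : ∀ j, -1 < α j) : tubeKernelConst α ≠ 0 :=
  Finset.prod_ne_zero_iff.2 fun j _ => (ENNReal.ofReal_pos.2 (by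
    have : 0 < α j + 1 := by linarith [hα j]
    positivity)).ne'

lemma modTube_cons (α : Fin (n + 1) → ℝ) (x u : ℂ) (y v : Fin n → ℂ) :
    modTube α (Fin.cons x y) (Fin.cons u v) = modKernel (α 0) x u * modTube (Fin.tail α) y v := by
  simp [modTube, Fin.prod_univ_succ, Fin.tail]

lemma tubeHeight_cons (α : Fin (n + 1) → ℝ) (u : ℂ) (v : Fin n → ℂ) :
    tubeHeight α (Fin.cons u v) =
      ENNReal.ofReal (u.im ^ (2 + α 0)) * tubeHeight (Fin.tail α) v := by
  simp [tubeHeight, Fin.prod_univ_succ, Fin.tail]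

lemma tubeKernel_cons (α : Fin (n + 1) → ℝ) (x u : ℂ) (y v : Fin n → ℂ) :
    tubeKernel α (Fin.cons x y) (Fin.cons u v) =
      halfPlaneKernel (α 0) x u * tubeKernel (Fin.tail α) y v := by
  simp [tubeKernel, Fin.prod_univ_succ, Fin.tail]

lemma enorm_prod_eq {ι : Type*} (s : Finset ι) (f : ι → ℂ) : ‖∏ i ∈ s, f i‖ₑ = ∏ i ∈ s, ‖f i‖ₑ := by
  classical
  induction s using Finset.induction_on with
  | empty => simp
  | insert i s hi ih => rw [Finset.prod_insert hi, Finset.prod_insert hi, enorm_mul, ih]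

lemma enorm_tubeKernel {α : Fin n → ℝ} (hα : ∀ j, -1 < α j) (z w : Fin n → ℂ) :
    ‖tubeKernel α z w‖ₑ = tubeKernelConst α * modTube α z w := by
  rw [tubeKernel, enorm_prod_eq, tubeKernelConst, modTube, ← Finset.prod_mul_distrib]
  exact Finset.prod_congr rfl fun j _ => enorm_halfPlaneKernel (hα j) _ _

lemma lintegral_modTube_rpow (α : Fin n → ℝ) {s : ℝ} (hs : 0 < s) {w : Fin n → ℂ}
    (hw : w ∈ tube n) :
    ∫⁻ z, modTube α z w ^ s ∂tubeMeasure α =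
      tubeHeight α w ^ (1 - s) * ∏ j, modKernelMass (α j) s := by
  induction n with
  | zero =>
    rw [tubeMeasure_zero α w, lintegral_dirac]
    simp [modTube, tubeHeight]
  | succ n ih =>
    obtain ⟨u, v, rfl⟩ : ∃ u v, w = Fin.cons u v := ⟨w 0, Fin.tail w, (Fin.cons_self_tail w).symm⟩
    obtain ⟨hu, hv⟩ := cons_mem_tube.1 hw
    have hu0 : 0 < u.im := hu
    have hm := ih (Fin.tail α) hv
    rw [lintegral_tubeMeasure_succ α ((measurable_modTube_left α _).pow_const s)]
    simp only [modTube_cons, ENNReal.mul_rpow_of_nonneg _ _ hs.le]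
    have : ∀ x : ℂ, ∫⁻ y, modKernel (α 0) x u ^ s * modTube (Fin.tail α) y v ^ s
        ∂tubeMeasure (Fin.tail α) = modKernel (α 0) x u ^ s *
          (tubeHeight (Fin.tail α) v ^ (1 - s) * ∏ j, modKernelMass (Fin.tail α j) s) := fun x => by
      rw [lintegral_const_mul _ ((measurable_modTube_left _ _).pow_const s), hm]
    simp only [this]
    have hmk : Measurable fun x => modKernel (α 0) x u ^ s :=
      ((measurable_modKernel _).comp (measurable_id.prodMk measurable_const)).pow_const s
    rw [lintegral_mul_const _ hmk, lintegral_modKernel_rpow hs hu, tubeHeight_cons,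
      ENNReal.mul_rpow_of_ne_top ENNReal.ofReal_ne_top (tubeHeight_ne_top _ _), Fin.prod_univ_succ,
      ENNReal.ofReal_rpow_of_pos (Real.rpow_pos_of_pos hu0 _), ← Real.rpow_mul hu0.le]
    simp only [Fin.tail]
    ring

lemma differentiableOn_halfPlaneKernel (a : ℝ) {w : ℂ} (hw : w ∈ halfPlane) :
    DifferentiableOn ℂ (fun z => halfPlaneKernel a z w) halfPlane := by
  unfold halfPlaneKernel
  refine DifferentiableOn.const_mul ?_ _
  refine DifferentiableOn.cpow (by fun_prop) (by fun_prop) fun z hz => ?_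
  left
  have h1 : 0 < z.im := hz
  have h2 : 0 < w.im := hw
  have : ((z - conj w) / Complex.I).re = z.im + w.im := by simp [Complex.div_I]
  rw [this]; linarith

lemma differentiableOn_prod {ι E : Type*} [NormedAddCommGroup E] [NormedSpace ℂ E] (s : Finset ι)
    {f : ι → E → ℂ} {t : Set E} (h : ∀ i ∈ s, DifferentiableOn ℂ (f i) t) :
    DifferentiableOn ℂ (fun z => ∏ i ∈ s, f i z) t := by
  classical
  induction s using Finset.induction_on with
  | empty => simp
  | insert i s hi ih =>
    simp only [Finset.prod_insert hi]
    exact (h i (Finset.mem_insert_self i s)).mul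
      (ih fun j hj => h j (Finset.mem_insert_of_mem hj))

lemma differentiableOn_tubeKernel (α : Fin n → ℝ) {w : Fin n → ℂ} (hw : w ∈ tube n) :
    DifferentiableOn ℂ (fun z => tubeKernel α z w) (tube n) := by
  unfold tubeKernel
  refine differentiableOn_prod _ fun j _ => ?_
  exact (differentiableOn_halfPlaneKernel (α j) (hw j)).comp (by fun_prop) fun z hz => hz j

lemma measurable_tubeKernel (α : Fin n → ℝ) :
    Measurable fun x : (Fin n → ℂ) × (Fin n → ℂ) => tubeKernel α x.1 x.2 := by
  unfold tubeKernel halfPlaneKernel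
  refine Finset.measurable_fun_prod _ fun j _ => ?_
  fun_prop

/-! ### The reproducing formula on the tube -/

lemma differentiable_cons_left (y : Fin n → ℂ) :
    Differentiable ℂ fun x : ℂ => (Fin.cons x y : Fin (n + 1) → ℂ) := by
  refine differentiable_pi.2 fun j => ?_
  refine Fin.cases ?_ (fun j => ?_) j
  · simp
  · simp

lemma differentiable_cons_right (x : ℂ) :
    Differentiable ℂ fun y : Fin n → ℂ => (Fin.cons x y : Fin (n + 1) → ℂ) := by
  refine differentiable_pi.2 fun j => ?_
  refine Fin.cases ?_ (fun j => ?_) j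
  · simp
  · simp only [Fin.cons_succ]; fun_prop

lemma differentiableOn_slice_left {f : (Fin (n + 1) → ℂ) → ℂ}
    (hf : DifferentiableOn ℂ f (tube (n + 1))) {y : Fin n → ℂ} (hy : y ∈ tube n) :
    DifferentiableOn ℂ (fun x => f (Fin.cons x y)) halfPlane :=
  hf.comp (differentiable_cons_left y).differentiableOn fun _ hx => cons_mem_tube.2 ⟨hx, hy⟩

lemma differentiableOn_slice_right {f : (Fin (n + 1) → ℂ) → ℂ}
    (hf : DifferentiableOn ℂ f (tube (n + 1))) {x : ℂ} (hx : x ∈ halfPlane) :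
    DifferentiableOn ℂ (fun y => f (Fin.cons x y)) (tube n) :=
  hf.comp (differentiable_cons_right x).differentiableOn fun _ hy => cons_mem_tube.2 ⟨hx, hy⟩

/-- The reproducing formula on the tube, for every holomorphic function for which the integral
converges absolutely. -/
theorem integral_tubeKernel_mul {α : Fin n → ℝ} (hα : ∀ j, -1 < α j) {F : (Fin n → ℂ) → ℂ}
    (hF : DifferentiableOn ℂ F (tube n)) {z : Fin n → ℂ} (hz : z ∈ tube n)
    (hint : Integrable (fun w => tubeKernel α z w * F w) (tubeMeasure α)) :
    ∫ w, tubeKernel α z w * F w ∂tubeMeasure α = F z := by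
  induction n with
  | zero =>
    rw [tubeMeasure_zero α z, integral_dirac]
    simp [tubeKernel]
  | succ n ih =>
    obtain ⟨x, y, rfl⟩ : ∃ u v, z = Fin.cons u v := ⟨z 0, Fin.tail z, (Fin.cons_self_tail z).symm⟩
    obtain ⟨hx, hy⟩ := cons_mem_tube.1 hz
    have hmp := measurePreserving_cons α
    rw [← hmp.integrable_comp_emb (consEquiv n).measurableEmbedding] at hint
    rw [← hmp.integral_comp (consEquiv n).measurableEmbedding]
    have hcomp : ((fun w => tubeKernel α (Fin.cons x y) w * F w) ∘ consEquiv n) =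
        fun p => halfPlaneKernel (α 0) x p.1 * (tubeKernel (Fin.tail α) y p.2 *
          F (Fin.cons p.1 p.2)) := by
      ext p
      simp only [Function.comp_apply, consEquiv_apply, tubeKernel_cons]
      ring
    have hcomp' : ∀ p, tubeKernel α (Fin.cons x y) (consEquiv n p) * F (consEquiv n p) =
        halfPlaneKernel (α 0) x p.1 * (tubeKernel (Fin.tail α) y p.2 *
          F (Fin.cons p.1 p.2)) := fun p => congrFun hcomp p
    rw [hcomp] at hint
    simp only [hcomp']
    rw [integral_prod_symm _ hint]
    -- Joint absolute convergence gives absolute convergence on almost every slice only; this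
    -- suffices under the outer integral, and Fubini also supplies the integrability required by the
    -- induction hypothesis.
    have hinner : ∀ᵐ v ∂tubeMeasure (Fin.tail α), ∫ u, halfPlaneKernel (α 0) x u *
        (tubeKernel (Fin.tail α) y v * F (Fin.cons u v)) ∂halfPlaneMeasure (α 0) =
          tubeKernel (Fin.tail α) y v * F (Fin.cons x v) := by
      filter_upwards [hint.prod_left_ae, ae_mem_tube (Fin.tail α)] with v hv hvt
      exact integral_halfPlaneKernel_mul (hα 0)
        ((differentiableOn_slice_left hF hvt).const_mul (tubeKernel (Fin.tail α) y v)) hx hv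
    rw [integral_congr_ae hinner]
    refine ih (fun j => hα j.succ) (differentiableOn_slice_right hF hx) hy ?_
    exact hint.integral_prod_right.congr hinner

/-! ### Pointwise estimates -/

/-- The norm `‖F κ_w‖_{p,α}`, where `κ_w` is the modulus of the kernel without its constant. -/
def kernelNorm (p : ℝ) (α : Fin n → ℝ) (w : Fin n → ℂ) (F : (Fin n → ℂ) → ℝ≥0∞) : ℝ≥0∞ :=
  (∫⁻ z, (F z * modTube α z w) ^ p ∂tubeMeasure α) ^ (1 / p)

/-- The norm `‖F κ_w‖_{p,a}` on the half-plane. -/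
def halfPlaneKernelNorm (p a : ℝ) (w : ℂ) (F : ℂ → ℝ≥0∞) : ℝ≥0∞ :=
  (∫⁻ z, (F z * modKernel a z w) ^ p ∂halfPlaneMeasure a) ^ (1 / p)

/-- The constant in `enorm_le_kernelNorm`. -/
def pointwiseConst (α : Fin n → ℝ) (q : ℝ) : ℝ≥0∞ :=
  tubeKernelConst α * (∏ j, ENNReal.ofReal (2 ^ (2 + α j))) * (∏ j, modKernelMass (α j) q) ^ (1 / q)

lemma pointwiseConst_ne_top {α : Fin n → ℝ} (hα : ∀ j, -1 < α j) {q : ℝ} (hq : 1 < q) :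
    pointwiseConst α q ≠ ∞ := by
  refine ENNReal.mul_ne_top (ENNReal.mul_ne_top (tubeKernelConst_ne_top α)
    (ENNReal.prod_ne_top fun _ _ => ENNReal.ofReal_ne_top)) ?_
  exact ENNReal.rpow_ne_top_of_nonneg (by positivity)
    (ENNReal.prod_ne_top fun j _ => modKernelMass_ne_top (hα j) hq)

/-- Either the right side is infinite or the reproducing formula applies, so no integrability has to
be assumed. -/
lemma enorm_le_lintegral_tubeKernel {α : Fin n → ℝ} (hα : ∀ j, -1 < α j) {F : (Fin n → ℂ) → ℂ}
    (hF : DifferentiableOn ℂ F (tube n)) {w : Fin n → ℂ} (hw : w ∈ tube n) :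
    ‖F w‖ₑ ≤ ∫⁻ z, ‖tubeKernel α w z * F z‖ₑ ∂tubeMeasure α := by
  have hm : AEStronglyMeasurable (fun z => tubeKernel α w z * F z) (tubeMeasure α) := by
    refine AEStronglyMeasurable.mul ?_ (aestronglyMeasurable_of_differentiableOn α hF)
    have : Measurable fun z => tubeKernel α w z := by
      unfold tubeKernel halfPlaneKernel
      refine Finset.measurable_fun_prod _ fun j _ => ?_
      fun_prop
    exact this.aestronglyMeasurable
  by_cases hint : Integrable (fun z => tubeKernel α w z * F z) (tubeMeasure α)
  · rw [← integral_tubeKernel_mul hα hF hw hint]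
    exact enorm_integral_le_lintegral_enorm _
  · have : ∫⁻ z, ‖tubeKernel α w z * F z‖ₑ ∂tubeMeasure α = ∞ := by
      by_contra h
      exact hint ⟨hm, lt_top_iff_ne_top.2 h⟩
    rw [this]; exact le_top

lemma modTube_self_mul {α : Fin n → ℝ} {w : Fin n → ℂ} (hw : w ∈ tube n) :
    modTube α w w * (tubeHeight α w * ∏ j, ENNReal.ofReal (2 ^ (2 + α j))) = 1 := by
  rw [modTube, tubeHeight, ← Finset.prod_mul_distrib, ← Finset.prod_mul_distrib]
  refine Finset.prod_eq_one fun j _ => ?_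
  have hj : 0 < (w j).im := hw j
  have hn : ‖w j - conj (w j)‖ = 2 * (w j).im := by
    rw [Complex.sub_conj, norm_mul, Complex.norm_real, Complex.norm_I, mul_one,
      Real.norm_of_nonneg (by positivity)]
  rw [modKernel, hn, ← ENNReal.ofReal_mul (by positivity), ← ENNReal.ofReal_mul (by positivity),
    ← ENNReal.ofReal_one]
  congr 1
  rw [Real.rpow_neg (by positivity), Real.mul_rpow (by norm_num) hj.le]
  field_simp

lemma rpow_lintegral_modTube {α : Fin n → ℝ} {q : ℝ} (hq : 0 < q) {w : Fin n → ℂ}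
    (hw : w ∈ tube n) :
    tubeHeight α w * (∫⁻ z, modTube α z w ^ q ∂tubeMeasure α) ^ (1 / q) =
      tubeHeight α w ^ (1 / q) * (∏ j, modKernelMass (α j) q) ^ (1 / q) := by
  rw [lintegral_modTube_rpow α hq hw, ENNReal.mul_rpow_of_nonneg _ _ (by positivity),
    ← ENNReal.rpow_mul, ← mul_assoc]
  congr 1
  nth_rw 1 [← ENNReal.rpow_one (tubeHeight α w)]
  rw [← ENNReal.rpow_add _ _ (tubeHeight_ne_zero α hw) (tubeHeight_ne_top α w)]
  congr 1
  field_simp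
  ring

/-- The pointwise estimate for holomorphic functions in terms of `‖f κ_w‖_{p,α}`. -/
theorem enorm_le_kernelNorm {α : Fin n → ℝ} (hα : ∀ j, -1 < α j) {p q : ℝ}
    (hpq : p.HolderConjugate q) {f : (Fin n → ℂ) → ℂ} (hf : DifferentiableOn ℂ f (tube n))
    {w : Fin n → ℂ} (hw : w ∈ tube n) :
    ‖f w‖ₑ ≤ pointwiseConst α q * tubeHeight α w ^ (1 / q) * kernelNorm p α w fun z => ‖f z‖ₑ := by
  have hq0 : 0 < q := hpq.symm.pos
  set c := tubeKernelConst α with hc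
  have hc0 : c ≠ 0 := tubeKernelConst_ne_zero hα
  have hcT : c ≠ ∞ := tubeKernelConst_ne_top α
  have hfm : AEMeasurable (fun z => ‖f z‖ₑ) (tubeMeasure α) :=
    (aestronglyMeasurable_of_differentiableOn α hf).enorm
  -- The reproducing formula is applied to `f K_w` at `w` rather than to `f`. Hölder then pairs
  -- `K_w` in `L^q` with `f K_w` in `L^p`, and division by `K(w, w)` restores `f w`.
  have h1 := enorm_le_lintegral_tubeKernel hα (hf.mul (differentiableOn_tubeKernel α hw)) hw
  simp only [enorm_mul, Pi.mul_apply, enorm_tubeKernel hα, ← hc] at h1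
  have h2 : ∫⁻ z, c * modTube α w z * (‖f z‖ₑ * (c * modTube α z w)) ∂tubeMeasure α =
      c * c * ∫⁻ z, (fun z => modTube α z w) z * (fun z => ‖f z‖ₑ * modTube α z w) z
        ∂tubeMeasure α := by
    rw [← lintegral_const_mul' _ _ (ENNReal.mul_ne_top hcT hcT)]
    refine lintegral_congr fun z => ?_
    rw [modTube_comm α w z]
    ring
  have h3 : ∫⁻ z, (fun z => modTube α z w) z * (fun z => ‖f z‖ₑ * modTube α z w) z ∂tubeMeasure α ≤
      (∫⁻ z, modTube α z w ^ q ∂tubeMeasure α) ^ (1 / q) * kernelNorm p α w fun z => ‖f z‖ₑ :=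
    ENNReal.lintegral_mul_le_Lp_mul_Lq _ hpq.symm (measurable_modTube_left α w).aemeasurable
      (hfm.mul (measurable_modTube_left α w).aemeasurable)
  have h4 : c * (‖f w‖ₑ * modTube α w w) ≤ c * (c * ((∫⁻ z, modTube α z w ^ q ∂tubeMeasure α) ^ (1 / q) *
      kernelNorm p α w fun z => ‖f z‖ₑ)) := by
    calc c * (‖f w‖ₑ * modTube α w w) = ‖f w‖ₑ * (c * modTube α w w) := by ring
      _ ≤ _ := h1
      _ = _ := h2
      _ ≤ c * c * _ := mul_le_mul' le_rfl h3
      _ = _ := by ring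
  have h5 := (ENNReal.mul_le_mul_iff_right hc0 hcT).1 h4
  set D : ℝ≥0∞ := ∏ j, ENNReal.ofReal (2 ^ (2 + α j)) with hD
  calc ‖f w‖ₑ = ‖f w‖ₑ * (modTube α w w * (tubeHeight α w * D)) := by
        rw [modTube_self_mul hw, mul_one]
    _ = ‖f w‖ₑ * modTube α w w * (tubeHeight α w * D) := by ring
    _ ≤ (c * ((∫⁻ z, modTube α z w ^ q ∂tubeMeasure α) ^ (1 / q) *
      kernelNorm p α w fun z => ‖f z‖ₑ)) * (tubeHeight α w * D) := mul_le_mul' h5 le_rfl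
    _ = c * D * (tubeHeight α w * (∫⁻ z, modTube α z w ^ q ∂tubeMeasure α) ^ (1 / q)) *
      kernelNorm p α w fun z => ‖f z‖ₑ := by ring
    _ = _ := by rw [rpow_lintegral_modTube hq0 hw, pointwiseConst]; ring

lemma enorm_le_halfPlaneKernelNorm {a : ℝ} (ha : -1 < a) {p q : ℝ}
    (hpq : p.HolderConjugate q) {f : ℂ → ℂ} (hfm : Measurable f)
    (hf : DifferentiableOn ℂ f halfPlane) {w : ℂ} (hw : w ∈ halfPlane) :
    ‖f w‖ₑ ≤ pointwiseConst (fun _ : Fin 1 => a) q * ENNReal.ofReal (w.im ^ (2 + a)) ^ (1 / q) *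
      halfPlaneKernelNorm p a w fun z => ‖f z‖ₑ := by
  have hg : DifferentiableOn ℂ (fun z : Fin 1 → ℂ => f (z 0)) (tube 1) :=
    hf.comp (by fun_prop) fun z hz => hz 0
  have h := enorm_le_kernelNorm (α := fun _ : Fin 1 => a) (fun _ => ha) hpq hg
    (w := fun _ => w) (fun _ => hw)
  have h1 : tubeHeight (fun _ : Fin 1 => a) (fun _ => w) = ENNReal.ofReal (w.im ^ (2 + a)) := by
    simp [tubeHeight]
  have h2 : kernelNorm p (fun _ : Fin 1 => a) (fun _ => w) (fun z => ‖f (z 0)‖ₑ) =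
      halfPlaneKernelNorm p a w fun z => ‖f z‖ₑ := by
    have hm : Measurable fun z : Fin 1 → ℂ =>
        (‖f (z 0)‖ₑ * modTube (fun _ : Fin 1 => a) z (fun _ => w)) ^ p :=
      ((hfm.comp (measurable_pi_apply 0)).enorm.mul (measurable_modTube_left _ _)).pow_const p
    rw [kernelNorm, halfPlaneKernelNorm, lintegral_tubeMeasure_succ _ hm]
    congr 1
    refine lintegral_congr fun x => ?_
    rw [tubeMeasure_zero _ (fun _ => w)]
    simp [modTube]
  rwa [h1, h2] at h

/-! ### Slices -/

/-- For each `x`, the pointwise estimate in the remaining variables bounds `f (x, v)` by an integral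
over `y`. Integration of the `p`-th power against the kernel in `x` rebuilds the full norm at `(u,
v)`, so freezing variables costs only a power of the height of `v`. -/
lemma halfPlaneKernelNorm_slice_le {α : Fin (n + 1) → ℝ} (hα : ∀ j, -1 < α j) {p q : ℝ}
    (hpq : p.HolderConjugate q) {f : (Fin (n + 1) → ℂ) → ℂ} (hfm : Measurable f)
    (hf : DifferentiableOn ℂ f (tube (n + 1))) (u : ℂ) {v : Fin n → ℂ}
    (hv : v ∈ tube n) :
    halfPlaneKernelNorm p (α 0) u (fun x => ‖f (Fin.cons x v)‖ₑ) ≤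
      pointwiseConst (Fin.tail α) q * tubeHeight (Fin.tail α) v ^ (1 / q) *
        kernelNorm p α (Fin.cons u v) fun z => ‖f z‖ₑ := by
  have hp0 : 0 < p := hpq.pos
  have hq1 : 1 < q := hpq.symm.lt
  set c := pointwiseConst (Fin.tail α) q * tubeHeight (Fin.tail α) v ^ (1 / q) with hc
  have hcT : c ≠ ∞ := ENNReal.mul_ne_top (pointwiseConst_ne_top (fun j => hα j.succ) hq1)
    (ENNReal.rpow_ne_top_of_nonneg (by positivity) (tubeHeight_ne_top _ _))
  have hm : Measurable fun z : Fin (n + 1) → ℂ => (‖f z‖ₑ * modTube α z (Fin.cons u v)) ^ p :=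
    (hfm.enorm.mul (measurable_modTube_left _ _)).pow_const p
  have key : ∀ᵐ x ∂halfPlaneMeasure (α 0), (‖f (Fin.cons x v)‖ₑ * modKernel (α 0) x u) ^ p ≤
      c ^ p * ∫⁻ y, (‖f (Fin.cons x y)‖ₑ * modTube α (Fin.cons x y) (Fin.cons u v)) ^ p
        ∂tubeMeasure (Fin.tail α) := by
    filter_upwards [ae_mem_halfPlane (α 0)] with x hx
    have h1 := enorm_le_kernelNorm (fun j => hα j.succ) hpq (α := Fin.tail α)
      (differentiableOn_slice_right hf hx) hv
    have h2 := ENNReal.rpow_le_rpow (mul_le_mul' h1 (le_refl (modKernel (α 0) x u))) hp0.le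
    refine h2.trans_eq ?_
    rw [← hc, ENNReal.mul_rpow_of_nonneg _ _ hp0.le, ENNReal.mul_rpow_of_nonneg _ _ hp0.le,
      kernelNorm, ← ENNReal.rpow_mul, one_div_mul_cancel hp0.ne', ENNReal.rpow_one, mul_assoc,
      ← lintegral_mul_const']
    · congr 1
      refine lintegral_congr fun y => ?_
      rw [modTube_cons, ← ENNReal.mul_rpow_of_nonneg _ _ hp0.le]
      congr 1
      ring
    · exact ENNReal.rpow_ne_top_of_nonneg hp0.le (modKernel_ne_top _ _ _)
  calc halfPlaneKernelNorm p (α 0) u (fun x => ‖f (Fin.cons x v)‖ₑ)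
      ≤ (∫⁻ x, c ^ p * ∫⁻ y, (‖f (Fin.cons x y)‖ₑ * modTube α (Fin.cons x y) (Fin.cons u v)) ^ p
        ∂tubeMeasure (Fin.tail α) ∂halfPlaneMeasure (α 0)) ^ (1 / p) :=
        ENNReal.rpow_le_rpow (lintegral_mono_ae key) (by positivity)
    _ = _ := by
        rw [lintegral_const_mul' _ _ (ENNReal.rpow_ne_top_of_nonneg hp0.le hcT),
          ← lintegral_tubeMeasure_succ α hm, ENNReal.mul_rpow_of_nonneg _ _ (by positivity),
          ← ENNReal.rpow_mul, mul_one_div_cancel hp0.ne', ENNReal.rpow_one, kernelNorm]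

lemma kernelNorm_slice_le {α : Fin (n + 1) → ℝ} (hα : ∀ j, -1 < α j) {p q : ℝ}
    (hpq : p.HolderConjugate q) {f : (Fin (n + 1) → ℂ) → ℂ} (hfm : Measurable f)
    (hf : DifferentiableOn ℂ f (tube (n + 1))) {u : ℂ} (hu : u ∈ halfPlane) (v : Fin n → ℂ) :
    kernelNorm p (Fin.tail α) v (fun y => ‖f (Fin.cons u y)‖ₑ) ≤
      pointwiseConst (fun _ : Fin 1 => α 0) q * ENNReal.ofReal (u.im ^ (2 + α 0)) ^ (1 / q) *
        kernelNorm p α (Fin.cons u v) fun z => ‖f z‖ₑ := by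
  have hp0 : 0 < p := hpq.pos
  have hq1 : 1 < q := hpq.symm.lt
  set c := pointwiseConst (fun _ : Fin 1 => α 0) q * ENNReal.ofReal (u.im ^ (2 + α 0)) ^ (1 / q) with hc
  have hcT : c ≠ ∞ := ENNReal.mul_ne_top (pointwiseConst_ne_top (fun _ => hα 0) hq1)
    (ENNReal.rpow_ne_top_of_nonneg (by positivity) ENNReal.ofReal_ne_top)
  have hm : Measurable fun z : Fin (n + 1) → ℂ => (‖f z‖ₑ * modTube α z (Fin.cons u v)) ^ p :=
    (hfm.enorm.mul (measurable_modTube_left _ _)).pow_const p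
  have key : ∀ᵐ y ∂tubeMeasure (Fin.tail α),
      (‖f (Fin.cons u y)‖ₑ * modTube (Fin.tail α) y v) ^ p ≤
      c ^ p * ∫⁻ x, (‖f (Fin.cons x y)‖ₑ * modTube α (Fin.cons x y) (Fin.cons u v)) ^ p
        ∂halfPlaneMeasure (α 0) := by
    filter_upwards [ae_mem_tube (Fin.tail α)] with y hy
    have hmx : Measurable fun x : ℂ => f (Fin.cons x y) :=
      hfm.comp (measurable_cons.comp (measurable_id.prodMk measurable_const))
    have h1 := enorm_le_halfPlaneKernelNorm (hα 0) hpq hmx (differentiableOn_slice_left hf hy) hu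
    have h2 := ENNReal.rpow_le_rpow (mul_le_mul' h1 (le_refl (modTube (Fin.tail α) y v))) hp0.le
    refine h2.trans_eq ?_
    rw [← hc, ENNReal.mul_rpow_of_nonneg _ _ hp0.le, ENNReal.mul_rpow_of_nonneg _ _ hp0.le,
      halfPlaneKernelNorm, ← ENNReal.rpow_mul, one_div_mul_cancel hp0.ne', ENNReal.rpow_one,
      mul_assoc, ← lintegral_mul_const']
    · congr 1
      refine lintegral_congr fun x => ?_
      rw [modTube_cons, ← ENNReal.mul_rpow_of_nonneg _ _ hp0.le]
      congr 1
      ring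
    · exact ENNReal.rpow_ne_top_of_nonneg hp0.le (modTube_ne_top _ _ _)
  calc kernelNorm p (Fin.tail α) v (fun y => ‖f (Fin.cons u y)‖ₑ)
      ≤ (∫⁻ y, c ^ p * ∫⁻ x, (‖f (Fin.cons x y)‖ₑ * modTube α (Fin.cons x y) (Fin.cons u v)) ^ p
        ∂halfPlaneMeasure (α 0) ∂tubeMeasure (Fin.tail α)) ^ (1 / p) :=
        ENNReal.rpow_le_rpow (lintegral_mono_ae key) (by positivity)
    _ = _ := by
        rw [lintegral_const_mul' _ _ (ENNReal.rpow_ne_top_of_nonneg hp0.le hcT),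
          ← lintegral_tubeMeasure_succ' α hm, ENNReal.mul_rpow_of_nonneg _ _ (by positivity),
          ← ENNReal.rpow_mul, mul_one_div_cancel hp0.ne', ENNReal.rpow_one, kernelNorm]

lemma rpow_conj_mul {p q : ℝ} (hpq : p.HolderConjugate q) {x : ℝ≥0∞} (h0 : x ≠ 0) (hT : x ≠ ∞) :
    x ^ (1 / q) * x ^ (1 / p) = x := by
  rw [← ENNReal.rpow_add _ _ h0 hT]
  have : 1 / q + 1 / p = 1 := by simpa using hpq.symm.inv_add_inv_eq_one
  rw [this, ENNReal.rpow_one]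

/-- The height powers `1 / q` and `1 / p` lost in the two slice estimates multiply to the full
height of `v`, exactly what the condition on the tube contains. The one-variable condition thus
holds for all slices, uniformly in `v`. -/
lemma halfPlaneKernelNorm_slice_mul_le {α : Fin (n + 1) → ℝ} (hα : ∀ j, -1 < α j) {p q : ℝ}
    (hpq : p.HolderConjugate q) {f g : (Fin (n + 1) → ℂ) → ℂ} (hfm : Measurable f)
    (hf : DifferentiableOn ℂ f (tube (n + 1))) (hgm : Measurable g)
    (hg : DifferentiableOn ℂ g (tube (n + 1))) {A : ℝ≥0∞}
    (hA : ∀ w ∈ tube (n + 1), kernelNorm p α w (fun z => ‖f z‖ₑ) *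
      kernelNorm q α w (fun z => ‖g z‖ₑ) * tubeHeight α w ≤ A)
    {u : ℂ} (hu : u ∈ halfPlane) {v : Fin n → ℂ} (hv : v ∈ tube n) :
    halfPlaneKernelNorm p (α 0) u (fun x => ‖f (Fin.cons x v)‖ₑ) *
      halfPlaneKernelNorm q (α 0) u (fun x => ‖g (Fin.cons x v)‖ₑ) *
        ENNReal.ofReal (u.im ^ (2 + α 0)) ≤
      pointwiseConst (Fin.tail α) q * pointwiseConst (Fin.tail α) p * A := by
  have h1 := halfPlaneKernelNorm_slice_le hα hpq hfm hf u hv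
  have h2 := halfPlaneKernelNorm_slice_le hα hpq.symm hgm hg u hv
  have h3 := hA _ (cons_mem_tube.2 ⟨hu, hv⟩)
  rw [tubeHeight_cons] at h3
  have hY := rpow_conj_mul hpq (tubeHeight_ne_zero (Fin.tail α) hv) (tubeHeight_ne_top _ v)
  refine (mul_le_mul' (mul_le_mul' h1 h2) le_rfl).trans ?_
  refine le_trans (le_of_eq ?_) (mul_le_mul' le_rfl h3)
  conv_rhs => rw [← hY]
  ring

lemma kernelNorm_slice_mul_le {α : Fin (n + 1) → ℝ} (hα : ∀ j, -1 < α j) {p q : ℝ}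
    (hpq : p.HolderConjugate q) {f g : (Fin (n + 1) → ℂ) → ℂ} (hfm : Measurable f)
    (hf : DifferentiableOn ℂ f (tube (n + 1))) (hgm : Measurable g)
    (hg : DifferentiableOn ℂ g (tube (n + 1))) {A : ℝ≥0∞}
    (hA : ∀ w ∈ tube (n + 1), kernelNorm p α w (fun z => ‖f z‖ₑ) *
      kernelNorm q α w (fun z => ‖g z‖ₑ) * tubeHeight α w ≤ A)
    {u : ℂ} (hu : u ∈ halfPlane) {v : Fin n → ℂ} (hv : v ∈ tube n) :
    kernelNorm p (Fin.tail α) v (fun y => ‖f (Fin.cons u y)‖ₑ) *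
      kernelNorm q (Fin.tail α) v (fun y => ‖g (Fin.cons u y)‖ₑ) * tubeHeight (Fin.tail α) v ≤
      pointwiseConst (fun _ : Fin 1 => α 0) q * pointwiseConst (fun _ : Fin 1 => α 0) p * A := by
  have hu0 : 0 < u.im := hu
  have h1 := kernelNorm_slice_le hα hpq hfm hf hu v
  have h2 := kernelNorm_slice_le hα hpq.symm hgm hg hu v
  have h3 := hA _ (cons_mem_tube.2 ⟨hu, hv⟩)
  rw [tubeHeight_cons] at h3
  have hY := rpow_conj_mul hpq (x := ENNReal.ofReal (u.im ^ (2 + α 0)))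
    (ENNReal.ofReal_pos.2 (by positivity)).ne' ENNReal.ofReal_ne_top
  refine (mul_le_mul' (mul_le_mul' h1 h2) le_rfl).trans ?_
  refine le_trans (le_of_eq ?_) (mul_le_mul' le_rfl h3)
  conv_rhs => rw [← hY]
  ring

/-! ### The weighted estimate for the positive Bergman operator on the tube -/

lemma enorm_mul_enorm_inv {x : ℂ} (hx : x ≠ 0) : ‖x‖ₑ * ‖x⁻¹‖ₑ = 1 := by
  rw [← enorm_mul, mul_inv_cancel₀ hx, enorm_one]

/-- The iterated form of the positive operator on a tube of dimension `n + 1`. -/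
lemma weighted_positive_step {α : Fin (n + 1) → ℝ} {f : (Fin (n + 1) → ℂ) → ℂ} (hfm : Measurable f)
    (hf0 : ∀ z ∈ tube (n + 1), f z ≠ 0) {U : (Fin (n + 1) → ℂ) → ℝ≥0∞} (hU : Measurable U)
    (x : ℂ) {y : Fin n → ℂ} (hy : y ∈ tube n) :
    ∫⁻ w, modTube α (Fin.cons x y) w * (‖(f w)⁻¹‖ₑ * U w) ∂tubeMeasure α =
      ∫⁻ u, modKernel (α 0) x u * (‖(f (Fin.cons u y))⁻¹‖ₑ * (‖f (Fin.cons u y)‖ₑ *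
        ∫⁻ v, modTube (Fin.tail α) y v * (‖(f (Fin.cons u v))⁻¹‖ₑ * U (Fin.cons u v))
          ∂tubeMeasure (Fin.tail α))) ∂halfPlaneMeasure (α 0) := by
  have hm : Measurable fun w => modTube α (Fin.cons x y) w * (‖(f w)⁻¹‖ₑ * U w) := by
    simp only [modTube_comm α (Fin.cons x y)]
    exact (measurable_modTube_left α _).mul (hfm.inv.enorm.mul hU)
  rw [lintegral_tubeMeasure_succ α hm]
  refine lintegral_congr_ae ?_
  filter_upwards [ae_mem_halfPlane (α 0)] with u hu
  -- The factor `|f|⁻¹ |f| = 1` is inserted at the mixed point `(u, y)`. It factors the operator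
  -- into a weighted operator in the last variables with `u` frozen, followed by one in the first
  -- variable with `y` frozen.
  have h1 := enorm_mul_enorm_inv (hf0 _ (cons_mem_tube.2 ⟨hu, hy⟩))
  rw [← mul_assoc ‖(f (Fin.cons u y))⁻¹‖ₑ, mul_comm ‖(f (Fin.cons u y))⁻¹‖ₑ, h1, one_mul,
    ← lintegral_const_mul' _ _ (modKernel_ne_top _ _ _)]
  refine lintegral_congr fun v => ?_
  rw [modTube_cons, mul_assoc]

/-- The weighted estimate for the positive Bergman operator on the tube, with weight `|f|` for a
holomorphic function `f` without zeros. -/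
theorem exists_lintegral_modTube_weighted_le {p q : ℝ} (hpq : p.HolderConjugate q) (n : ℕ)
    (α : Fin n → ℝ) (hα : ∀ j, -1 < α j) :
    ∃ C : ℝ≥0∞, C ≠ ∞ ∧ ∀ f : (Fin n → ℂ) → ℂ, Measurable f → DifferentiableOn ℂ f (tube n) →
      (∀ z ∈ tube n, f z ≠ 0) → ∀ A : ℝ≥0∞, A ≠ ∞ →
      (∀ w ∈ tube n, kernelNorm p α w (fun z => ‖f z‖ₑ) *
        kernelNorm q α w (fun z => ‖(f z)⁻¹‖ₑ) * tubeHeight α w ≤ A) →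
      ∀ U : (Fin n → ℂ) → ℝ≥0∞, Measurable U →
      ∫⁻ z, (‖f z‖ₑ * ∫⁻ w, modTube α z w * (‖(f w)⁻¹‖ₑ * U w) ∂tubeMeasure α) ^ p
        ∂tubeMeasure α ≤ (C * A ^ ((n : ℝ) * max p q)) ^ p * ∫⁻ z, U z ^ p ∂tubeMeasure α := by
  have hp0 : 0 < p := hpq.pos
  have hM : 0 ≤ max p q := hp0.le.trans (le_max_left _ _)
  induction n with
  | zero =>
    refine ⟨1, ENNReal.one_ne_top, fun f _ _ hf0 A _ _ U _ => ?_⟩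
    have hz : (0 : Fin 0 → ℂ) ∈ tube 0 := fun j => j.elim0
    rw [tubeMeasure_zero α 0]
    simp only [lintegral_dirac]
    have h1 := enorm_mul_enorm_inv (hf0 0 hz)
    have h2 : modTube α 0 0 = 1 := by simp [modTube]
    rw [h2, one_mul, ← mul_assoc, h1]
    simp
  | succ n ih =>
    obtain ⟨C, hC, hCb⟩ := ih (Fin.tail α) fun j => hα j.succ
    set c₁ := pointwiseConst (Fin.tail α) q * pointwiseConst (Fin.tail α) p with hc₁
    set c₂ := pointwiseConst (fun _ : Fin 1 => α 0) q * pointwiseConst (fun _ : Fin 1 => α 0) p with hc₂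
    have hc₁T : c₁ ≠ ∞ := ENNReal.mul_ne_top
      (pointwiseConst_ne_top (fun j => hα j.succ) hpq.symm.lt)
      (pointwiseConst_ne_top (fun j => hα j.succ) hpq.lt)
    have hc₂T : c₂ ≠ ∞ := ENNReal.mul_ne_top (pointwiseConst_ne_top (fun _ => hα 0) hpq.symm.lt)
      (pointwiseConst_ne_top (fun _ => hα 0) hpq.lt)
    have hnM : 0 ≤ (n : ℝ) * max p q := by positivity
    -- The half-plane estimate for the first variable times the induction constant for the others;
    -- `c₁` and `c₂` are the losses in passing to slices.
    refine ⟨(halfPlaneConst (α 0) p q * c₁ ^ max p q) * (C * c₂ ^ ((n : ℝ) * max p q)), ?_, ?_⟩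
    · exact ENNReal.mul_ne_top (ENNReal.mul_ne_top (halfPlaneConst_ne_top hpq)
        (ENNReal.rpow_ne_top_of_nonneg hM hc₁T))
        (ENNReal.mul_ne_top hC (ENNReal.rpow_ne_top_of_nonneg hnM hc₂T))
    intro f hfm hf hf0 A hA hAw U hU
    have hfi : DifferentiableOn ℂ (fun z => (f z)⁻¹) (tube (n + 1)) := hf.inv hf0
    have hfim : Measurable fun z => (f z)⁻¹ := hfm.inv
    -- the inner operator
    set W : ℂ → (Fin n → ℂ) → ℝ≥0∞ := fun u y => ‖f (Fin.cons u y)‖ₑ *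
      ∫⁻ v, modTube (Fin.tail α) y v * (‖(f (Fin.cons u v))⁻¹‖ₑ * U (Fin.cons u v))
        ∂tubeMeasure (Fin.tail α) with hW
    have hcu : ∀ u : ℂ, Measurable fun y : Fin n → ℂ => (Fin.cons u y : Fin (n + 1) → ℂ) :=
      fun u => measurable_cons.comp (measurable_const.prodMk measurable_id)
    have hcy : ∀ y : Fin n → ℂ, Measurable fun u : ℂ => (Fin.cons u y : Fin (n + 1) → ℂ) :=
      fun y => measurable_cons.comp (measurable_id.prodMk measurable_const)
    have hWm : Measurable fun x : ℂ × (Fin n → ℂ) => W x.1 x.2 := by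
      refine (hfm.comp measurable_cons).enorm.mul ?_
      refine Measurable.lintegral_prod_right' (f := fun x : (ℂ × (Fin n → ℂ)) × (Fin n → ℂ) =>
        modTube (Fin.tail α) x.1.2 x.2 *
          (‖(f (Fin.cons x.1.1 x.2))⁻¹‖ₑ * U (Fin.cons x.1.1 x.2))) ?_
      have h1 : Measurable fun x : (ℂ × (Fin n → ℂ)) × (Fin n → ℂ) =>
          modTube (Fin.tail α) x.1.2 x.2 := by
        unfold modTube
        refine Finset.measurable_fun_prod _ fun j _ => ?_
        unfold modKernel
        fun_prop
      have h2 : Measurable fun x : (ℂ × (Fin n → ℂ)) × (Fin n → ℂ) =>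
          (Fin.cons x.1.1 x.2 : Fin (n + 1) → ℂ) :=
        measurable_cons.comp ((measurable_fst.comp measurable_fst).prodMk measurable_snd)
      exact h1.mul ((hfim.comp h2).enorm.mul (hU.comp h2))
    have hinner : ∀ u ∈ halfPlane, ∫⁻ y, W u y ^ p ∂tubeMeasure (Fin.tail α) ≤
        (C * (c₂ * A) ^ ((n : ℝ) * max p q)) ^ p *
          ∫⁻ v, U (Fin.cons u v) ^ p ∂tubeMeasure (Fin.tail α) := by
      intro u hu
      exact hCb (fun y => f (Fin.cons u y)) (hfm.comp (hcu u)) (differentiableOn_slice_right hf hu)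
        (fun y hy => hf0 _ (cons_mem_tube.2 ⟨hu, hy⟩)) (c₂ * A) (ENNReal.mul_ne_top hc₂T hA)
        (fun v hv => kernelNorm_slice_mul_le hα hpq hfm hf hfim hfi hAw hu hv)
        (fun v => U (Fin.cons u v)) (hU.comp (hcu u))
    have houter : ∀ y ∈ tube n, ∫⁻ x, (‖f (Fin.cons x y)‖ₑ * ∫⁻ u, modKernel (α 0) x u *
        (‖(f (Fin.cons u y))⁻¹‖ₑ * W u y) ∂halfPlaneMeasure (α 0)) ^ p ∂halfPlaneMeasure (α 0) ≤
        (halfPlaneConst (α 0) p q * (c₁ * A) ^ max p q) ^ p *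
          ∫⁻ u, W u y ^ p ∂halfPlaneMeasure (α 0) := by
      intro y hy
      refine lintegral_modKernel_weighted_le (hα 0) hpq (hfm.comp (hcy y)).enorm
        (hfim.comp (hcy y)).enorm
        (fun x hx => enorm_mul_enorm_inv (hf0 _ (cons_mem_tube.2 ⟨hx, hy⟩)))
        (ENNReal.mul_ne_top hc₁T hA) (fun u hu => ?_)
        (hWm.comp (measurable_id.prodMk measurable_const))
      have hu0 : 0 < u.im := hu
      have h1 := halfPlaneKernelNorm_slice_mul_le hα hpq hfm hf hfim hfi hAw hu hy
      have h2 : ENNReal.ofReal (u.im ^ (2 + α 0)) * ENNReal.ofReal (u.im ^ (-(2 + α 0))) = 1 := by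
        rw [← ENNReal.ofReal_mul (by positivity), ← Real.rpow_add hu0]
        simp
      calc halfPlaneKernelNorm p (α 0) u (fun x => ‖f (Fin.cons x y)‖ₑ) *
            halfPlaneKernelNorm q (α 0) u (fun x => ‖(f (Fin.cons x y))⁻¹‖ₑ)
          = (halfPlaneKernelNorm p (α 0) u (fun x => ‖f (Fin.cons x y)‖ₑ) *
            halfPlaneKernelNorm q (α 0) u (fun x => ‖(f (Fin.cons x y))⁻¹‖ₑ) *
              ENNReal.ofReal (u.im ^ (2 + α 0))) * ENNReal.ofReal (u.im ^ (-(2 + α 0))) := by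
            rw [mul_assoc _ (ENNReal.ofReal (u.im ^ (2 + α 0))), h2, mul_one]
        _ ≤ _ := mul_le_mul' h1 le_rfl
    have hm : Measurable fun z : Fin (n + 1) → ℂ =>
        (‖f z‖ₑ * ∫⁻ w, modTube α z w * (‖(f w)⁻¹‖ₑ * U w) ∂tubeMeasure α) ^ p := by
      refine Measurable.pow_const (hfm.enorm.mul ?_) p
      refine Measurable.lintegral_prod_right' (f := fun x : (Fin (n + 1) → ℂ) × (Fin (n + 1) → ℂ) =>
        modTube α x.1 x.2 * (‖(f x.2)⁻¹‖ₑ * U x.2)) ?_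
      exact (measurable_modTube α).mul
        ((hfim.comp measurable_snd).enorm.mul (hU.comp measurable_snd))
    have hNT : (halfPlaneConst (α 0) p q * (c₁ * A) ^ max p q) ^ p ≠ ∞ :=
      ENNReal.rpow_ne_top_of_nonneg hp0.le (ENNReal.mul_ne_top (halfPlaneConst_ne_top hpq)
        (ENNReal.rpow_ne_top_of_nonneg hM (ENNReal.mul_ne_top hc₁T hA)))
    have hCT : (C * (c₂ * A) ^ ((n : ℝ) * max p q)) ^ p ≠ ∞ :=
      ENNReal.rpow_ne_top_of_nonneg hp0.le (ENNReal.mul_ne_top hC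
        (ENNReal.rpow_ne_top_of_nonneg hnM (ENNReal.mul_ne_top hc₂T hA)))
    rw [lintegral_tubeMeasure_succ' α hm]
    calc ∫⁻ y, ∫⁻ x, (‖f (Fin.cons x y)‖ₑ * ∫⁻ w, modTube α (Fin.cons x y) w *
          (‖(f w)⁻¹‖ₑ * U w) ∂tubeMeasure α) ^ p ∂halfPlaneMeasure (α 0) ∂tubeMeasure (Fin.tail α)
        ≤ ∫⁻ y, (halfPlaneConst (α 0) p q * (c₁ * A) ^ max p q) ^ p *
          ∫⁻ u, W u y ^ p ∂halfPlaneMeasure (α 0) ∂tubeMeasure (Fin.tail α) := by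
          refine lintegral_mono_ae ?_
          filter_upwards [ae_mem_tube (Fin.tail α)] with y hy
          simp only [weighted_positive_step hfm hf0 hU _ hy]
          exact houter y hy
      _ = (halfPlaneConst (α 0) p q * (c₁ * A) ^ max p q) ^ p *
          ∫⁻ u, ∫⁻ y, W u y ^ p ∂tubeMeasure (Fin.tail α) ∂halfPlaneMeasure (α 0) := by
          rw [lintegral_const_mul' _ _ hNT, lintegral_lintegral_swap]
          exact ((hWm.comp measurable_swap).pow_const p).aemeasurable
      _ ≤ (halfPlaneConst (α 0) p q * (c₁ * A) ^ max p q) ^ p *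
          ∫⁻ u, (C * (c₂ * A) ^ ((n : ℝ) * max p q)) ^ p *
          ∫⁻ v, U (Fin.cons u v) ^ p ∂tubeMeasure (Fin.tail α) ∂halfPlaneMeasure (α 0) := by
          refine mul_le_mul' le_rfl (lintegral_mono_ae ?_)
          filter_upwards [ae_mem_halfPlane (α 0)] with u hu using hinner u hu
      _ = _ := by
          rw [lintegral_const_mul' _ _ hCT, ← lintegral_tubeMeasure_succ α (hU.pow_const p),
            ← mul_assoc, ← ENNReal.mul_rpow_of_nonneg _ _ hp0.le]
          congr 2
          rw [ENNReal.mul_rpow_of_nonneg _ _ hM, ENNReal.mul_rpow_of_nonneg _ _ hnM]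
          have : A ^ (((n + 1 : ℕ) : ℝ) * max p q) = A ^ max p q * A ^ ((n : ℝ) * max p q) := by
            rw [← ENNReal.rpow_add_of_nonneg _ _ hM hnM]
            congr 1; push_cast; ring
          rw [this]
          ring

/-! ### The normalized kernels -/

lemma eLpNorm_halfPlaneKernel {a : ℝ} (ha : -1 < a) {w : ℂ} (hw : w ∈ halfPlane) :
    eLpNorm (fun ζ => halfPlaneKernel a ζ w) 2 (halfPlaneMeasure a) =
      ENNReal.ofReal (2 ^ a * (a + 1) / Real.pi) *
        (ENNReal.ofReal (w.im ^ (2 + a)) ^ (-1 : ℝ) * modKernelMass a 2) ^ (1 / 2 : ℝ) := by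
  have hw0 : 0 < w.im := hw
  set c := ENNReal.ofReal (2 ^ a * (a + 1) / Real.pi) with hc
  have hcT : c ^ (2 : ℝ) ≠ ∞ := ENNReal.rpow_ne_top_of_nonneg (by norm_num) ENNReal.ofReal_ne_top
  have h2 : (2 : ℝ≥0∞).toReal = 2 := by simp
  rw [eLpNorm_eq_lintegral_rpow_enorm_toReal (by norm_num) (by norm_num), h2]
  simp only [enorm_halfPlaneKernel ha, ← hc, ENNReal.mul_rpow_of_nonneg _ _ zero_le_two]
  rw [lintegral_const_mul' _ _ hcT, lintegral_modKernel_rpow zero_lt_two hw,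
    ENNReal.mul_rpow_of_nonneg _ _ (by norm_num), ← ENNReal.rpow_mul,
    ENNReal.ofReal_rpow_of_pos (Real.rpow_pos_of_pos hw0 _), ← Real.rpow_mul hw0.le]
  norm_num

/-- The constant factor of the kernel cancels against the same factor in its norm, leaving half a
power of the height. -/
lemma enorm_div_eLpNorm_halfPlaneKernel {a : ℝ} (ha : -1 < a) {w : ℂ} (hw : w ∈ halfPlane) (z : ℂ) :
    ‖halfPlaneKernel a z w /
      ((eLpNorm (fun ζ => halfPlaneKernel a ζ w) 2 (halfPlaneMeasure a)).toReal : ℂ)‖ₑ =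
      modKernelMass a 2 ^ (-(1 / 2) : ℝ) * ENNReal.ofReal (w.im ^ (2 + a)) ^ (1 / 2 : ℝ) *
        modKernel a z w := by
  have hw0 : 0 < w.im := hw
  have ha1 : 0 < a + 1 := by linarith
  rw [eLpNorm_halfPlaneKernel ha hw]
  set c := ENNReal.ofReal (2 ^ a * (a + 1) / Real.pi) with hc
  set h := ENNReal.ofReal (w.im ^ (2 + a)) with hh
  set m := modKernelMass a 2 with hm
  have hc0 : c ≠ 0 := (ENNReal.ofReal_pos.2 (by positivity)).ne'
  have hcT : c ≠ ∞ := ENNReal.ofReal_ne_top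
  have hh0 : h ≠ 0 := (ENNReal.ofReal_pos.2 (by positivity)).ne'
  have hhT : h ≠ ∞ := ENNReal.ofReal_ne_top
  have hm0 : m ≠ 0 := modKernelMass_ne_zero a 2
  have hmT : m ≠ ∞ := modKernelMass_ne_top ha (by norm_num)
  have e1 : (h ^ (-1 : ℝ) * m) ^ (1 / 2 : ℝ) = (m ^ (-(1 / 2) : ℝ) * h ^ (1 / 2 : ℝ))⁻¹ := by
    rw [ENNReal.mul_rpow_of_nonneg _ _ (by norm_num), ← ENNReal.rpow_mul, ENNReal.mul_inv,
      ← ENNReal.rpow_neg, ← ENNReal.rpow_neg, neg_neg, mul_comm]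
    · norm_num
    · exact Or.inr (ENNReal.rpow_ne_top_of_nonneg (by norm_num) hhT)
    · left
      exact ENNReal.rpow_ne_top_of_ne_zero hm0 hmT
  rw [e1]
  set d := m ^ (-(1 / 2) : ℝ) * h ^ (1 / 2 : ℝ) with hd
  have hd0 : d ≠ 0 := mul_ne_zero (ENNReal.rpow_pos (pos_iff_ne_zero.2 hm0) hmT).ne'
    (ENNReal.rpow_pos (pos_iff_ne_zero.2 hh0) hhT).ne'
  have hdT : d ≠ ∞ := ENNReal.mul_ne_top (ENNReal.rpow_ne_top_of_ne_zero hm0 hmT)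
    (ENNReal.rpow_ne_top_of_nonneg (by norm_num) hhT)
  have hcd0 : c * d⁻¹ ≠ 0 := mul_ne_zero hc0 (ENNReal.inv_ne_zero.2 hdT)
  have hcdT : c * d⁻¹ ≠ ∞ := ENNReal.mul_ne_top hcT (ENNReal.inv_ne_top.2 hd0)
  have hpos : 0 < (c * d⁻¹).toReal := ENNReal.toReal_pos hcd0 hcdT
  have e2 : ‖((c * d⁻¹).toReal : ℂ)‖ₑ = c * d⁻¹ := by
    rw [← ofReal_norm, Complex.norm_real, Real.norm_of_nonneg hpos.le, ENNReal.ofReal_toReal hcdT]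
  have hne : ((c * d⁻¹).toReal : ℂ) ≠ 0 := by exact_mod_cast hpos.ne'
  rw [div_eq_mul_inv, enorm_mul, enorm_inv hne, e2, enorm_halfPlaneKernel ha, ← hc,
    ENNReal.mul_inv (Or.inl hc0) (Or.inl hcT), inv_inv]
  calc c * modKernel a z w * (c⁻¹ * d) = (c * c⁻¹) * (d * modKernel a z w) := by ring
    _ = d * modKernel a z w := by rw [ENNReal.mul_inv_cancel hc0 hcT, one_mul]

/-- The constant relating the normalized kernel to the modulus of the kernel. -/
def normalizedConst (α : Fin n → ℝ) : ℝ≥0∞ := ∏ j, modKernelMass (α j) 2 ^ (-(1 / 2) : ℝ)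

lemma normalizedConst_ne_top {α : Fin n → ℝ} (hα : ∀ j, -1 < α j) : normalizedConst α ≠ ∞ :=
  ENNReal.prod_ne_top fun j _ => ENNReal.rpow_ne_top_of_ne_zero (modKernelMass_ne_zero _ _)
    (modKernelMass_ne_top (hα j) (by norm_num))

lemma normalizedConst_ne_zero {α : Fin n → ℝ} (hα : ∀ j, -1 < α j) : normalizedConst α ≠ 0 :=
  Finset.prod_ne_zero_iff.2 fun j _ => (ENNReal.rpow_pos
    (pos_iff_ne_zero.2 (modKernelMass_ne_zero _ _)) (modKernelMass_ne_top (hα j) (by norm_num))).ne'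

lemma enorm_normalizedKernel {α : Fin n → ℝ} (hα : ∀ j, -1 < α j) {w : Fin n → ℂ} (hw : w ∈ tube n)
    (z : Fin n → ℂ) :
    ‖normalizedKernel α w z‖ₑ =
      normalizedConst α * tubeHeight α w ^ (1 / 2 : ℝ) * modTube α z w := by
  rw [normalizedKernel, enorm_prod_eq, normalizedConst, tubeHeight, modTube,
    ← ENNReal.prod_rpow_of_nonneg (by norm_num), ← Finset.prod_mul_distrib,
    ← Finset.prod_mul_distrib]
  exact Finset.prod_congr rfl fun j _ => enorm_div_eLpNorm_halfPlaneKernel (hα j) (hw j) _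

lemma tubeNorm_eq {p : ℝ} (hp : 0 < p) (α : Fin n → ℝ) (f : (Fin n → ℂ) → ℂ) :
    tubeNorm p α f = (∫⁻ z, ‖f z‖ₑ ^ p ∂tubeMeasure α) ^ (1 / p) := by
  rw [tubeNorm, eLpNorm_eq_lintegral_rpow_enorm_toReal (ENNReal.ofReal_pos.2 hp).ne'
    ENNReal.ofReal_ne_top, ENNReal.toReal_ofReal hp.le]

lemma tubeNorm_mul_normalizedKernel {α : Fin n → ℝ} (hα : ∀ j, -1 < α j) {p : ℝ} (hp : 0 < p)
    {w : Fin n → ℂ} (hw : w ∈ tube n) (f : (Fin n → ℂ) → ℂ) :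
    tubeNorm p α (fun z => f z * normalizedKernel α w z) =
      normalizedConst α * tubeHeight α w ^ (1 / 2 : ℝ) * kernelNorm p α w fun z => ‖f z‖ₑ := by
  set d := normalizedConst α * tubeHeight α w ^ (1 / 2 : ℝ) with hd
  have hdT : d ≠ ∞ := ENNReal.mul_ne_top (normalizedConst_ne_top hα)
    (ENNReal.rpow_ne_top_of_nonneg (by norm_num) (tubeHeight_ne_top α w))
  rw [tubeNorm_eq hp, kernelNorm]
  have : ∀ z, ‖f z * normalizedKernel α w z‖ₑ ^ p = d ^ p * (‖f z‖ₑ * modTube α z w) ^ p := fun z => by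
    rw [enorm_mul, enorm_normalizedKernel hα hw, ← hd, ← ENNReal.mul_rpow_of_nonneg _ _ hp.le]
    congr 1; ring
  simp only [this]
  rw [lintegral_const_mul' _ _ (ENNReal.rpow_ne_top_of_nonneg hp.le hdT),
    ENNReal.mul_rpow_of_nonneg _ _ (by positivity), ← ENNReal.rpow_mul,
    mul_one_div_cancel hp.ne', ENNReal.rpow_one]

/-- The dictionary between normalized kernels and bare moduli: each normalized kernel carries half a
power of the height, whatever the exponent of the norm. -/
lemma tubeNorm_mul_tubeNorm {α : Fin n → ℝ} (hα : ∀ j, -1 < α j) {p q : ℝ} (hp : 0 < p) (hq : 0 < q)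
    {w : Fin n → ℂ} (hw : w ∈ tube n) (f g : (Fin n → ℂ) → ℂ) :
    tubeNorm p α (fun z => f z * normalizedKernel α w z) *
      tubeNorm q α (fun z => g z * normalizedKernel α w z) =
      normalizedConst α ^ 2 * (kernelNorm p α w (fun z => ‖f z‖ₑ) *
        kernelNorm q α w (fun z => ‖g z‖ₑ) * tubeHeight α w) := by
  rw [tubeNorm_mul_normalizedKernel hα hp hw, tubeNorm_mul_normalizedKernel hα hq hw]
  have h : tubeHeight α w ^ (1 / 2 : ℝ) * tubeHeight α w ^ (1 / 2 : ℝ) = tubeHeight α w := by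
    rw [← ENNReal.rpow_add_of_nonneg _ _ (by norm_num) (by norm_num)]
    norm_num
  conv_rhs => rw [← h]
  ring

lemma kernelNorm_mul_le_sarasonConst {α : Fin n → ℝ} (hα : ∀ j, -1 < α j) {p q : ℝ} (hp : 0 < p)
    (hq : 0 < q) {w : Fin n → ℂ} (hw : w ∈ tube n) (f g : (Fin n → ℂ) → ℂ) :
    kernelNorm p α w (fun z => ‖f z‖ₑ) * kernelNorm q α w (fun z => ‖g z‖ₑ) * tubeHeight α w ≤
      (normalizedConst α ^ 2)⁻¹ * sarasonConst p q α f g := by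
  have hd0 : normalizedConst α ^ 2 ≠ 0 := pow_ne_zero _ (normalizedConst_ne_zero hα)
  have hdT : normalizedConst α ^ 2 ≠ ∞ := ENNReal.pow_ne_top (normalizedConst_ne_top hα)
  have h1 : tubeNorm p α (fun z => f z * normalizedKernel α w z) *
      tubeNorm q α (fun z => g z * normalizedKernel α w z) ≤ sarasonConst p q α f g :=
    le_iSup₂ (f := fun w (_ : w ∈ tube n) => tubeNorm p α (fun z => f z * normalizedKernel α w z) *
      tubeNorm q α (fun z => g z * normalizedKernel α w z)) w hw
  rw [tubeNorm_mul_tubeNorm hα hp hq hw] at h1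
  calc _ = (normalizedConst α ^ 2)⁻¹ * (normalizedConst α ^ 2 * (kernelNorm p α w (fun z => ‖f z‖ₑ) *
        kernelNorm q α w (fun z => ‖g z‖ₑ) * tubeHeight α w)) := by
        rw [← mul_assoc, ENNReal.inv_mul_cancel hd0 hdT, one_mul]
    _ ≤ _ := mul_le_mul' le_rfl h1

lemma sarasonConst_le {α : Fin n → ℝ} (hα : ∀ j, -1 < α j) {p q : ℝ} (hp : 0 < p)
    (hq : 0 < q) (f g : (Fin n → ℂ) → ℂ) {B : ℝ≥0∞}
    (h : ∀ w ∈ tube n, kernelNorm p α w (fun z => ‖f z‖ₑ) * kernelNorm q α w (fun z => ‖g z‖ₑ) *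
      tubeHeight α w ≤ B) :
    sarasonConst p q α f g ≤ normalizedConst α ^ 2 * B := by
  refine iSup₂_le fun w hw => ?_
  rw [tubeNorm_mul_tubeNorm hα hp hq hw]
  exact mul_le_mul' le_rfl (h w hw)

/-- The pointwise bound for `f g` by the Sarason constant. -/
lemma enorm_mul_enorm_le_sarasonConst {α : Fin n → ℝ} (hα : ∀ j, -1 < α j) {p q : ℝ}
    (hpq : p.HolderConjugate q) {f g : (Fin n → ℂ) → ℂ} (hf : DifferentiableOn ℂ f (tube n))
    (hg : DifferentiableOn ℂ g (tube n)) {w : Fin n → ℂ} (hw : w ∈ tube n) :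
    ‖f w‖ₑ * ‖g w‖ₑ ≤ pointwiseConst α q * pointwiseConst α p * (normalizedConst α ^ 2)⁻¹ *
      sarasonConst p q α f g := by
  have h1 := enorm_le_kernelNorm hα hpq hf hw
  have h2 := enorm_le_kernelNorm hα hpq.symm hg hw
  have h3 := kernelNorm_mul_le_sarasonConst hα hpq.pos hpq.symm.pos hw f g
  have hY := rpow_conj_mul hpq (tubeHeight_ne_zero α hw) (tubeHeight_ne_top α w)
  calc _ ≤ _ := mul_le_mul' h1 h2
    _ = pointwiseConst α q * pointwiseConst α p * (kernelNorm p α w (fun z => ‖f z‖ₑ) *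
        kernelNorm q α w (fun z => ‖g z‖ₑ) * tubeHeight α w) := by
        conv_rhs => rw [← hY]
        ring
    _ ≤ _ := by rw [mul_assoc _ (normalizedConst α ^ 2)⁻¹]; exact mul_le_mul' le_rfl h3

/-! ### Holomorphy of the Bergman projection -/

lemma hasDerivAt_halfPlaneKernel (a : ℝ) {z w : ℂ} (hz : z ∈ halfPlane) (hw : w ∈ halfPlane) :
    HasDerivAt (fun z => halfPlaneKernel a z w)
      ((-(2 + a) / (z - conj w)) * halfPlaneKernel a z w) z := by
  have hz0 : 0 < z.im := hz
  have hw0 : 0 < w.im := hw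
  have hne : z - conj w ≠ 0 := norm_pos_iff.1 (norm_sub_conj_pos hz hw)
  have h1 : HasDerivAt (fun z : ℂ => (z - conj w) / Complex.I) (1 / Complex.I) z :=
    ((hasDerivAt_id' z).sub_const (conj w)).div_const Complex.I
  have hs : (z - conj w) / Complex.I ∈ Complex.slitPlane := by
    left
    have : ((z - conj w) / Complex.I).re = z.im + w.im := by simp [Complex.div_I]
    rw [this]; linarith
  have h2 := (h1.cpow_const (c := ((-(2 + a) : ℝ) : ℂ)) hs).const_mul
    ((2 ^ a * (a + 1) / Real.pi : ℝ) : ℂ)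
  unfold halfPlaneKernel
  convert! h2 using 1
  have hb : (z - conj w) / Complex.I ≠ 0 := div_ne_zero hne Complex.I_ne_zero
  rw [Complex.cpow_sub _ _ hb, Complex.cpow_one]
  push_cast
  field_simp

/-- The differential of the kernel divided by the kernel. -/
def logDifferential (α : Fin n → ℝ) (s : Finset (Fin n)) (z w : Fin n → ℂ) : (Fin n → ℂ) →L[ℂ] ℂ :=
  ∑ j ∈ s, (-(2 + (α j : ℂ)) / (z j - conj (w j))) • ContinuousLinearMap.proj (R := ℂ) j

lemma hasFDerivAt_prod_halfPlaneKernel (α : Fin n → ℝ) {z w : Fin n → ℂ} (hz : z ∈ tube n)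
    (hw : w ∈ tube n) (s : Finset (Fin n)) :
    HasFDerivAt (fun z : Fin n → ℂ => ∏ j ∈ s, halfPlaneKernel (α j) (z j) (w j))
      ((∏ j ∈ s, halfPlaneKernel (α j) (z j) (w j)) • logDifferential α s z w) z := by
  induction s using Finset.induction_on with
  | empty => simpa [logDifferential] using hasFDerivAt_const (1 : ℂ) z
  | insert i s hi ih =>
    simp only [Finset.prod_insert hi, logDifferential, Finset.sum_insert hi]
    have h1 : HasFDerivAt (fun z : Fin n → ℂ => halfPlaneKernel (α i) (z i) (w i))
        (((-(2 + (α i : ℂ)) / (z i - conj (w i))) * halfPlaneKernel (α i) (z i) (w i)) •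
          ContinuousLinearMap.proj (R := ℂ) (φ := fun _ : Fin n => ℂ) i) z :=
      HasDerivAt.comp_hasFDerivAt (h₂ := fun x => halfPlaneKernel (α i) x (w i))
        (f := fun z : Fin n → ℂ => z i) z (hasDerivAt_halfPlaneKernel (α i) (hz i) (hw i))
        (ContinuousLinearMap.proj (R := ℂ) (φ := fun _ : Fin n => ℂ) i).hasFDerivAt
    refine (h1.mul ih).congr_fderiv ?_
    simp only [logDifferential]
    module

/-- Since `‖z₀ - conj w‖` is at least `z₀.im`, a displacement of `z₀` by less than `z₀.im / 2`
changes it by less than half of itself, uniformly in `w`. Kernels at nearby points are therefore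
dominated by the kernel at `z₀`. -/
lemma norm_sub_conj_le_two_mul {z z₀ w : ℂ} (hz₀ : z₀ ∈ halfPlane) (hw : w ∈ halfPlane)
    (h : ‖z - z₀‖ < z₀.im / 2) : ‖z₀ - conj w‖ ≤ 2 * ‖z - conj w‖ := by
  have h0 : 0 < z₀.im := hz₀
  have h1 : 0 < w.im := hw
  have h2 := im_add_im_le_norm z₀ w
  have h3 : ‖z₀ - conj w‖ ≤ ‖z - conj w‖ + ‖z - z₀‖ := by
    have := norm_sub_le (z - conj w) (z - z₀)
    rwa [show z - conj w - (z - z₀) = z₀ - conj w by ring] at this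
  linarith

lemma modKernel_le_of_near {a : ℝ} (ha : -1 < a) {z z₀ w : ℂ} (hz₀ : z₀ ∈ halfPlane)
    (hw : w ∈ halfPlane) (h : ‖z - z₀‖ < z₀.im / 2) :
    modKernel a z w ≤ ENNReal.ofReal (2 ^ (2 + a)) * modKernel a z₀ w := by
  have h1 := norm_sub_conj_le_two_mul hz₀ hw h
  have h2 := norm_sub_conj_pos hz₀ hw
  rw [modKernel, modKernel, ← ENNReal.ofReal_mul (by positivity)]
  refine ENNReal.ofReal_le_ofReal ?_
  calc ‖z - conj w‖ ^ (-(2 + a)) ≤ (‖z₀ - conj w‖ / 2) ^ (-(2 + a)) :=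
        Real.rpow_le_rpow_of_nonpos (by positivity) (by linarith) (by linarith)
    _ = _ := by
        rw [Real.div_rpow h2.le (by norm_num), Real.rpow_neg (by norm_num : (0 : ℝ) ≤ 2)]
        field_simp

lemma norm_tubeKernel_le_of_near {α : Fin n → ℝ} (hα : ∀ j, -1 < α j) {z z₀ w : Fin n → ℂ}
    (hz₀ : z₀ ∈ tube n) (hw : w ∈ tube n) (h : ∀ j, ‖z j - z₀ j‖ < (z₀ j).im / 2) :
    ‖tubeKernel α z w‖ ≤ (∏ j, (2 : ℝ) ^ (2 + α j)) * ‖tubeKernel α z₀ w‖ := by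
  have h1 : ‖tubeKernel α z w‖ₑ ≤ (∏ j, ENNReal.ofReal ((2 : ℝ) ^ (2 + α j))) *
      ‖tubeKernel α z₀ w‖ₑ := by
    rw [enorm_tubeKernel hα, enorm_tubeKernel hα, mul_left_comm]
    refine mul_le_mul' le_rfl ?_
    rw [modTube, modTube, ← Finset.prod_mul_distrib]
    exact Finset.prod_le_prod' fun j _ => modKernel_le_of_near (hα j) (hz₀ j) (hw j) (h j)
  rw [← ENNReal.ofReal_prod_of_nonneg (fun _ _ => by positivity), ← ofReal_norm, ← ofReal_norm,
    ← ENNReal.ofReal_mul (Finset.prod_nonneg fun _ _ => by positivity)] at h1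
  refine (ENNReal.ofReal_le_ofReal_iff ?_).1 h1
  exact mul_nonneg (Finset.prod_nonneg fun _ _ => by positivity) (norm_nonneg _)

lemma norm_logDifferential_le {α : Fin n → ℝ} (hα : ∀ j, -1 < α j) {z z₀ w : Fin n → ℂ}
    (hz₀ : z₀ ∈ tube n) (hw : w ∈ tube n) (h : ∀ j, ‖z j - z₀ j‖ < (z₀ j).im / 2) :
    ‖logDifferential α Finset.univ z w‖ ≤ ∑ j, (2 + α j) * (2 / (z₀ j).im) := by
  refine (norm_sum_le _ _).trans (Finset.sum_le_sum fun j _ => ?_)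
  have hz0 : 0 < (z₀ j).im := hz₀ j
  have hw0 : 0 < (w j).im := hw j
  have h1 := norm_sub_conj_le_two_mul (hz₀ j) (hw j) (h j)
  have h2 := im_add_im_le_norm (z₀ j) (w j)
  have h3 : (z₀ j).im / 2 ≤ ‖z j - conj (w j)‖ := by linarith
  have ha : 0 ≤ 2 + α j := by linarith [hα j]
  have hp : ‖(ContinuousLinearMap.proj (R := ℂ) (φ := fun _ : Fin n => ℂ) j)‖ ≤ 1 := by
    refine ContinuousLinearMap.opNorm_le_bound _ zero_le_one fun x => ?_
    simpa using norm_le_pi_norm x j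
  have hc : ‖-(2 + (α j : ℂ)) / (z j - conj (w j))‖ ≤ (2 + α j) * (2 / (z₀ j).im) := by
    have : -(2 + (α j : ℂ)) = ((-(2 + α j) : ℝ) : ℂ) := by push_cast; ring
    rw [norm_div, this, Complex.norm_real, Real.norm_eq_abs, abs_neg, abs_of_nonneg ha,
      div_eq_mul_inv]
    refine mul_le_mul_of_nonneg_left ?_ ha
    rw [← inv_div]
    exact inv_anti₀ (by positivity) h3
  calc _ ≤ ‖-(2 + (α j : ℂ)) / (z j - conj (w j))‖ *
        ‖(ContinuousLinearMap.proj (R := ℂ) (φ := fun _ : Fin n => ℂ) j)‖ := norm_smul_le _ _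
    _ ≤ (2 + α j) * (2 / (z₀ j).im) * 1 := mul_le_mul hc hp (norm_nonneg _) (by positivity)
    _ = _ := mul_one _

lemma measurable_tubeKernel_right (α : Fin n → ℝ) (z : Fin n → ℂ) :
    Measurable fun w => tubeKernel α z w := by
  unfold tubeKernel halfPlaneKernel
  refine Finset.measurable_fun_prod _ fun j _ => ?_
  fun_prop

/-- Differentiation under the integral sign. Near `z₀` the differential of the kernel is the kernel
times a bounded logarithmic differential, and the kernel is at most a constant times its value at
`z₀`; absolute convergence at `z₀` thus provides the dominating function. -/
theorem differentiableOn_integral_tubeKernel {α : Fin n → ℝ} (hα : ∀ j, -1 < α j)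
    {Ψ : (Fin n → ℂ) → ℂ} (hΨ : AEStronglyMeasurable Ψ (tubeMeasure α))
    (hint : ∀ z ∈ tube n, Integrable (fun w => tubeKernel α z w * Ψ w) (tubeMeasure α)) :
    DifferentiableOn ℂ (fun z => ∫ w, tubeKernel α z w * Ψ w ∂tubeMeasure α) (tube n) := by
  intro z₀ hz₀
  refine DifferentiableAt.differentiableWithinAt ?_
  set s : Set (Fin n → ℂ) := univ.pi fun j => Metric.ball (z₀ j) ((z₀ j).im / 2) with hs
  have hsn : s ∈ nhds z₀ := set_pi_mem_nhds finite_univ fun j _ =>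
    Metric.ball_mem_nhds _ (by have : 0 < (z₀ j).im := hz₀ j; positivity)
  have hs' : ∀ z ∈ s, ∀ j, ‖z j - z₀ j‖ < (z₀ j).im / 2 := fun z hz j => by
    have := hz j (mem_univ j)
    rwa [mem_ball_iff_norm] at this
  have hst : ∀ z ∈ s, z ∈ tube n := fun z hz j => by
    have h0 : 0 < (z₀ j).im := hz₀ j
    have h1 := (Complex.abs_im_le_norm (z j - z₀ j)).trans_lt (hs' z hz j)
    rw [Complex.sub_im, abs_lt] at h1
    linarith [h1.1]
  set B : ℝ := (∏ j, (2 : ℝ) ^ (2 + α j)) * ∑ j, (2 + α j) * (2 / (z₀ j).im) with hB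
  have key := hasFDerivAt_integral_of_dominated_of_fderiv_le (𝕜 := ℂ) (μ := tubeMeasure α)
    (F := fun z w => tubeKernel α z w * Ψ w)
    (F' := fun z w => (tubeKernel α z w * Ψ w) • logDifferential α Finset.univ z w)
    (bound := fun w => B * ‖tubeKernel α z₀ w * Ψ w‖) hsn ?_ (hint z₀ hz₀) ?_ ?_
    ((hint z₀ hz₀).norm.const_mul B) ?_
  · exact key.differentiableAt
  · exact Eventually.of_forall fun z => (measurable_tubeKernel_right α z).aestronglyMeasurable.mul hΨ
  · refine ((measurable_tubeKernel_right α z₀).aestronglyMeasurable.mul hΨ).smul ?_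
    unfold logDifferential
    refine Finset.aestronglyMeasurable_fun_sum _ fun j _ => ?_
    have : Measurable fun w : Fin n → ℂ => -(2 + (α j : ℂ)) / (z₀ j - conj (w j)) := by fun_prop
    exact this.aestronglyMeasurable.smul_const _
  · filter_upwards [ae_mem_tube α] with w hw z hz
    have h1 := norm_tubeKernel_le_of_near hα hz₀ hw (hs' z hz)
    have h2 := norm_logDifferential_le hα hz₀ hw (hs' z hz)
    rw [norm_smul, norm_mul, norm_mul]
    have h3 : 0 ≤ ∏ j, (2 : ℝ) ^ (2 + α j) := Finset.prod_nonneg fun _ _ => by positivity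
    calc ‖tubeKernel α z w‖ * ‖Ψ w‖ * ‖logDifferential α Finset.univ z w‖
        ≤ ((∏ j, (2 : ℝ) ^ (2 + α j)) * ‖tubeKernel α z₀ w‖) * ‖Ψ w‖ *
          ∑ j, (2 + α j) * (2 / (z₀ j).im) := by gcongr
      _ = _ := by rw [hB]; ring
  · filter_upwards [ae_mem_tube α] with w hw z hz
    have h1 := (hasFDerivAt_prod_halfPlaneKernel α (hst z hz) hw Finset.univ).mul_const (Ψ w)
    refine h1.congr_fderiv ?_
    rw [smul_smul, mul_comm]
    rfl

/-! ### Boundedness of Toeplitz products -/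

lemma kernelNorm_congr {p : ℝ} {α : Fin n → ℝ} {w : Fin n → ℂ} {F G : (Fin n → ℂ) → ℝ≥0∞}
    (h : F =ᵐ[tubeMeasure α] G) : kernelNorm p α w F = kernelNorm p α w G := by
  unfold kernelNorm
  congr 1
  refine lintegral_congr_ae ?_
  filter_upwards [h] with z hz
  rw [hz]

/-- The two-weight estimate for functions that are measurable only up to null sets. -/
theorem exists_lintegral_modTube_weighted_le_of_aemeasurable {p q : ℝ} (hpq : p.HolderConjugate q)
    {α : Fin n → ℝ} (hα : ∀ j, -1 < α j) :
    ∃ C : ℝ≥0∞, C ≠ ∞ ∧ ∀ f : (Fin n → ℂ) → ℂ, DifferentiableOn ℂ f (tube n) →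
      (∀ z ∈ tube n, f z ≠ 0) → ∀ A : ℝ≥0∞, A ≠ ∞ →
      (∀ w ∈ tube n, kernelNorm p α w (fun z => ‖f z‖ₑ) *
        kernelNorm q α w (fun z => ‖(f z)⁻¹‖ₑ) * tubeHeight α w ≤ A) →
      ∀ U : (Fin n → ℂ) → ℝ≥0∞, AEMeasurable U (tubeMeasure α) →
        ∫⁻ z, (‖f z‖ₑ * ∫⁻ w, modTube α z w * (‖(f w)⁻¹‖ₑ * U w) ∂tubeMeasure α) ^ p
          ∂tubeMeasure α ≤ (C * A ^ ((n : ℝ) * max p q)) ^ p * ∫⁻ z, U z ^ p ∂tubeMeasure α := by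
  obtain ⟨C, hC, H⟩ := exists_lintegral_modTube_weighted_le hpq n α hα
  refine ⟨C, hC, fun f hf hf0 A hA hA' U hU => ?_⟩
  classical
  set f' := (tube n).indicator f with hf'
  have hff : ∀ z ∈ tube n, f' z = f z := fun z hz => indicator_of_mem hz f
  have hfae : ∀ᵐ z ∂tubeMeasure α, f' z = f z := by
    filter_upwards [ae_mem_tube α] with z hz using hff z hz
  have hm : Measurable f' := by
    rw [hf', ← piecewise_eq_indicator]
    exact hf.continuousOn.measurable_piecewise continuousOn_const (measurableSet_tube n)
  have key := H f' hm (hf.congr hff) (fun z hz => by rw [hff z hz]; exact hf0 z hz) A hA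
    (fun w hw => by
      rw [kernelNorm_congr (F := fun z => ‖f' z‖ₑ) (G := fun z => ‖f z‖ₑ),
        kernelNorm_congr (F := fun z => ‖(f' z)⁻¹‖ₑ) (G := fun z => ‖(f z)⁻¹‖ₑ)]
      · exact hA' w hw
      · filter_upwards [hfae] with z hz using by rw [hz]
      · filter_upwards [hfae] with z hz using by rw [hz]) (hU.mk U) hU.measurable_mk
  refine (le_of_eq ?_).trans (key.trans (le_of_eq ?_))
  · refine lintegral_congr_ae ?_
    filter_upwards [hfae] with z hz
    rw [hz]
    congr 2
    refine lintegral_congr_ae ?_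
    filter_upwards [hfae, hU.ae_eq_mk] with w hw hw'
    rw [hw, ← hw']
  · congr 1
    refine lintegral_congr_ae ?_
    filter_upwards [hU.ae_eq_mk] with z hz
    rw [hz]

lemma lintegral_modTube_mul_le {p q : ℝ} (hpq : p.HolderConjugate q) (α : Fin n → ℝ)
    (z : Fin n → ℂ) {W U : (Fin n → ℂ) → ℝ≥0∞} (hW : AEMeasurable W (tubeMeasure α))
    (hU : AEMeasurable U (tubeMeasure α)) :
    ∫⁻ w, modTube α z w * (W w * U w) ∂tubeMeasure α ≤
      kernelNorm q α z W * (∫⁻ w, U w ^ p ∂tubeMeasure α) ^ (1 / p) := by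
  have h := ENNReal.lintegral_mul_le_Lp_mul_Lq (tubeMeasure α) hpq.symm
    (hW.mul (measurable_modTube_left α z).aemeasurable) hU
  refine (le_of_eq (lintegral_congr fun w => ?_)).trans h
  simp only [Pi.mul_apply]
  rw [modTube_comm]
  ring

lemma integrable_tubeKernel_mul {α : Fin n → ℝ} (hα : ∀ j, -1 < α j) {z : Fin n → ℂ}
    {Ψ : (Fin n → ℂ) → ℂ} (hΨ : AEStronglyMeasurable Ψ (tubeMeasure α))
    (h : ∫⁻ w, modTube α z w * ‖Ψ w‖ₑ ∂tubeMeasure α ≠ ∞) :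
    Integrable (fun w => tubeKernel α z w * Ψ w) (tubeMeasure α) := by
  refine ⟨(measurable_tubeKernel_right α z).aestronglyMeasurable.mul hΨ, ?_⟩
  rw [HasFiniteIntegral]
  simp only [enorm_mul, enorm_tubeKernel hα, mul_assoc]
  rw [lintegral_const_mul' _ _ (tubeKernelConst_ne_top α)]
  exact ENNReal.mul_lt_top (tubeKernelConst_ne_top α).lt_top h.lt_top

lemma enorm_integral_tubeKernel_mul_le {α : Fin n → ℝ} (hα : ∀ j, -1 < α j) (z : Fin n → ℂ)
    (Ψ : (Fin n → ℂ) → ℂ) :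
    ‖∫ w, tubeKernel α z w * Ψ w ∂tubeMeasure α‖ₑ ≤
      tubeKernelConst α * ∫⁻ w, modTube α z w * ‖Ψ w‖ₑ ∂tubeMeasure α := by
  refine (enorm_integral_le_lintegral_enorm _).trans (le_of_eq ?_)
  simp only [enorm_mul, enorm_tubeKernel hα, mul_assoc]
  rw [lintegral_const_mul' _ _ (tubeKernelConst_ne_top α)]

lemma kernelNorm_one_ne_top {q : ℝ} (hq : 1 < q) {α : Fin n → ℝ} (hα : ∀ j, -1 < α j)
    {z : Fin n → ℂ} (hz : z ∈ tube n) : kernelNorm q α z (fun _ => 1) ≠ ∞ := by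
  have hq0 : 0 < q := zero_lt_one.trans hq
  simp only [kernelNorm, one_mul]
  rw [lintegral_modTube_rpow α hq0 hz]
  refine ENNReal.rpow_ne_top_of_nonneg (by positivity) (ENNReal.mul_ne_top
    (ENNReal.rpow_ne_top_of_ne_zero (tubeHeight_ne_zero α hz) (tubeHeight_ne_top α z))
    (ENNReal.prod_ne_top fun j _ => modKernelMass_ne_top (hα j) hq))

lemma MemBergman.lintegral_ne_top {p : ℝ} (hp : 0 < p) {α : Fin n → ℝ} {h : (Fin n → ℂ) → ℂ}
    (hh : MemBergman p α h) : (∫⁻ w, ‖h w‖ₑ ^ p ∂tubeMeasure α) ^ (1 / p) ≠ ∞ := by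
  rw [← tubeNorm_eq hp]
  exact hh.2.2.ne

lemma lintegral_modTube_mul_enorm_le {p q : ℝ} (hpq : p.HolderConjugate q) (α : Fin n → ℝ)
    (z : Fin n → ℂ) {h : (Fin n → ℂ) → ℂ} (hh : AEStronglyMeasurable h (tubeMeasure α)) :
    ∫⁻ w, modTube α z w * ‖h w‖ₑ ∂tubeMeasure α ≤
      kernelNorm q α z (fun _ => 1) * tubeNorm p α h := by
  have := lintegral_modTube_mul_le hpq α z (W := fun _ => 1) aemeasurable_const hh.enorm
  simpa only [one_mul, ← tubeNorm_eq hpq.pos] using this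

lemma MemBergman.lintegral_modTube_ne_top {p q : ℝ} (hpq : p.HolderConjugate q)
    {α : Fin n → ℝ} (hα : ∀ j, -1 < α j) {h : (Fin n → ℂ) → ℂ}
    (hh : MemBergman p α h) {z : Fin n → ℂ} (hz : z ∈ tube n) :
    ∫⁻ w, modTube α z w * ‖h w‖ₑ ∂tubeMeasure α ≠ ∞ :=
  ne_top_of_le_ne_top (ENNReal.mul_ne_top (kernelNorm_one_ne_top hpq.symm.lt hα hz) hh.2.2.ne)
    (lintegral_modTube_mul_enorm_le hpq α z hh.2.1)

/-- A holomorphic function for which the kernel integrals converge is fixed by the projection. -/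
lemma toeplitz_eq {α : Fin n → ℝ} (hα : ∀ j, -1 < α j) {F u : (Fin n → ℂ) → ℂ}
    (hF : DifferentiableOn ℂ F (tube n)) (hu : DifferentiableOn ℂ u (tube n))
    (h : ToeplitzDefined α F u) {z : Fin n → ℂ} (hz : z ∈ tube n) :
    toeplitz α F u z = F z * u z :=
  integral_tubeKernel_mul hα (hF.mul hu) hz (h z hz)

theorem differentiableOn_toeplitz {α : Fin n → ℝ} (hα : ∀ j, -1 < α j) {φ h : (Fin n → ℂ) → ℂ}
    (hφ : AEStronglyMeasurable φ (tubeMeasure α)) (hh : AEStronglyMeasurable h (tubeMeasure α))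
    (H : ToeplitzDefined α φ h) : DifferentiableOn ℂ (toeplitz α φ h) (tube n) :=
  differentiableOn_integral_tubeKernel hα (hφ.mul hh) H

lemma kernelNorm_ne_zero {α : Fin n → ℝ} (hα : ∀ j, -1 < α j) {p q : ℝ}
    (hpq : p.HolderConjugate q) {f : (Fin n → ℂ) → ℂ} (hf : DifferentiableOn ℂ f (tube n))
    (hf0 : ∀ z ∈ tube n, f z ≠ 0) {w : Fin n → ℂ} (hw : w ∈ tube n) :
    kernelNorm p α w (fun z => ‖f z‖ₑ) ≠ 0 := fun h => by
  have h1 := enorm_le_kernelNorm hα hpq hf hw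
  rw [h, mul_zero, nonpos_iff_eq_zero, enorm_eq_zero] at h1
  exact hf0 w hw h1

/-- The pointwise bound `|F P(Ḡ h)| ≤ c D E |φ| P⁺(|φ|⁻¹ |h|)` reduces the claim to the weighted
estimate. The separate weight `φ` lets one statement serve both products: `φ = f` for `T_f T_ḡ` on
`A^p`, and `φ = f⁻¹` for `T_g T_f̄` on `A^q` with the exponents exchanged. -/
theorem exists_toeplitzProductBoundedBy {p q : ℝ} (hpq : p.HolderConjugate q)
    {α : Fin n → ℝ} (hα : ∀ j, -1 < α j) :
    ∃ C : ℝ≥0∞, C ≠ ∞ ∧ ∀ φ F G : (Fin n → ℂ) → ℂ, DifferentiableOn ℂ φ (tube n) →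
      DifferentiableOn ℂ F (tube n) → DifferentiableOn ℂ G (tube n) →
      (∀ z ∈ tube n, φ z ≠ 0) → ∀ A : ℝ≥0∞, A ≠ ∞ →
      (∀ w ∈ tube n, kernelNorm p α w (fun z => ‖φ z‖ₑ) *
        kernelNorm q α w (fun z => ‖(φ z)⁻¹‖ₑ) * tubeHeight α w ≤ A) →
      ∀ D E : ℝ≥0∞, D ≠ ∞ → E ≠ ∞ → (∀ z ∈ tube n, ‖F z‖ₑ ≤ D * ‖φ z‖ₑ) →
      (∀ z ∈ tube n, ‖G z‖ₑ ≤ E * ‖(φ z)⁻¹‖ₑ) →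
      ∀ M : ℝ≥0, C * (D * E) * A ^ ((n : ℝ) * max p q) ≤ M →
        ToeplitzProductBoundedBy p α F G M := by
  obtain ⟨C, hC, H⟩ := exists_lintegral_modTube_weighted_le_of_aemeasurable hpq hα
  refine ⟨tubeKernelConst α * C, ENNReal.mul_ne_top (tubeKernelConst_ne_top α) hC, ?_⟩
  intro φ F G hφ hF hG hφ0 A hA hA' D E hD hE hFD hGE M hM h hh
  have hp0 := hpq.pos
  have hmφ : AEMeasurable (fun w => ‖(φ w)⁻¹‖ₑ) (tubeMeasure α) :=
    (aestronglyMeasurable_of_differentiableOn α (hφ.inv hφ0)).enorm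
  have hmG : AEStronglyMeasurable (fun w => conj (G w)) (tubeMeasure α) :=
    Complex.continuous_conj.comp_aestronglyMeasurable (aestronglyMeasurable_of_differentiableOn α hG)
  have hmh : AEMeasurable (fun w => ‖h w‖ₑ) (tubeMeasure α) := hh.2.1.enorm
  set I : (Fin n → ℂ) → ℝ≥0∞ := fun z =>
    ∫⁻ w, modTube α z w * (‖(φ w)⁻¹‖ₑ * ‖h w‖ₑ) ∂tubeMeasure α with hI
  have hIT : ∀ z ∈ tube n, I z ≠ ∞ := fun z hz => by
    refine ne_top_of_le_ne_top (ENNReal.mul_ne_top ?_ (hh.lintegral_ne_top hp0))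
      (lintegral_modTube_mul_le hpq α z hmφ hmh)
    -- An infinite norm of `φ⁻¹ κ_z` would make the product in the weight condition infinite, its
    -- other two factors being nonzero.
    intro hk
    have h1 := hA' z hz
    rw [hk, ENNReal.mul_top (kernelNorm_ne_zero hα hpq hφ hφ0 hz),
      ENNReal.top_mul (tubeHeight_ne_zero α hz), top_le_iff] at h1
    exact hA h1
  have hle : ∀ z, ∫⁻ w, modTube α z w * ‖conj (G w) * h w‖ₑ ∂tubeMeasure α ≤ E * I z := fun z => by
    rw [hI, ← lintegral_const_mul' _ _ hE]
    refine lintegral_mono_ae ?_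
    filter_upwards [ae_mem_tube α] with w hw
    rw [enorm_mul, RCLike.enorm_conj]
    calc modTube α z w * (‖G w‖ₑ * ‖h w‖ₑ)
        ≤ modTube α z w * ((E * ‖(φ w)⁻¹‖ₑ) * ‖h w‖ₑ) :=
          mul_le_mul' le_rfl (mul_le_mul' (hGE w hw) le_rfl)
      _ = _ := by ring
  have hdef : ToeplitzDefined α (fun w => conj (G w)) h := fun z hz =>
    integrable_tubeKernel_mul hα (hmG.mul hh.2.1)
      (ne_top_of_le_ne_top (ENNReal.mul_ne_top hE (hIT z hz)) (hle z))
  set u := toeplitz α (fun w => conj (G w)) h with hu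
  have hud : DifferentiableOn ℂ u (tube n) := differentiableOn_toeplitz hα hmG hh.2.1 hdef
  have hul : ∀ z, ‖u z‖ₑ ≤ tubeKernelConst α * (E * I z) := fun z =>
    (enorm_integral_tubeKernel_mul_le hα z _).trans (mul_le_mul' le_rfl (hle z))
  -- The estimate is made for the product `F u`, before `T_F u` is known to exist. Membership of `F
  -- u` in `A^p` then gives the absolute convergence of `T_F u`, and the reproducing formula
  -- identifies the two.
  have hnorm : tubeNorm p α (fun z => F z * u z) ≤ M * tubeNorm p α h := by
    set c := tubeKernelConst α * D * E with hc
    have hcT : c ≠ ∞ := ENNReal.mul_ne_top (ENNReal.mul_ne_top (tubeKernelConst_ne_top α) hD) hE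
    have h1 : ∫⁻ z, ‖F z * u z‖ₑ ^ p ∂tubeMeasure α ≤
        c ^ p * ∫⁻ z, (‖φ z‖ₑ * I z) ^ p ∂tubeMeasure α := by
      rw [← lintegral_const_mul' _ _ (ENNReal.rpow_ne_top_of_nonneg hp0.le hcT)]
      refine lintegral_mono_ae ?_
      filter_upwards [ae_mem_tube α] with z hz
      rw [← ENNReal.mul_rpow_of_nonneg _ _ hp0.le, enorm_mul]
      refine ENNReal.rpow_le_rpow ?_ hp0.le
      calc _ ≤ (D * ‖φ z‖ₑ) * (tubeKernelConst α * (E * I z)) := mul_le_mul' (hFD z hz) (hul z)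
        _ = _ := by rw [hc]; ring
    have h2 := h1.trans (mul_le_mul' le_rfl (H φ hφ hφ0 A hA hA' _ hmh))
    rw [← mul_assoc, ← ENNReal.mul_rpow_of_nonneg _ _ hp0.le] at h2
    have h3 : c * (C * A ^ ((n : ℝ) * max p q)) ≤ M := by
      refine le_trans (le_of_eq ?_) hM
      rw [hc]; ring
    rw [tubeNorm_eq hp0, tubeNorm_eq hp0]
    calc _ ≤ ((M : ℝ≥0∞) ^ p * ∫⁻ z, ‖h z‖ₑ ^ p ∂tubeMeasure α) ^ (1 / p) :=
          ENNReal.rpow_le_rpow (h2.trans (mul_le_mul' (ENNReal.rpow_le_rpow h3 hp0.le) le_rfl))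
            (by positivity)
      _ = _ := by
          rw [ENNReal.mul_rpow_of_nonneg _ _ (by positivity), ← ENNReal.rpow_mul,
            mul_one_div_cancel hp0.ne', ENNReal.rpow_one]
  have hFu : MemBergman p α (fun z => F z * u z) :=
    ⟨hF.mul hud, aestronglyMeasurable_of_differentiableOn α (hF.mul hud),
      hnorm.trans_lt (ENNReal.mul_lt_top ENNReal.coe_lt_top hh.2.2)⟩
  have hdef2 : ToeplitzDefined α F u := fun z hz =>
    integrable_tubeKernel_mul hα hFu.2.1 (hFu.lintegral_modTube_ne_top hpq hα hz)
  have heq : ∀ z ∈ tube n, toeplitz α F u z = F z * u z := fun z hz =>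
    toeplitz_eq hα hF hud hdef2 hz
  have hae : toeplitz α F u =ᵐ[tubeMeasure α] fun z => F z * u z := by
    filter_upwards [ae_mem_tube α] with z hz using heq z hz
  refine ⟨hdef, hdef2, ⟨hFu.1.congr heq, hFu.2.ae_eq hae.symm⟩, ?_⟩
  rwa [tubeNorm, eLpNorm_congr_ae hae]

/-! ### Lower bounds for Toeplitz products -/

lemma conj_halfPlaneKernel (a : ℝ) {z w : ℂ} (hz : z ∈ halfPlane) (hw : w ∈ halfPlane) :
    conj (halfPlaneKernel a z w) = halfPlaneKernel a w z := by
  have hz0 : 0 < z.im := hz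
  have hw0 : 0 < w.im := hw
  have hs : (z - conj w) / Complex.I ∈ Complex.slitPlane := by
    left
    have : ((z - conj w) / Complex.I).re = z.im + w.im := by simp [Complex.div_I]
    rw [this]; linarith
  have hs' := (Complex.mem_slitPlane_iff_arg.1 hs).1
  have h1 : conj ((z - conj w) / Complex.I) = (w - conj z) / Complex.I := by
    rw [Complex.div_I, Complex.div_I]
    simp
    ring
  rw [halfPlaneKernel, halfPlaneKernel, map_mul, Complex.conj_ofReal, ← h1,
    Complex.conj_cpow _ _ hs', Complex.conj_ofReal]

lemma conj_tubeKernel (α : Fin n → ℝ) {z w : Fin n → ℂ} (hz : z ∈ tube n) (hw : w ∈ tube n) :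
    conj (tubeKernel α z w) = tubeKernel α w z := by
  rw [tubeKernel, tubeKernel, map_prod]
  exact Finset.prod_congr rfl fun j _ => conj_halfPlaneKernel (α j) (hz j) (hw j)

lemma tubeNorm_tubeKernel {α : Fin n → ℝ} (hα : ∀ j, -1 < α j) {p : ℝ} (hp : 0 < p)
    (w : Fin n → ℂ) (g : (Fin n → ℂ) → ℂ) :
    tubeNorm p α (fun z => g z * tubeKernel α z w) =
      tubeKernelConst α * kernelNorm p α w (fun z => ‖g z‖ₑ) := by
  rw [tubeNorm_eq hp, kernelNorm]
  have : ∀ z, ‖g z * tubeKernel α z w‖ₑ ^ p =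
      tubeKernelConst α ^ p * (‖g z‖ₑ * modTube α z w) ^ p := fun z => by
    rw [enorm_mul, enorm_tubeKernel hα, ← ENNReal.mul_rpow_of_nonneg _ _ hp.le]
    congr 1; ring
  simp only [this]
  rw [lintegral_const_mul' _ _ (ENNReal.rpow_ne_top_of_nonneg hp.le (tubeKernelConst_ne_top α)),
    ENNReal.mul_rpow_of_nonneg _ _ (by positivity), ← ENNReal.rpow_mul,
    mul_one_div_cancel hp.ne', ENNReal.rpow_one]

lemma tubeNorm_tubeKernel_one {α : Fin n → ℝ} (hα : ∀ j, -1 < α j) {p : ℝ} (hp : 0 < p)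
    (w : Fin n → ℂ) :
    tubeNorm p α (fun z => tubeKernel α z w) = tubeKernelConst α * kernelNorm p α w (fun _ => 1) := by
  simpa using tubeNorm_tubeKernel hα hp w fun _ => 1

lemma memBergman_tubeKernel {α : Fin n → ℝ} (hα : ∀ j, -1 < α j) {p : ℝ} (hp : 1 < p)
    {w : Fin n → ℂ} (hw : w ∈ tube n) : MemBergman p α (fun z => tubeKernel α z w) := by
  have hd := differentiableOn_tubeKernel α hw
  refine ⟨hd, aestronglyMeasurable_of_differentiableOn α hd, ?_⟩
  have h := tubeNorm_tubeKernel_one hα (zero_lt_one.trans hp) w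
  rw [tubeNorm] at h
  rw [h]
  exact ENNReal.mul_lt_top (tubeKernelConst_ne_top α).lt_top (kernelNorm_one_ne_top hp hα hw).lt_top

/-- Kernel functions are eigenvectors of conjugate analytic Toeplitz operators. -/
theorem toeplitz_conj_tubeKernel {α : Fin n → ℝ} (hα : ∀ j, -1 < α j) {f : (Fin n → ℂ) → ℂ}
    (hf : DifferentiableOn ℂ f (tube n)) {w : Fin n → ℂ} (hw : w ∈ tube n)
    (h : ToeplitzDefined α (fun ζ => conj (f ζ)) fun ζ => tubeKernel α ζ w)
    {z : Fin n → ℂ} (hz : z ∈ tube n) :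
    toeplitz α (fun ζ => conj (f ζ)) (fun ζ => tubeKernel α ζ w) z =
      conj (f w) * tubeKernel α z w := by
  -- By Hermitian symmetry of the kernel, the conjugate of the Toeplitz integral reproduces the
  -- holomorphic function `f K_z` at `w`.
  have hae : (fun ζ => conj (tubeKernel α z ζ * (conj (f ζ) * tubeKernel α ζ w))) =ᵐ[tubeMeasure α]
      fun ζ => tubeKernel α w ζ * (f ζ * tubeKernel α ζ z) := by
    filter_upwards [ae_mem_tube α] with ζ hζ
    rw [map_mul, map_mul, conj_tubeKernel α hz hζ, conj_tubeKernel α hζ hw, Complex.conj_conj]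
    ring
  have hint : Integrable (fun ζ => tubeKernel α w ζ * (f ζ * tubeKernel α ζ z)) (tubeMeasure α) :=
    ((Complex.conjLIE.toContinuousLinearEquiv.toContinuousLinearMap.integrable_comp
      (h z hz)).congr hae)
  have key := integral_tubeKernel_mul hα (hf.mul (differentiableOn_tubeKernel α hz)) hw hint
  rw [toeplitz, ← Complex.conj_conj (∫ ζ, _ ∂_), ← integral_conj, integral_congr_ae hae]
  simp only [Pi.mul_apply] at key
  rw [key, map_mul, conj_tubeKernel α hw hz]

lemma tubeNorm_congr {p : ℝ} {α : Fin n → ℝ} {f g : (Fin n → ℂ) → ℂ}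
    (h : ∀ z ∈ tube n, f z = g z) : tubeNorm p α f = tubeNorm p α g := by
  refine eLpNorm_congr_ae ?_
  filter_upwards [ae_mem_tube α] with z hz using h z hz

/-- Testing a Toeplitz product on kernel functions. -/
theorem enorm_mul_kernelNorm_le {α : Fin n → ℝ} (hα : ∀ j, -1 < α j) {q : ℝ} (hq : 1 < q)
    {f g : (Fin n → ℂ) → ℂ} (hf : DifferentiableOn ℂ f (tube n))
    (hg : DifferentiableOn ℂ g (tube n)) {M : ℝ≥0} (hM : ToeplitzProductBoundedBy q α g f M)
    {w : Fin n → ℂ} (hw : w ∈ tube n) :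
    ‖f w‖ₑ * kernelNorm q α w (fun z => ‖g z‖ₑ) ≤ M * kernelNorm q α w (fun _ => 1) := by
  have hq0 : 0 < q := zero_lt_one.trans hq
  have hK := memBergman_tubeKernel hα hq hw
  obtain ⟨h1, h2, -, h4⟩ := hM _ hK
  have hmf : AEStronglyMeasurable (fun w => conj (f w)) (tubeMeasure α) :=
    Complex.continuous_conj.comp_aestronglyMeasurable (aestronglyMeasurable_of_differentiableOn α hf)
  have hu := differentiableOn_toeplitz hα hmf hK.2.1 h1
  have he : ∀ z ∈ tube n, toeplitz α g (toeplitz α (fun w => conj (f w))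
      fun z => tubeKernel α z w) z = (conj (f w) * g z) * tubeKernel α z w := fun z hz => by
    rw [toeplitz_eq hα hg hu h2 hz, toeplitz_conj_tubeKernel hα hf hw h1 hz]
    ring
  rw [tubeNorm_congr he, tubeNorm_tubeKernel hα hq0, tubeNorm_tubeKernel_one hα hq0,
    mul_left_comm, ENNReal.mul_le_mul_iff_right (tubeKernelConst_ne_zero hα)
      (tubeKernelConst_ne_top α)] at h4
  refine le_trans (le_of_eq ?_) h4
  simp only [kernelNorm, enorm_mul, RCLike.enorm_conj, mul_assoc,
    ENNReal.mul_rpow_of_nonneg _ _ hq0.le]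
  rw [lintegral_const_mul' _ _ (ENNReal.rpow_ne_top_of_nonneg hq0.le enorm_ne_top),
    ENNReal.mul_rpow_of_nonneg _ _ (by positivity), ← ENNReal.rpow_mul,
    mul_one_div_cancel hq0.ne', ENNReal.rpow_one]

lemma tubeHeight_rpow_mul_kernelNorm_one {α : Fin n → ℝ} {p q : ℝ} (hpq : p.HolderConjugate q)
    {w : Fin n → ℂ} (hw : w ∈ tube n) :
    tubeHeight α w ^ (1 / p) * kernelNorm q α w (fun _ => 1) =
      (∏ j, modKernelMass (α j) q) ^ (1 / q) := by
  have h0 := tubeHeight_ne_zero α hw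
  have hT := tubeHeight_ne_top α w
  have h := rpow_lintegral_modTube (α := α) hpq.symm.pos hw
  conv_lhs at h => rw [← rpow_conj_mul hpq h0 hT, mul_assoc]
  rw [ENNReal.mul_right_inj (ENNReal.rpow_pos (pos_iff_ne_zero.2 h0) hT).ne'
    (ENNReal.rpow_ne_top_of_ne_zero h0 hT)] at h
  simpa [kernelNorm] using h

/-- Insert `|f(w)| |f(w)⁻¹| = 1`. The factor `|f(w)|` goes with `‖g κ_w‖_q` into the hypothesis,
while `|f(w)⁻¹|` is bounded by `‖f⁻¹ κ_w‖_q`, which together with `‖f κ_w‖_p` produces `[f]`. The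
powers of the height cancel. Both lower bounds, from the product on `A^q` and from that on `A^p`,
end this way. -/
theorem sarasonConst_le_mul_invariantConst {α : Fin n → ℝ} (hα : ∀ j, -1 < α j) {p q : ℝ}
    (hpq : p.HolderConjugate q) {f g : (Fin n → ℂ) → ℂ} (hf : DifferentiableOn ℂ f (tube n))
    (hf0 : ∀ z ∈ tube n, f z ≠ 0) {B : ℝ≥0∞}
    (h : ∀ w ∈ tube n, ‖f w‖ₑ * kernelNorm q α w (fun z => ‖g z‖ₑ) ≤
      B * kernelNorm q α w (fun _ => 1)) :
    sarasonConst p q α f g ≤ pointwiseConst α p * (∏ j, modKernelMass (α j) q) ^ (1 / q) * B *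
      invariantConst p q α f := by
  have hd0 : normalizedConst α ^ 2 ≠ 0 := pow_ne_zero _ (normalizedConst_ne_zero hα)
  have hdT : normalizedConst α ^ 2 ≠ ∞ := ENNReal.pow_ne_top (normalizedConst_ne_top hα)
  refine (sarasonConst_le hα hpq.pos hpq.symm.pos f g (B := pointwiseConst α p *
    (∏ j, modKernelMass (α j) q) ^ (1 / q) * B * ((normalizedConst α ^ 2)⁻¹ *
      invariantConst p q α f)) fun w hw => ?_).trans (le_of_eq ?_)
  · have h1 := enorm_le_kernelNorm hα hpq.symm (hf.inv hf0) hw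
    have h2 := kernelNorm_mul_le_sarasonConst hα hpq.pos hpq.symm.pos hw f fun z => (f z)⁻¹
    have h3 := enorm_mul_enorm_inv (hf0 w hw)
    set kf := kernelNorm p α w (fun z => ‖f z‖ₑ)
    set kg := kernelNorm q α w (fun z => ‖g z‖ₑ)
    calc kf * kg * tubeHeight α w
        = (kf * ‖(f w)⁻¹‖ₑ * tubeHeight α w) * (‖f w‖ₑ * kg) := by
          rw [← one_mul (kf * kg * _), ← h3]; ring
      _ ≤ (kf * (pointwiseConst α p * tubeHeight α w ^ (1 / p) *
            kernelNorm q α w fun z => ‖(f z)⁻¹‖ₑ) * tubeHeight α w) *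
            (B * kernelNorm q α w (fun _ => 1)) :=
          mul_le_mul' (mul_le_mul' (mul_le_mul' le_rfl h1) le_rfl) (h w hw)
      _ = pointwiseConst α p * (tubeHeight α w ^ (1 / p) * kernelNorm q α w (fun _ => 1)) * B *
            (kf * kernelNorm q α w (fun z => ‖(f z)⁻¹‖ₑ) * tubeHeight α w) := by ring
      _ ≤ _ := by
          rw [tubeHeight_rpow_mul_kernelNorm_one hpq hw]
          exact mul_le_mul' le_rfl h2
  · calc _ = (normalizedConst α ^ 2 * (normalizedConst α ^ 2)⁻¹) * (pointwiseConst α p *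
          (∏ j, modKernelMass (α j) q) ^ (1 / q) * B * invariantConst p q α f) := by ring
      _ = _ := by rw [ENNReal.mul_inv_cancel hd0 hdT, one_mul]

/-- The Bergman projection is bounded on `L^p`. -/
theorem exists_tubeNorm_projection_le {p q : ℝ} (hpq : p.HolderConjugate q) {α : Fin n → ℝ}
    (hα : ∀ j, -1 < α j) :
    ∃ C : ℝ≥0∞, C ≠ ∞ ∧ ∀ v : (Fin n → ℂ) → ℂ, MemLp v (ENNReal.ofReal p) (tubeMeasure α) →
      MemBergman p α (toeplitz α (fun _ => 1) v) ∧
        tubeNorm p α (toeplitz α (fun _ => 1) v) ≤ C * tubeNorm p α v := by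
  have hp0 := hpq.pos
  obtain ⟨C, hC, H⟩ := exists_lintegral_modTube_weighted_le_of_aemeasurable hpq hα
  set A := (∏ j, modKernelMass (α j) p) ^ (1 / p) * (∏ j, modKernelMass (α j) q) ^ (1 / q) with hA
  have hAT : A ≠ ∞ := ENNReal.mul_ne_top
    (ENNReal.rpow_ne_top_of_nonneg (by positivity)
      (ENNReal.prod_ne_top fun j _ => modKernelMass_ne_top (hα j) hpq.lt))
    (ENNReal.rpow_ne_top_of_nonneg (one_div_nonneg.2 hpq.symm.nonneg)
      (ENNReal.prod_ne_top fun j _ => modKernelMass_ne_top (hα j) hpq.symm.lt))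
  have hN : 0 ≤ (n : ℝ) * max p q := mul_nonneg n.cast_nonneg (hp0.le.trans (le_max_left _ _))
  set D := tubeKernelConst α * (C * A ^ ((n : ℝ) * max p q)) with hD
  have hDT : D ≠ ∞ := ENNReal.mul_ne_top (tubeKernelConst_ne_top α)
    (ENNReal.mul_ne_top hC (ENNReal.rpow_ne_top_of_nonneg hN hAT))
  refine ⟨D, hDT, fun v hv => ?_⟩
  -- The weighted estimate with weight `1`: by homogeneity `‖κ_w‖_p ‖κ_w‖_q` times the height of `w`
  -- is the constant `A`.
  have key := H (fun _ => 1) (differentiableOn_const 1) (fun _ _ => one_ne_zero) A hAT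
    (fun w hw => by
      simp only [inv_one, enorm_one]
      rw [hA, ← tubeHeight_rpow_mul_kernelNorm_one hpq hw,
        ← tubeHeight_rpow_mul_kernelNorm_one hpq.symm hw]
      conv_lhs => rw [← rpow_conj_mul hpq (tubeHeight_ne_zero α hw) (tubeHeight_ne_top α w)]
      exact le_of_eq (by ring)) _ hv.1.enorm
  simp only [inv_one, enorm_one, one_mul] at key
  have hdef : ToeplitzDefined α (fun _ => 1) v := fun z hz => by
    simp only [one_mul]
    refine integrable_tubeKernel_mul hα hv.1 (ne_top_of_le_ne_top (ENNReal.mul_ne_top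
      (kernelNorm_one_ne_top hpq.symm.lt hα hz) ?_) (lintegral_modTube_mul_enorm_le hpq α z hv.1))
    exact hv.2.ne
  have hd := differentiableOn_toeplitz hα aestronglyMeasurable_const hv.1 hdef
  have hnorm : tubeNorm p α (toeplitz α (fun _ => 1) v) ≤ D * tubeNorm p α v := by
    rw [tubeNorm_eq hp0, tubeNorm_eq hp0]
    have h1 : ∫⁻ z, ‖toeplitz α (fun _ => 1) v z‖ₑ ^ p ∂tubeMeasure α ≤
        D ^ p * ∫⁻ z, ‖v z‖ₑ ^ p ∂tubeMeasure α := by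
      calc _ ≤ ∫⁻ z, tubeKernelConst α ^ p *
            (∫⁻ w, modTube α z w * ‖v w‖ₑ ∂tubeMeasure α) ^ p ∂tubeMeasure α := by
            refine lintegral_mono fun z => ?_
            rw [← ENNReal.mul_rpow_of_nonneg _ _ hp0.le]
            refine ENNReal.rpow_le_rpow ?_ hp0.le
            simpa only [toeplitz, one_mul] using enorm_integral_tubeKernel_mul_le hα z v
        _ ≤ _ := by
            rw [lintegral_const_mul' _ _ (ENNReal.rpow_ne_top_of_nonneg hp0.le
              (tubeKernelConst_ne_top α)), hD, ENNReal.mul_rpow_of_nonneg _ _ hp0.le, mul_assoc]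
            exact mul_le_mul' le_rfl key
    calc _ ≤ _ := ENNReal.rpow_le_rpow h1 (by positivity)
      _ = _ := by
          rw [ENNReal.mul_rpow_of_nonneg _ _ (by positivity), ← ENNReal.rpow_mul,
            mul_one_div_cancel hp0.ne', ENNReal.rpow_one]
  exact ⟨⟨hd, aestronglyMeasurable_of_differentiableOn α hd,
    hnorm.trans_lt (ENNReal.mul_lt_top hDT.lt_top hv.2)⟩, hnorm⟩

lemma enorm_integral_ofReal {X : Type*} [MeasurableSpace X] {μ : Measure X} {ρ : X → ℝ}
    (h0 : ∀ x, 0 ≤ ρ x) (h : Integrable ρ μ) :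
    ‖∫ x, (ρ x : ℂ) ∂μ‖ₑ = ∫⁻ x, ‖ρ x‖ₑ ∂μ := by
  rw [integral_complex_ofReal, ← ofReal_integral_norm_eq_lintegral_enorm h, ← ofReal_norm,
    Complex.norm_real, Real.norm_eq_abs, abs_of_nonneg (integral_nonneg h0)]
  congr 1
  exact integral_congr_ae (Eventually.of_forall fun x => (Real.norm_of_nonneg (h0 x)).symm)

/-- Converse of Hölder's inequality, tested on functions that are integrable against a given
majorant `J` of `X`. -/
theorem lintegral_enorm_rpow_le_of_forall {Ω : Type*} [MeasurableSpace Ω] {μ : Measure Ω}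
    [SigmaFinite μ] {p q : ℝ} (hpq : p.HolderConjugate q) {X : Ω → ℂ} (hX : Measurable X)
    {J : Ω → ℝ≥0∞} (hJ : Measurable J) (hJT : ∀ᵐ x ∂μ, J x ≠ ∞) (hXJ : ∀ᵐ x ∂μ, ‖X x‖ₑ ≤ J x)
    {B : ℝ≥0∞}
    (h : ∀ v : Ω → ℂ, MemLp v (ENNReal.ofReal p) μ → ∫⁻ x, ‖v x‖ₑ * J x ∂μ ≠ ∞ →
      ‖∫ x, v x * X x ∂μ‖ₑ ≤ B * (∫⁻ x, ‖v x‖ₑ ^ p ∂μ) ^ (1 / p)) :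
    ∫⁻ x, ‖X x‖ₑ ^ q ∂μ ≤ B ^ q := by
  have hp0 := hpq.pos
  have hq1 : 0 ≤ q - 1 := by linarith [hpq.symm.lt]
  -- On `{J ≤ N}` the bounded test functions with support of finite measure are integrable against
  -- `J`, so the hypothesis applies to them. As `J` is finite almost everywhere, these sets exhaust
  -- the space.
  have hE : ∀ N : ℕ, ∫⁻ x in {x | J x ≤ N}, ‖X x‖ₑ ^ q ∂μ ≤ B ^ q := by
    intro N
    set E := {x | J x ≤ N} with hEdef
    have hEm : MeasurableSet E := measurableSet_le hJ measurable_const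
    refine lintegral_rpow_le_of_forall_mul_le hpq.symm hX.enorm fun k => ?_
    set S := spanningSets (μ.restrict E) k with hS
    have hSm : MeasurableSet S := measurableSet_spanningSets _ k
    have hSf : μ.restrict E S < ∞ := measure_spanningSets_lt_top _ k
    set R : Ω → ℝ≥0∞ := S.indicator fun x => min ‖X x‖ₑ k ^ (q - 1) with hR
    have hRm : Measurable R := ((hX.enorm.min measurable_const).pow_const _).indicator hSm
    have hRle : ∀ x, R x ≤ S.indicator (fun _ => (k : ℝ≥0∞) ^ (q - 1)) x := fun x =>
      indicator_le_indicator (ENNReal.rpow_le_rpow (min_le_right _ _) hq1)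
    have hkT : (k : ℝ≥0∞) ^ (q - 1) ≠ ∞ :=
      ENNReal.rpow_ne_top_of_nonneg hq1 (ENNReal.natCast_ne_top k)
    have hRT : ∀ x, R x ≠ ∞ := fun x => ne_top_of_le_ne_top (by
      by_cases hx : x ∈ S <;> simp [hx, hkT]) (hRle x)
    have hRint : ∀ s : ℝ, 0 < s → ∫⁻ x in E, R x ^ s ∂μ ≠ ∞ := fun s hs => by
      refine ne_top_of_le_ne_top (b := ((k : ℝ≥0∞) ^ (q - 1)) ^ s * μ.restrict E S)
        (ENNReal.mul_ne_top (ENNReal.rpow_ne_top_of_nonneg hs.le hkT) hSf.ne) ?_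
      rw [← lintegral_indicator_const hSm]
      refine lintegral_mono fun x => ?_
      by_cases hx : x ∈ S
      · simpa [hx] using ENNReal.rpow_le_rpow (hRle x) hs.le
      · simp [hR, hx, hs]
    -- The phase makes `v X` equal to `R |X|` on `E`. Where `X` vanishes the quotient is `0` by
    -- convention, which is harmless.
    set v : Ω → ℂ := E.indicator fun x => ((R x).toReal : ℂ) * (conj (X x) / (‖X x‖ : ℂ)) with hv
    have hvm : Measurable v := by
      refine Measurable.indicator ?_ hEm
      have h1 : Measurable fun x => ((R x).toReal : ℂ) :=
        Complex.measurable_ofReal.comp hRm.ennreal_toReal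
      have h2 : Measurable fun x => (‖X x‖ : ℂ) := Complex.measurable_ofReal.comp hX.norm
      exact h1.mul ((Complex.continuous_conj.measurable.comp hX).div h2)
    have hvle : ∀ x, ‖v x‖ₑ ≤ E.indicator R x := fun x => by
      by_cases hx : x ∈ E
      · simp only [hv, indicator_of_mem hx]
        rw [enorm_mul]
        refine (mul_le_mul' (b := R x) (d := 1) (le_of_eq ?_) ?_).trans (mul_one _).le
        · rw [← ofReal_norm, Complex.norm_real, Real.norm_of_nonneg ENNReal.toReal_nonneg,
            ENNReal.ofReal_toReal (hRT x)]
        · rw [← ofReal_norm, norm_div, RCLike.norm_conj, Complex.norm_real, norm_norm,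
            ENNReal.ofReal_le_one]
          exact div_self_le_one _
      · simp [hv, hx]
    have hvint : ∀ s : ℝ, 0 < s → ∫⁻ x, ‖v x‖ₑ ^ s ∂μ ≤ ∫⁻ x in E, R x ^ s ∂μ := fun s hs => by
      rw [← lintegral_indicator hEm]
      refine lintegral_mono fun x => ?_
      by_cases hx : x ∈ E
      · simpa [hx] using ENNReal.rpow_le_rpow (hvle x) hs.le
      · simp [hv, hx, hs]
    have hvJ : ∫⁻ x, ‖v x‖ₑ * J x ∂μ ≠ ∞ := by
      have h1 : ∫⁻ x, ‖v x‖ₑ * N ∂μ ≠ ∞ := by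
        rw [lintegral_mul_const' _ _ (ENNReal.natCast_ne_top N)]
        refine ENNReal.mul_ne_top ?_ (ENNReal.natCast_ne_top N)
        have h2 := hvint 1 one_pos
        simp only [ENNReal.rpow_one] at h2
        refine ne_top_of_le_ne_top ?_ h2
        simpa using hRint 1 one_pos
      refine ne_top_of_le_ne_top h1 (lintegral_mono fun x => ?_)
      by_cases hx : x ∈ E
      · exact mul_le_mul' le_rfl hx
      · simp [hv, hx]
    have hvp : MemLp v (ENNReal.ofReal p) μ := by
      refine ⟨hvm.aestronglyMeasurable, ?_⟩
      rw [eLpNorm_eq_lintegral_rpow_enorm_toReal (ENNReal.ofReal_pos.2 hp0).ne'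
        ENNReal.ofReal_ne_top, ENNReal.toReal_ofReal hp0.le]
      exact (ENNReal.rpow_ne_top_of_nonneg (by positivity)
        (ne_top_of_le_ne_top (hRint p hp0) (hvint p hp0))).lt_top
    set ρ : Ω → ℝ := E.indicator fun x => (R x).toReal * ‖X x‖ with hρ
    have hρv : ∀ x, v x * X x = (ρ x : ℂ) := fun x => by
      by_cases hx : x ∈ E
      · simp only [hv, hρ, indicator_of_mem hx]
        rw [mul_assoc, div_mul_eq_mul_div, ← Complex.normSq_eq_conj_mul_self,
          Complex.normSq_eq_norm_sq]
        push_cast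
        rw [sq, mul_self_div_self]
      · simp [hv, hρ, hx]
    have hρ0 : ∀ x, 0 ≤ ρ x := fun x =>
      indicator_nonneg (fun x _ => mul_nonneg ENNReal.toReal_nonneg (norm_nonneg _)) x
    have hρm : Measurable ρ := (hRm.ennreal_toReal.mul hX.norm).indicator hEm
    have hρe : ∀ x, ‖ρ x‖ₑ = ‖v x‖ₑ * ‖X x‖ₑ := fun x => by
      rw [← enorm_mul, hρv, ← ofReal_norm, ← ofReal_norm, Complex.norm_real]
    have hρi : Integrable ρ μ := by
      refine ⟨hρm.aestronglyMeasurable, ?_⟩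
      rw [HasFiniteIntegral]
      refine (ne_top_of_le_ne_top hvJ (lintegral_mono_ae ?_)).lt_top
      filter_upwards [hXJ] with x hx
      rw [hρe]
      exact mul_le_mul' le_rfl hx
    have key := h v hvp hvJ
    simp only [hρv] at key
    rw [enorm_integral_ofReal hρ0 hρi] at key
    calc ∫⁻ x in E, ‖X x‖ₑ * R x ∂μ = ∫⁻ x, ‖ρ x‖ₑ ∂μ := by
          rw [← lintegral_indicator hEm]
          refine lintegral_congr fun x => ?_
          by_cases hx : x ∈ E
          · simp only [hρ, indicator_of_mem hx]
            rw [enorm_mul, enorm_norm, ← ofReal_norm (R x).toReal, Real.norm_of_nonneg ENNReal.toReal_nonneg,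
              ENNReal.ofReal_toReal (hRT x), mul_comm]
          · simp [hρ, hx]
      _ ≤ _ := key
      _ ≤ _ := mul_le_mul' le_rfl (ENNReal.rpow_le_rpow (hvint p hp0) (by positivity))
  have hmono : Directed (· ⊆ ·) fun N : ℕ => {x | J x ≤ N} :=
    directed_of_isDirected_le fun i j hij x (hx : J x ≤ i) =>
      show J x ≤ j from hx.trans (by exact_mod_cast hij)
  have hU : (⋃ N : ℕ, {x | J x ≤ N}) =ᵐ[μ] univ := by
    rw [eventuallyEq_univ]
    filter_upwards [hJT] with x hx
    obtain ⟨N, hN⟩ := ENNReal.exists_nat_gt hx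
    exact mem_iUnion.2 ⟨N, hN.le⟩
  rw [← setLIntegral_univ, ← setLIntegral_congr hU, setLIntegral_iUnion_of_directed _ hmono]
  exact iSup_le hE

/-- The pairing of a conjugate analytic Toeplitz operator with the projection of `v`. -/
theorem toeplitz_conj_projection {α : Fin n → ℝ} (hα : ∀ j, -1 < α j) {g v : (Fin n → ℂ) → ℂ}
    (hg : DifferentiableOn ℂ g (tube n)) (hv : AEStronglyMeasurable v (tubeMeasure α))
    (hdef : ∀ η ∈ tube n, ToeplitzDefined α (fun ζ => conj (g ζ)) fun ζ => tubeKernel α ζ η)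
    {w : Fin n → ℂ} (hw : w ∈ tube n)
    (hJ : ∫⁻ η, ‖v η‖ₑ * ∫⁻ ζ, ‖tubeKernel α w ζ * (conj (g ζ) * tubeKernel α ζ η)‖ₑ
      ∂tubeMeasure α ∂tubeMeasure α ≠ ∞) :
    toeplitz α (fun ζ => conj (g ζ)) (toeplitz α (fun _ => 1) v) w =
      ∫ η, v η * (tubeKernel α w η * conj (g η)) ∂tubeMeasure α := by
  have hmg : AEStronglyMeasurable (fun w => conj (g w)) (tubeMeasure α) :=
    Complex.continuous_conj.comp_aestronglyMeasurable (aestronglyMeasurable_of_differentiableOn α hg)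
  set Φ : (Fin n → ℂ) → (Fin n → ℂ) → ℂ := fun ζ η =>
    v η * (tubeKernel α w ζ * (conj (g ζ) * tubeKernel α ζ η)) with hΦ
  -- The hypothesis `hJ` is the joint integrability of `Φ`. After the exchange of integrals the
  -- inner one is `T_ḡ K_η` at `w`, an eigenvector identity.
  have hΦm : AEStronglyMeasurable (Function.uncurry Φ) ((tubeMeasure α).prod (tubeMeasure α)) := by
    refine (hv.comp_snd).mul ((AEStronglyMeasurable.comp_fst
      (measurable_tubeKernel_right α w).aestronglyMeasurable).mul ((hmg.comp_fst).mul ?_))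
    exact (measurable_tubeKernel α).aestronglyMeasurable
  have hΦi : Integrable (Function.uncurry Φ) ((tubeMeasure α).prod (tubeMeasure α)) := by
    refine ⟨hΦm, ?_⟩
    rw [HasFiniteIntegral, lintegral_prod_symm _ hΦm.enorm]
    refine lt_of_eq_of_lt (lintegral_congr fun η => ?_) hJ.lt_top
    simp only [Function.uncurry, hΦ, enorm_mul (v η)]
    rw [lintegral_const_mul' _ _ enorm_ne_top]
  have h1 : toeplitz α (fun ζ => conj (g ζ)) (toeplitz α (fun _ => 1) v) w =
      ∫ ζ, ∫ η, Φ ζ η ∂tubeMeasure α ∂tubeMeasure α := by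
    rw [toeplitz]
    refine integral_congr_ae (Eventually.of_forall fun ζ => ?_)
    simp only [toeplitz, hΦ]
    rw [← integral_const_mul, ← integral_const_mul]
    refine integral_congr_ae (Eventually.of_forall fun η => ?_)
    simp only
    ring
  rw [h1, integral_integral_swap hΦi]
  refine integral_congr_ae ?_
  filter_upwards [ae_mem_tube α] with η hη
  simp only [hΦ]
  rw [integral_const_mul]
  have h2 := toeplitz_conj_tubeKernel hα hg hη (hdef η hη) hw
  rw [toeplitz] at h2
  rw [h2, mul_comm (conj (g η))]

/-- The values of a bounded Toeplitz product. -/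
lemma enorm_mul_enorm_toeplitz_le {α : Fin n → ℝ} (hα : ∀ j, -1 < α j) {p q : ℝ}
    (hpq : p.HolderConjugate q) {f g : (Fin n → ℂ) → ℂ} (hf : DifferentiableOn ℂ f (tube n))
    (hg : DifferentiableOn ℂ g (tube n)) {M : ℝ≥0} (hM : ToeplitzProductBoundedBy p α f g M)
    {h : (Fin n → ℂ) → ℂ} (hh : MemBergman p α h) {w : Fin n → ℂ} (hw : w ∈ tube n) :
    ‖f w‖ₑ * ‖toeplitz α (fun ζ => conj (g ζ)) h w‖ₑ ≤
      tubeKernelConst α * kernelNorm q α w (fun _ => 1) * (M * tubeNorm p α h) := by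
  obtain ⟨h1, h2, h3, h4⟩ := hM h hh
  have hmg : AEStronglyMeasurable (fun w => conj (g w)) (tubeMeasure α) :=
    Complex.continuous_conj.comp_aestronglyMeasurable (aestronglyMeasurable_of_differentiableOn α hg)
  have hu := differentiableOn_toeplitz hα hmg hh.2.1 h1
  have he := toeplitz_eq hα hf hu h2 hw
  have hr := integral_tubeKernel_mul hα h3.1 hw
    (integrable_tubeKernel_mul hα h3.2.1 (h3.lintegral_modTube_ne_top hpq hα hw))
  rw [← enorm_mul, ← he, ← hr]
  refine (enorm_integral_tubeKernel_mul_le hα w _).trans ?_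
  rw [mul_assoc]
  exact mul_le_mul' le_rfl ((lintegral_modTube_mul_enorm_le hpq α w h3.2.1).trans
    (mul_le_mul' le_rfl h4))

/-- The inequality that kernel testing would give for the adjoint product, obtained without assuming
that product to be defined. The map sending `v` to `f(w) T_ḡ(P v)(w)` is bounded on `L^p` with norm
at most a constant times `M ‖κ_w‖_q`. By Fubini it is integration against `f(w) K(w, η)` times the
conjugate of `g(η)`, at least for those `v` for which the double integral converges absolutely, and
the converse of Hölder needs no others. -/
theorem exists_enorm_mul_kernelNorm_le {α : Fin n → ℝ} (hα : ∀ j, -1 < α j) {p q : ℝ}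
    (hpq : p.HolderConjugate q) :
    ∃ C : ℝ≥0∞, C ≠ ∞ ∧ ∀ f g : (Fin n → ℂ) → ℂ, DifferentiableOn ℂ f (tube n) →
      DifferentiableOn ℂ g (tube n) → (∀ z ∈ tube n, f z ≠ 0) → ∀ M : ℝ≥0,
      ToeplitzProductBoundedBy p α f g M → ∀ w ∈ tube n,
      ‖f w‖ₑ * kernelNorm q α w (fun z => ‖g z‖ₑ) ≤ C * M * kernelNorm q α w (fun _ => 1) := by
  obtain ⟨C, hC, H⟩ := exists_tubeNorm_projection_le hpq hα
  refine ⟨C, hC, fun f g hf hg hf0 M hM w hw => ?_⟩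
  have hp0 := hpq.pos
  have hq0 := hpq.symm.pos
  have hfw0 : ‖f w‖ₑ ≠ 0 := enorm_ne_zero.2 (hf0 w hw)
  set c := tubeKernelConst α with hc
  have hc0 : c ≠ 0 := tubeKernelConst_ne_zero hα
  have hcT : c ≠ ∞ := tubeKernelConst_ne_top α
  set k := kernelNorm q α w (fun _ => 1) with hk
  set B := ‖f w‖ₑ⁻¹ * (c * k * (M * C)) with hB
  have hdef : ∀ η ∈ tube n, ToeplitzDefined α (fun ζ => conj (g ζ)) fun ζ => tubeKernel α ζ η :=
    fun η hη => (hM _ (memBergman_tubeKernel hα hpq.lt hη)).1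
  have hmg : AEStronglyMeasurable (fun w => conj (g w)) (tubeMeasure α) :=
    Complex.continuous_conj.comp_aestronglyMeasurable (aestronglyMeasurable_of_differentiableOn α hg)
  have hmX : AEMeasurable (fun η => tubeKernel α w η * conj (g η)) (tubeMeasure α) :=
    ((measurable_tubeKernel_right α w).aestronglyMeasurable.mul hmg).aemeasurable
  set J : (Fin n → ℂ) → ℝ≥0∞ := fun η =>
    ∫⁻ ζ, ‖tubeKernel α w ζ * (conj (g ζ) * tubeKernel α ζ η)‖ₑ ∂tubeMeasure α with hJ
  have hmJ : AEMeasurable J (tubeMeasure α) := by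
    refine AEMeasurable.lintegral_prod_left' (μ := tubeMeasure α) (ν := tubeMeasure α)
      (f := fun x => ‖tubeKernel α w x.1 * (conj (g x.1) * tubeKernel α x.1 x.2)‖ₑ)
      (AEStronglyMeasurable.enorm ?_)
    refine (AEStronglyMeasurable.comp_fst
      (measurable_tubeKernel_right α w).aestronglyMeasurable).mul ((hmg.comp_fst).mul ?_)
    exact (measurable_tubeKernel α).aestronglyMeasurable
  -- Kernels belong to `A^p`, so the boundedness hypothesis includes the absolute convergence of
  -- `T_ḡ K_η` at `w`.
  have hJT : ∀ η ∈ tube n, J η ≠ ∞ := fun η hη => (hdef η hη w hw).2.ne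
  have hXJ : ∀ η ∈ tube n, ‖tubeKernel α w η * conj (g η)‖ₑ ≤ J η := fun η hη => by
    rw [mul_comm, ← toeplitz_conj_tubeKernel hα hg hη (hdef η hη) hw]
    exact enorm_integral_le_lintegral_enorm _
  have key := lintegral_enorm_rpow_le_of_forall (μ := tubeMeasure α) hpq hmX.measurable_mk
    hmJ.measurable_mk (B := B)
    (by filter_upwards [ae_mem_tube α, hmJ.ae_eq_mk] with η hη h1 using h1 ▸ hJT η hη)
    (by
      filter_upwards [ae_mem_tube α, hmJ.ae_eq_mk, hmX.ae_eq_mk] with η hη h1 h2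
      rw [← h1, ← h2]
      exact hXJ η hη) (fun v hv hvJ => by
      have hvJ' : ∫⁻ η, ‖v η‖ₑ * J η ∂tubeMeasure α ≠ ∞ := by
        rwa [lintegral_congr_ae (g := fun η => ‖v η‖ₑ * hmJ.mk J η)]
        filter_upwards [hmJ.ae_eq_mk] with η h1
        rw [h1]
      have hPv := H v hv
      have h1 := enorm_mul_enorm_toeplitz_le hα hpq hf hg hM hPv.1 hw
      rw [toeplitz_conj_projection hα hg hv.1 hdef hw hvJ'] at h1
      rw [integral_congr_ae (g := fun η => v η * (tubeKernel α w η * conj (g η)))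
        (by filter_upwards [hmX.ae_eq_mk] with η h1; rw [← h1]), ← tubeNorm_eq hp0, hB, mul_assoc,
        ← ENNReal.mul_le_iff_le_inv hfw0 enorm_ne_top]
      refine h1.trans ?_
      calc _ ≤ c * k * (M * (C * tubeNorm p α v)) :=
            mul_le_mul' le_rfl (mul_le_mul' le_rfl hPv.2)
        _ = _ := by ring)
  have h2 : c * kernelNorm q α w (fun z => ‖g z‖ₑ) ≤ B := by
    have h3 := ENNReal.rpow_le_rpow key (one_div_nonneg.2 hq0.le)
    rw [← ENNReal.rpow_mul B, mul_one_div_cancel hq0.ne', ENNReal.rpow_one] at h3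
    refine le_trans (le_of_eq ?_) h3
    rw [← tubeNorm_tubeKernel hα hq0, tubeNorm_eq hq0]
    congr 1
    refine lintegral_congr_ae ?_
    filter_upwards [hmX.ae_eq_mk] with η h1
    rw [← h1, enorm_mul, enorm_mul, RCLike.enorm_conj, enorm_tubeKernel hα, enorm_tubeKernel hα,
      modTube_comm, mul_comm]
  rw [hB, ← ENNReal.mul_le_iff_le_inv hfw0 enorm_ne_top] at h2
  refine (ENNReal.mul_le_mul_iff_right hc0 hcT).1 ?_
  calc _ = ‖f w‖ₑ * (c * kernelNorm q α w (fun z => ‖g z‖ₑ)) := by ring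
    _ ≤ _ := h2
    _ = _ := by ring

/-! ### Sarason's condition -/

/-- The constant in the pointwise bound for a product by its Sarason constant. -/
def sarasonPointwiseConst (p q : ℝ) (α : Fin n → ℝ) : ℝ≥0∞ :=
  pointwiseConst α q * pointwiseConst α p * (normalizedConst α ^ 2)⁻¹

lemma inv_normalizedConst_sq_ne_top {α : Fin n → ℝ} (hα : ∀ j, -1 < α j) :
    (normalizedConst α ^ 2)⁻¹ ≠ ∞ :=
  ENNReal.inv_ne_top.2 (pow_ne_zero _ (normalizedConst_ne_zero hα))

lemma sarasonPointwiseConst_ne_top {α : Fin n → ℝ} (hα : ∀ j, -1 < α j) {p q : ℝ}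
    (hpq : p.HolderConjugate q) : sarasonPointwiseConst p q α ≠ ∞ :=
  ENNReal.mul_ne_top (ENNReal.mul_ne_top (pointwiseConst_ne_top hα hpq.symm.lt)
    (pointwiseConst_ne_top hα hpq.lt)) (inv_normalizedConst_sq_ne_top hα)

lemma enorm_le_sarasonConst_mul_enorm_inv {α : Fin n → ℝ} (hα : ∀ j, -1 < α j) {p q : ℝ}
    (hpq : p.HolderConjugate q) {f g : (Fin n → ℂ) → ℂ} (hf : DifferentiableOn ℂ f (tube n))
    (hg : DifferentiableOn ℂ g (tube n)) {w : Fin n → ℂ} (hw : w ∈ tube n) (hf0 : f w ≠ 0) :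
    ‖g w‖ₑ ≤ sarasonPointwiseConst p q α * sarasonConst p q α f g * ‖(f w)⁻¹‖ₑ := by
  calc ‖g w‖ₑ = (‖f w‖ₑ * ‖g w‖ₑ) * ‖(f w)⁻¹‖ₑ := by
        rw [mul_right_comm, enorm_mul_enorm_inv hf0, one_mul]
    _ ≤ _ := mul_le_mul' (enorm_mul_enorm_le_sarasonConst hα hpq hf hg hw) le_rfl

/-- The pointwise bound for `f · f⁻¹ = 1` at a single point. Positivity is needed because `0 * ∞ =
0` in `ℝ≥0∞`. -/
lemma invariantConst_ne_zero {α : Fin n → ℝ} (hα : ∀ j, -1 < α j) {p q : ℝ}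
    (hpq : p.HolderConjugate q) {f : (Fin n → ℂ) → ℂ} (hf : DifferentiableOn ℂ f (tube n))
    (hf0 : ∀ z ∈ tube n, f z ≠ 0) : invariantConst p q α f ≠ 0 := fun h => by
  have hw : (fun _ => Complex.I : Fin n → ℂ) ∈ tube n := fun j => by simp
  have h1 := enorm_mul_enorm_le_sarasonConst hα hpq hf (hf.inv hf0) hw
  rw [invariantConst] at h
  simp only [Pi.inv_apply] at h1
  have h2 := enorm_mul_enorm_inv (hf0 _ hw)
  rw [h2] at h1
  change 1 ≤ _ * sarasonConst p q α f (fun z => (f z)⁻¹) at h1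
  rw [h, mul_zero] at h1
  exact one_ne_zero (nonpos_iff_eq_zero.1 h1)

/-- The weight is `f` itself, with `|g| ≤ k [f,g] |f|⁻¹`. Thus `[f,g]` enters linearly through the
pointwise bound, and only `[f]` is raised to the power coming from the weighted estimate. -/
theorem exists_toeplitzProductNorm_le {p q : ℝ} (hpq : p.HolderConjugate q) {α : Fin n → ℝ}
    (hα : ∀ j, -1 < α j) :
    ∃ C : ℝ≥0∞, C ≠ ∞ ∧ ∀ f g : (Fin n → ℂ) → ℂ, DifferentiableOn ℂ f (tube n) →
      DifferentiableOn ℂ g (tube n) → (∀ z ∈ tube n, f z ≠ 0) → invariantConst p q α f ≠ ∞ →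
      sarasonConst p q α f g ≠ ∞ → ToeplitzProductBounded p α f g ∧
        toeplitzProductNorm p α f g ≤ C * sarasonConst p q α f g *
          invariantConst p q α f ^ ((n : ℝ) * max p q) := by
  obtain ⟨C, hC, H⟩ := exists_toeplitzProductBoundedBy hpq hα
  have hN : 0 ≤ (n : ℝ) * max p q :=
    mul_nonneg n.cast_nonneg (hpq.nonneg.trans (le_max_left _ _))
  set N := (n : ℝ) * max p q
  set d := (normalizedConst α ^ 2)⁻¹ with hd
  have hdT : d ≠ ∞ := inv_normalizedConst_sq_ne_top hα
  set k := sarasonPointwiseConst p q α with hk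
  have hkT : k ≠ ∞ := sarasonPointwiseConst_ne_top hα hpq
  refine ⟨C * k * d ^ N, ENNReal.mul_ne_top (ENNReal.mul_ne_top hC hkT)
    (ENNReal.rpow_ne_top_of_nonneg hN hdT), fun f g hf hg hf0 hfT hfg => ?_⟩
  set R := C * k * d ^ N * sarasonConst p q α f g * invariantConst p q α f ^ N with hR
  have hRT : R ≠ ∞ := ENNReal.mul_ne_top (ENNReal.mul_ne_top (ENNReal.mul_ne_top
    (ENNReal.mul_ne_top hC hkT) (ENNReal.rpow_ne_top_of_nonneg hN hdT)) hfg)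
    (ENNReal.rpow_ne_top_of_nonneg hN hfT)
  have hB : ToeplitzProductBoundedBy p α f g R.toNNReal := by
    refine H f f g hf hf hg hf0 (d * invariantConst p q α f) (ENNReal.mul_ne_top hdT hfT)
      (fun w hw => kernelNorm_mul_le_sarasonConst hα hpq.pos hpq.symm.pos hw f _) 1
      (k * sarasonConst p q α f g) ENNReal.one_ne_top (ENNReal.mul_ne_top hkT hfg)
      (fun z _ => (one_mul _).ge)
      (fun z hz => enorm_le_sarasonConst_mul_enorm_inv hα hpq hf hg hz (hf0 z hz)) _ ?_
    rw [ENNReal.coe_toNNReal hRT, ENNReal.mul_rpow_of_nonneg _ _ hN, hR]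
    exact le_of_eq (by ring)
  refine ⟨⟨_, hB⟩, (iInf₂_le _ hB).trans (ENNReal.coe_toNNReal hRT).le⟩

/-- Sarason's condition gives boundedness of the dual product. -/
theorem toeplitzProductBounded_swap {p q : ℝ} (hpq : p.HolderConjugate q) {α : Fin n → ℝ}
    (hα : ∀ j, -1 < α j) {f g : (Fin n → ℂ) → ℂ} (hf : DifferentiableOn ℂ f (tube n))
    (hg : DifferentiableOn ℂ g (tube n)) (hf0 : ∀ z ∈ tube n, f z ≠ 0)
    (hfT : invariantConst p q α f ≠ ∞) (hfg : sarasonConst p q α f g ≠ ∞) :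
    ToeplitzProductBounded q α g f := by
  obtain ⟨C, hC, H⟩ := exists_toeplitzProductBoundedBy hpq.symm hα
  have hN : 0 ≤ (n : ℝ) * max q p :=
    mul_nonneg n.cast_nonneg (hpq.nonneg.trans (le_max_right _ _))
  set d := (normalizedConst α ^ 2)⁻¹ with hd
  have hdT : d ≠ ∞ := inv_normalizedConst_sq_ne_top hα
  set k := sarasonPointwiseConst p q α with hk
  have hkT : k ≠ ∞ := sarasonPointwiseConst_ne_top hα hpq
  have hAT : d * invariantConst p q α f ≠ ∞ := ENNReal.mul_ne_top hdT hfT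
  have hDT : k * sarasonConst p q α f g ≠ ∞ := ENNReal.mul_ne_top hkT hfg
  refine ⟨_, H (fun z => (f z)⁻¹) g f (hf.inv hf0) hg hf (fun z hz => inv_ne_zero (hf0 z hz))
    (d * invariantConst p q α f) hAT (fun w hw => ?_) (k * sarasonConst p q α f g) 1 hDT
    ENNReal.one_ne_top
    (fun z hz => enorm_le_sarasonConst_mul_enorm_inv hα hpq hf hg hz (hf0 z hz))
    (fun z _ => by simp only [inv_inv, one_mul, le_refl])
    (C * (k * sarasonConst p q α f g * 1) *
      (d * invariantConst p q α f) ^ ((n : ℝ) * max q p)).toNNReal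
    (ENNReal.coe_toNNReal (ENNReal.mul_ne_top (ENNReal.mul_ne_top hC (by rwa [mul_one]))
      (ENNReal.rpow_ne_top_of_nonneg hN hAT))).ge⟩
  simp only [inv_inv]
  rw [mul_comm (kernelNorm q α w _)]
  exact kernelNorm_mul_le_sarasonConst hα hpq.pos hpq.symm.pos hw f _

lemma exists_sarasonConst_le {p q : ℝ} (hpq : p.HolderConjugate q) {α : Fin n → ℝ}
    (hα : ∀ j, -1 < α j) :
    ∃ C : ℝ≥0∞, C ≠ ∞ ∧ ∀ f g : (Fin n → ℂ) → ℂ, DifferentiableOn ℂ f (tube n) →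
      DifferentiableOn ℂ g (tube n) → (∀ z ∈ tube n, f z ≠ 0) → ∀ M : ℝ≥0,
      ToeplitzProductBoundedBy q α g f M →
        sarasonConst p q α f g ≤ C * M * invariantConst p q α f := by
  refine ⟨pointwiseConst α p * (∏ j, modKernelMass (α j) q) ^ (1 / q),
    ENNReal.mul_ne_top (pointwiseConst_ne_top hα hpq.lt)
      (ENNReal.rpow_ne_top_of_nonneg (one_div_nonneg.2 hpq.symm.nonneg)
        (ENNReal.prod_ne_top fun j _ => modKernelMass_ne_top (hα j) hpq.symm.lt)), ?_⟩
  intro f g hf hg hf0 M hM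
  exact sarasonConst_le_mul_invariantConst hα hpq hf hf0 fun w hw =>
    enorm_mul_kernelNorm_le hα hpq.symm.lt hf hg hM hw

lemma sarasonConst_ne_top_of_toeplitzProductBounded {p q : ℝ} (hpq : p.HolderConjugate q)
    {α : Fin n → ℝ} (hα : ∀ j, -1 < α j) {f g : (Fin n → ℂ) → ℂ}
    (hf : DifferentiableOn ℂ f (tube n)) (hg : DifferentiableOn ℂ g (tube n))
    (hf0 : ∀ z ∈ tube n, f z ≠ 0) (hfT : invariantConst p q α f ≠ ∞)
    (h : ToeplitzProductBounded p α f g) : sarasonConst p q α f g ≠ ∞ := by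
  obtain ⟨C, hC, H⟩ := exists_enorm_mul_kernelNorm_le hα hpq
  obtain ⟨M, hM⟩ := h
  refine ne_top_of_le_ne_top ?_ (sarasonConst_le_mul_invariantConst hα hpq hf hf0
    fun w hw => H f g hf hg hf0 M hM w hw)
  exact ENNReal.mul_ne_top (ENNReal.mul_ne_top (ENNReal.mul_ne_top (pointwiseConst_ne_top hα hpq.lt)
      (ENNReal.rpow_ne_top_of_nonneg (one_div_nonneg.2 hpq.symm.nonneg)
        (ENNReal.prod_ne_top fun j _ => modKernelMass_ne_top (hα j) hpq.symm.lt)))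
    (ENNReal.mul_ne_top hC ENNReal.coe_ne_top)) hfT

end ToeplitzTube

end

/-! ### The main theorem -/

theorem mainTheorem5 (n : ℕ) (hn : 1 ≤ n) (α : Fin n → ℝ) (hα : ∀ j, -1 < α j)
    (p q : ℝ) (hp : 1 < p) (hpq : p = q * (p - 1)) :
    ∃ C : ℝ≥0, ∀ f g : (Fin n → ℂ) → ℂ,
      DifferentiableOn ℂ f (ToeplitzTube.tube n) →
      DifferentiableOn ℂ g (ToeplitzTube.tube n) →
      (∀ z ∈ ToeplitzTube.tube n, f z ≠ 0) →
      ToeplitzTube.invariantConst p q α f < ∞ →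
      (ToeplitzTube.ToeplitzProductBounded p α f g ↔
        ToeplitzTube.sarasonConst p q α f g < ∞) ∧
      (ToeplitzTube.ToeplitzProductBounded p α f g →
        ToeplitzTube.ToeplitzProductBounded q α g f) ∧
      ToeplitzTube.toeplitzProductNorm p α f g ≤
        C * ToeplitzTube.sarasonConst p q α f g *
          ToeplitzTube.invariantConst p q α f ^ ((n : ℝ) * max p q) ∧
      ToeplitzTube.sarasonConst p q α f g ≤
        C * ToeplitzTube.toeplitzProductNorm q α g f *
          ToeplitzTube.invariantConst p q α f := by
  have hconj : p.HolderConjugate q := by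
    rw [Real.holderConjugate_iff_eq_conjExponent hp, eq_div_iff (by linarith)]
    exact hpq.symm
  obtain ⟨C₁, hC₁, H₁⟩ := ToeplitzTube.exists_toeplitzProductNorm_le hconj hα
  obtain ⟨C₂, hC₂, H₂⟩ := ToeplitzTube.exists_sarasonConst_le hconj hα
  have hCT : C₁ + C₂ + 1 ≠ ∞ :=
    ENNReal.add_ne_top.2 ⟨ENNReal.add_ne_top.2 ⟨hC₁, hC₂⟩, ENNReal.one_ne_top⟩
  -- The summand `1` keeps the constant nonzero, so that the first bound is trivial when `[f,g] = ∞`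
  -- and division by the constant is possible in the second.
  refine ⟨(C₁ + C₂ + 1).toNNReal, fun f g hf hg hf0 hfT => ?_⟩
  rw [ENNReal.coe_toNNReal hCT]
  have hf1 := ToeplitzTube.invariantConst_ne_zero hconj hf hf0 (hα := hα)
  have hnec := ToeplitzTube.sarasonConst_ne_top_of_toeplitzProductBounded hconj hα hf hg hf0 hfT.ne
  have hC0 : C₁ + C₂ + 1 ≠ 0 := by simp
  refine ⟨⟨fun h => (hnec h).lt_top, fun h => (H₁ f g hf hg hf0 hfT.ne h.ne).1⟩, fun h =>
    ToeplitzTube.toeplitzProductBounded_swap hconj hα hf hg hf0 hfT.ne (hnec h), ?_, ?_⟩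
  · by_cases h : ToeplitzTube.sarasonConst p q α f g = ∞
    · rw [h, ENNReal.mul_top hC0,
        ENNReal.top_mul (ENNReal.rpow_pos (pos_iff_ne_zero.2 hf1) hfT.ne).ne']
      exact le_top
    · refine (H₁ f g hf hg hf0 hfT.ne h).2.trans (mul_le_mul' (mul_le_mul' ?_ le_rfl) le_rfl)
      rw [add_assoc]
      exact le_self_add
  · set D := (C₁ + C₂ + 1) * ToeplitzTube.invariantConst p q α f with hD
    have hD0 : D ≠ 0 := mul_ne_zero hC0 hf1
    have hDT : D ≠ ∞ := ENNReal.mul_ne_top hCT hfT.ne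
    -- After division by `D` the claim is a lower bound for the operator norm, checked on each
    -- admissible `M`; an unbounded product has norm `∞` and needs no separate case.
    rw [mul_right_comm, ← hD, mul_comm, ← ENNReal.div_le_iff hD0 hDT]
    refine le_iInf₂ fun M hM => (ENNReal.div_le_iff hD0 hDT).2 ((H₂ f g hf hg hf0 M hM).trans ?_)
    rw [mul_right_comm, mul_comm (M : ℝ≥0∞), hD]
    refine mul_le_mul' (mul_le_mul' ?_ le_rfl) le_rfl
    exact le_add_right le_add_self
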